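/- **Setting.** For each sample size $n$ let $p=p_n\ge 1$, $R_n\ge 1$ be integers, $s_n\ge 0$, $\lambda_n\ge 0$ reals, and put $V=\{1,\dots,p\}$. Let $X\in\mathbb R^p$ follow the additive structural equation model $$X_j=\sum_{k\in \mathrm{pa}(j)} f^\star_{kj}(X_k)+\epsilon_j,\qquad \epsilon_j\sim N(0,\sigma_j^{\star2})\ \text{mutually independent},\quad \sigma_j^\star>0,\quad \mathbb E f^\star_{kj}(X_k)=0,$$ where $\mathrm{pa}(j)$ is the parent set of $j$ in a DAG $\mathcal G^\star=(V,E^\star)$ and $f^\star_{kj}\not\equiv0$ iff $(k,j)\in E^\star$; the nonzero $f^\star_{kj}$ are non-linear and three times differentiable. The model may vary with $n$. One observes $n$ i.i.d. copies of $X$; $\|\cdot\|_n^2$ denotes the empirical second moment. Fix constants $K\in\mathbb N$, $C>0$, $\eta>1$, $\overline\sigma$, $\underline c>0$ that do not depend on $n$. For $k\ne j$ let $b_{rkj}$ ($r\ge1$) be three times differentiable functions on $\mathbb R$ with infinite support, $|b_{rkj}|\le1$ and $\mathbb E[b_{rkj}(X_k)b_{r'kj}(X_k)]=\upsilon\mathbf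 1(r=r')$ for some $\upsilon\in(0,1]$, and let $$\mathcal F_{kj}=\Big\{\beta_0+\sum_{r\ge1}\beta_r b_{rkj}:\ \sum_{r\ge1}|\beta_r|r^\eta\le C,\ \beta_0=-\mathbb E\Big[\sum_{r\ge1}\beta_rb_{rkj}(X_k)\Big]\Big\};$$ $\mathcal F_{kj,n}$ is the subset with $\beta_r=0$ for $r>R_n$. Let $E^\circ\supseteq E^\star$ be a set of ordered pairs of distinct nodes. For $g\subseteq\{k:(k,j)\in E^\circ\}$ let $\nu_j(g)=\inf\mathbb E\big(X_j-\sum_{k\in g}f_{k}(X_k)\big)^2$ over $f_{k}\in\mathcal F_{kj}$. A permutation $\pi$ (position $\mapsto$ node) is consistent with $E^\star$ if every edge goes from an earlier to a later node; $\Pi^\star$ is the set of these. With $g(\pi)_j=\{k:\pi^{-1}(k)<\pi^{-1}(j),(k,j)\in E^\circ\}$ let $$\xi_p=\min_{\pi\notin\Pi^\star}\frac1p\sum_{j=1}^p\big(\log\nu_j(g(\pi)_j)-\log\sigma_j^{\star2}\big),$$ with $\xi_p=+\infty$ if there is no such $\pi$. **Assumptions**, for every $n$: $|\{k:(k,j)\in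 E^\circ\}|\le K$ for all $j$; $|E^\star|\le s_n$; $f^\star_{kj}\in\mathcal F_{kj}$ for all $k\neq j$; $\sigma_j^{\star2}\le\overline\sigma^2$ and $\nu_j(g)\ge\underline c$ for all $j$ and all $g\subseteq\{k:(k,j)\in E^\circ\}$; there is $\phi>0$ with $\mathbb E\big(\sum_{k\ne j}\gamma_kf_{k}(X_k)\big)^2\ge\phi^2\sum_{k\ne j}\gamma_k^2$ for all $j$, $\gamma\in\mathbb R^p$ and $f_k\in\mathcal F_{kj}$ with $\mathbb E f_k(X_k)^2=1$. Moreover $\lambda_n^2s_n+p\sqrt{\log p/n}+s_nR_n^{-2\eta}=o(p\,\xi_p)$. **Estimators.** A parameter $\theta$ consists of functions $f_{kj}\in\mathcal F_{kj,n}$, given by their coefficients $(\beta_{rkj})_{r\le R_n}$, and of $\sigma_j>0$; its graph $\mathcal G(\theta)$ has the edge $(k,j)$ iff some $\beta_{rkj}\ne0$. It is feasible if $\mathcal G(\theta)$ is a DAG with edges in $E^\circ$ and $|\mathcal G(\theta)|\le s_n$ edges. Let $\widehat\theta$ be any minimizer over feasible $\theta$ of $$\sum_j\log\sigma_j^2+\sum_j\frac{\|X_j-\sum_{k\ne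 j}f_{kj}(X_k)\|_n^2}{\sigma_j^2}+\lambda_n^2|\mathcal G(\theta)|,$$ with variances $\widehat\sigma_j^2$. For $\tau^{\rm early}=\tau_n\ge0$, an early-stopped solution $\widehat\theta^{\rm early}$ is any feasible $\theta$ whose objective value exceeds the infimum by at most $\tau_n$; it is called profiled if $(\widehat\sigma_j^{\rm early})^2=\|X_j-\sum_{k\ne j}\widehat f^{\rm early}_{kj}(X_k)\|_n^2$ for all $j$, i.e. if its variances are optimal given its functions. **Theorem.** There are events $A_n$ with $\mathbb P(A_n)\ge1-5/p_n$ on which the following bounds hold; each $\lesssim$ means $\le D\cdot(\cdot)$ for all $n\ge N$, with constants $D,N$ that do not depend on $n$ or on the sample. $$\sum_{j=1}^p(\sigma_j^{\star2}-\widehat\sigma_j^2)^2\lesssim\frac{(p+s_nR_n)\log p}{n}+s_nR_n^{-2\eta}+\lambda_n^2s_n .$$ If moreover $s_n>0$, $s_nR_n^{-2\eta}+s_nR_n\log p/n\lesssim p\log p/n$ and $\lambda_n^2\asymp p\log p/(ns_n)$, then: 1. $\sum_j(\sigma_j^{\star2}-\widehat\sigma_j^2)^2\lesssim\lambda_n^2s_n$;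 2. if $\tau_n\lesssim\lambda_n^2s_n+(p+s_nR_n)\log p/n+s_nR_n^{-2\eta}$ and $\tau_n=o(p\,\xi_p)$, then $\sum_j\big(\sigma_j^{\star2}-(\widehat\sigma_j^{\rm early})^2\big)^2\lesssim\lambda_n^2s_n$ for every profiled early-stopped solution; if in addition $\tau_n=O(1)$, the same holds for every early-stopped solution, profiled or not. -/

import Mathlib

open MeasureTheory ProbabilityTheory Filter

noncomputable section

namespace CausalAdditive

/-- A directed graph on `Fin p`, given by its edge set (`(k, j)` stands for `k → j`), is acyclic. -/
def IsDAG {p : ℕ} (E : Finset (Fin p × Fin p)) : Prop :=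
  ∀ v, ¬ Relation.TransGen (fun k j => (k, j) ∈ E) v v

/-- An additive structural equation model with Gaussian errors on `p` nodes.
`P` is the law of `X = (X_1, …, X_p)`; the errors are recovered from `X` as
`ε_j = X_j - ∑_{k ∈ pa(j)} f_{kj}(X_k)`. -/
structure AdditiveSEM (p : ℕ) where
  /-- the edges of the true graph -/
  edges : Finset (Fin p × Fin p)
  /-- `f k j` is the effect of node `k` on node `j` -/
  f : Fin p → Fin p → ℝ → ℝ
  /-- the standard deviations of the errors -/
  σ : Fin p → ℝ
  /-- the joint law of the variables -/
  P : Measure (Fin p → ℝ)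
  isProb : IsProbabilityMeasure P
  acyclic : IsDAG edges
  measurable_f : ∀ k j, Measurable (f k j)
  f_ne_zero_iff : ∀ k j, f k j ≠ 0 ↔ (k, j) ∈ edges
  σ_pos : ∀ j, 0 < σ j
  integrable_f : ∀ k j, Integrable (fun x => f k j (x k)) P
  mean_zero : ∀ k j, ∫ x, f k j (x k) ∂P = 0
  noise_indep :
    iIndepFun (fun j (x : Fin p → ℝ) => x j - ∑ k with (k, j) ∈ edges, f k j (x k)) P
  noise_gaussian : ∀ j,
    P.map (fun x => x j - ∑ k with (k, j) ∈ edges, f k j (x k))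
      = gaussianReal 0 (σ j ^ 2).toNNReal

attribute [instance] AdditiveSEM.isProb

/-- The law of `n` independent samples of `X`. -/
def AdditiveSEM.sampleLaw {p : ℕ} (M : AdditiveSEM p) (n : ℕ) :
    Measure (Fin n → Fin p → ℝ) :=
  Measure.pi fun _ => M.P

/-- Three times differentiable (the third derivative need not be continuous). -/
def ThriceDifferentiable (f : ℝ → ℝ) : Prop :=
  ∀ m < 3, Differentiable ℝ (iteratedDeriv m f)

/-- All non-zero effects are non-linear and three times differentiable. -/
def AdditiveSEM.NonlinearSmooth {p : ℕ} (M : AdditiveSEM p) : Prop :=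
  ∀ k j, M.f k j ≠ 0 →
    (¬ ∃ a c : ℝ, ∀ x, M.f k j x = a * x + c) ∧ ThriceDifferentiable (M.f k j)

/-- A model together with the basis functions and the super-structure used for estimation.
`b k j r` is the `(r+1)`-st basis function of the pair `(k, j)`, for `r = 0, 1, 2, …`. -/
structure Setup (p : ℕ) where
  sem : AdditiveSEM p
  b : Fin p → Fin p → ℕ → ℝ → ℝ
  super : Finset (Fin p × Fin p)

/-- Coefficient sequences `(β_1, β_2, …)`, with `β r` standing for `β_{r+1}`, that satisfy
`∑_{r ≥ 1} |β_r| r^η ≤ C`. -/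
def SobolevBall (C η : ℝ) (β : ℕ → ℝ) : Prop :=
  Summable (fun r => |β r| * ((r : ℝ) + 1) ^ η) ∧ ∑' r, |β r| * ((r : ℝ) + 1) ^ η ≤ C

namespace Setup

variable {p : ℕ} (S : Setup p)

/-- The function `β_0 + ∑_r β_r b_{rkj}` with `β_0 = - E[∑_r β_r b_{rkj}(X_k)]`. -/
def expansion (k j : Fin p) (β : ℕ → ℝ) : ℝ → ℝ := fun t =>
  -(∫ x, ∑' r, β r * S.b k j r (x k) ∂S.sem.P) + ∑' r, β r * S.b k j r t

/-- The function class `F_{kj}`. -/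
def functionClass (C η : ℝ) (k j : Fin p) : Set (ℝ → ℝ) :=
  {f | ∃ β, SobolevBall C η β ∧ f = S.expansion k j β}

/-- The residual variance `ν_j(g)` of `X_j` after projection on the additive class over `g`. -/
def residualVar (C η : ℝ) (j : Fin p) (g : Finset (Fin p)) : ℝ :=
  sInf ((fun f : Fin p → ℝ → ℝ => ∫ x, (x j - ∑ k ∈ g, f k (x k)) ^ 2 ∂S.sem.P) ''
    {f | ∀ k ∈ g, f k ∈ S.functionClass C η k j})

/-- The candidate parents `{k : (k, j) ∈ E°}` of node `j`. -/
def candidates (j : Fin p) : Finset (Fin p) := {k | (k, j) ∈ S.super}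

/-- The permutation `π`, a map from positions to nodes, is consistent with the edge set `E`. -/
def _root_.CausalAdditive.Consistent (π : Equiv.Perm (Fin p)) (E : Finset (Fin p × Fin p)) :
    Prop :=
  ∀ k j, (π k, π j) ∈ E → k < j

/-- The candidate parents of `j` that precede `j` in the order `π`. -/
def parentsUnder (π : Equiv.Perm (Fin p)) (j : Fin p) : Finset (Fin p) :=
  {k | π⁻¹ k < π⁻¹ j ∧ (k, j) ∈ S.super}

/-- The separation `ξ_p`: the minimum, over all permutations that are not consistent with the true
graph, of the averaged excess log residual variance. It is `⊤` if there is no such permutation. -/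
def separation (C η : ℝ) : EReal :=
  ⨅ π : {π : Equiv.Perm (Fin p) // ¬ Consistent π S.sem.edges},
    (((p : ℝ)⁻¹ * ∑ j, (Real.log (S.residualVar C η j (S.parentsUnder π.1 j))
      - Real.log (S.sem.σ j ^ 2)) : ℝ) : EReal)

/-! ### Assumptions on a single model -/

/-- `E° ⊆ V × V` has no self-loops and contains the true edges; the true functions belong to the
function classes. -/
def WellSpecified (C η : ℝ) : Prop :=
  (∀ j, (j, j) ∉ S.super) ∧ S.sem.edges ⊆ S.super ∧
    ∀ k j, k ≠ j → S.sem.f k j ∈ S.functionClass C η k j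

/-- Every node has at most `K` candidate parents. -/
def SuperSparse (K : ℕ) : Prop := ∀ j, (S.candidates j).card ≤ K

/-- Smooth, uniformly bounded, orthogonal basis functions. -/
def GoodBasis : Prop :=
  (∀ k j, k ≠ j → ∀ r, ThriceDifferentiable (S.b k j r) ∧
    (Function.support (S.b k j r)).Infinite ∧ ∀ t, |S.b k j r t| ≤ 1) ∧
  ∃ υ : ℝ, 0 < υ ∧ υ ≤ 1 ∧ ∀ k j, k ≠ j → ∀ r r' : ℕ,
    ∫ x, S.b k j r (x k) * S.b k j r' (x k) ∂S.sem.P = if r = r' then υ else 0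

/-- Noise variances at most `σbar²`, residual variances at least `c`. -/
def BoundedVariances (C η σbar c : ℝ) : Prop :=
  (∀ j, S.sem.σ j ^ 2 ≤ σbar ^ 2) ∧
    ∀ j, ∀ g ⊆ S.candidates j, c ≤ S.residualVar C η j g

/-- Functional compatibility. -/
def Compatible (C η : ℝ) : Prop :=
  ∃ φ : ℝ, 0 < φ ∧ ∀ (j : Fin p) (γ : Fin p → ℝ) (f : Fin p → ℝ → ℝ),
    (∀ k, k ≠ j → f k ∈ S.functionClass C η k j ∧ ∫ x, (f k (x k)) ^ 2 ∂S.sem.P = 1) →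
    φ ^ 2 * ∑ k with k ≠ j, γ k ^ 2 ≤ ∫ x, (∑ k with k ≠ j, γ k * f k (x k)) ^ 2 ∂S.sem.P

end Setup

/-! ### The estimator -/

/-- A parameter: coefficients `β k j r` (for `β_{(r+1)kj}`) and standard deviations `σ j`. -/
structure Param (p : ℕ) where
  β : Fin p → Fin p → ℕ → ℝ
  σ : Fin p → ℝ

open Classical in
/-- The edges of the graph induced by a parameter. -/
def Param.edges {p : ℕ} (θ : Param p) : Finset (Fin p × Fin p) :=
  {e | ∃ r, θ.β e.1 e.2 r ≠ 0}

namespace Setup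

variable {p : ℕ} (S : Setup p)

/-- `‖X_j - ∑_{k ≠ j} f_{kj}(X_k)‖_n²` for the functions `f_{kj}` given by the parameter. -/
def empiricalResidual {n : ℕ} (x : Fin n → Fin p → ℝ) (θ : Param p) (j : Fin p) : ℝ :=
  (n : ℝ)⁻¹ * ∑ i, (x i j - ∑ k with k ≠ j, S.expansion k j (θ.β k j) (x i k)) ^ 2

/-- The penalized negative log-likelihood `ℓ_n(θ) + λ² |G(θ)|`. -/
def objective (lam : ℝ) {n : ℕ} (x : Fin n → Fin p → ℝ) (θ : Param p) : ℝ :=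
  ∑ j, Real.log (θ.σ j ^ 2) + ∑ j, S.empiricalResidual x θ j / θ.σ j ^ 2
    + lam ^ 2 * (θ.edges.card : ℝ)

/-- The feasible set: `f_{kj} ∈ F_{kj,n}` (only the first `R` basis functions are used), positive
`σ_j`, an acyclic graph inside the super-structure, at most `s` edges. -/
structure Feasible (C η : ℝ) (R : ℕ) (s : ℝ) (θ : Param p) : Prop where
  σ_pos : ∀ j, 0 < θ.σ j
  sobolev : ∀ k j, SobolevBall C η (θ.β k j)
  truncated : ∀ k j r, R ≤ r → θ.β k j r = 0
  acyclic : IsDAG θ.edges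
  subset_super : θ.edges ⊆ S.super
  card_le : (θ.edges.card : ℝ) ≤ s

/-- `θ` is feasible and its objective value exceeds the optimal value by at most `τ`. -/
def IsNearOptimal (C η : ℝ) (R : ℕ) (s lam τ : ℝ) {n : ℕ} (x : Fin n → Fin p → ℝ)
    (θ : Param p) : Prop :=
  S.Feasible C η R s θ ∧
    ∀ θ', S.Feasible C η R s θ' → S.objective lam x θ ≤ S.objective lam x θ' + τ

/-- `θ` is a minimizer of the penalized negative log-likelihood over the feasible set. -/
def IsEstimator (C η : ℝ) (R : ℕ) (s lam : ℝ) {n : ℕ} (x : Fin n → Fin p → ℝ)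
    (θ : Param p) : Prop :=
  S.Feasible C η R s θ ∧
    ∀ θ', S.Feasible C η R s θ' → S.objective lam x θ ≤ S.objective lam x θ'

/-- The variances of `θ` are the optimal ones for its functions, i.e. the empirical residuals. -/
def IsProfiled {n : ℕ} (x : Fin n → Fin p → ℝ) (θ : Param p) : Prop :=
  ∀ j, θ.σ j ^ 2 = S.empiricalResidual x θ j

/-- `∑_j (σ_j^{⋆2} - σ_j²)²` for the standard deviations `σ_j` of the parameter `θ`. -/
def varianceError (θ : Param p) : ℝ :=
  ∑ j, (S.sem.σ j ^ 2 - θ.σ j ^ 2) ^ 2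

end Setup

/-- `a_n = o(b_n)` for a real sequence `a` and a sequence `b` that may take the value `⊤`. -/
def NegligibleTo (a : ℕ → ℝ) (b : ℕ → EReal) : Prop :=
  ∀ ε : ℝ, 0 < ε → ∀ᶠ n in atTop, ((|a n| : ℝ) : EReal) ≤ (ε : EReal) * b n

end CausalAdditive

end

open MeasureTheory ProbabilityTheory Filter Asymptotics CausalAdditive

namespace CausalAdditive

/-! ### Concentration for independent samples -/

lemma exp_le_one_add_add_sq_mul_exp_abs (u : ℝ) :
    Real.exp u ≤ 1 + u + u ^ 2 * Real.exp |u| := by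
  have h1 : Real.exp u ≤ 1 + u * Real.exp u := by
    have h := Real.add_one_le_exp (-u)
    have h2 : Real.exp (-u) * Real.exp u = 1 := by rw [← Real.exp_add]; simp
    nlinarith [Real.exp_pos u]
  rcases le_total 0 u with hu | hu
  · rw [abs_of_nonneg hu]
    nlinarith [mul_le_mul_of_nonneg_left h1 hu]
  · have h3 := Real.add_one_le_exp u
    have h4 : 1 ≤ Real.exp |u| := Real.one_le_exp (abs_nonneg u)
    nlinarith [mul_le_mul_of_nonneg_left h4 (sq_nonneg u)]

/-- Chernoff bound for a sum over an independent sample. -/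
lemma chernoff_iid {Ω : Type*} [MeasurableSpace Ω] (μ : Measure Ω) [IsProbabilityMeasure μ]
    (Y : Ω → ℝ) (κ : ℝ) (hint : Integrable (fun ω => Real.exp (Y ω)) μ)
    (hκ : ∫ ω, Real.exp (Y ω) ∂μ ≤ Real.exp κ) (n : ℕ) (t : ℝ) :
    (Measure.pi (fun _ : Fin n => μ)).real {x | n * κ + t ≤ ∑ i, Y (x i)} ≤ Real.exp (-t) := by
  have he : ∀ x : Fin n → Ω, Real.exp (1 * ∑ i, Y (x i)) = ∏ i, Real.exp (Y (x i)) := by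
    intro x; rw [one_mul, Real.exp_sum]
  have h := measure_ge_le_exp_mul_mgf (μ := Measure.pi (fun _ : Fin n => μ))
    (X := fun x => ∑ i, Y (x i)) (t := 1) (n * κ + t) zero_le_one
    (by simp_rw [he]; exact Integrable.fintype_prod (fun _ => hint))
  refine h.trans ?_
  rw [mgf]
  simp_rw [he]
  rw [integral_fintype_prod_eq_pow (fun ω => Real.exp (Y ω)), Fintype.card_fin]
  calc Real.exp (-1 * (n * κ + t)) * (∫ ω, Real.exp (Y ω) ∂μ) ^ n
      ≤ Real.exp (-1 * (n * κ + t)) * (Real.exp κ) ^ n := by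
        gcongr
    _ = Real.exp (-t) := by
        rw [← Real.exp_nat_mul, ← Real.exp_add]; congr 1; ring

/-- A centred variable with an exponential moment is locally sub-Gaussian. -/
lemma integral_exp_centered_le {Ω : Type*} [MeasurableSpace Ω] (μ : Measure Ω)
    [IsProbabilityMeasure μ] {a M : ℝ} (ha : 0 < a) (Y : Ω → ℝ) (hY : Measurable Y)
    (hint : Integrable (fun ω => Real.exp (a * |Y ω|)) μ)
    (hM : ∫ ω, Real.exp (a * |Y ω|) ∂μ ≤ M) {s : ℝ} (hs : |s| ≤ a / 2) :
    Integrable (fun ω => Real.exp (s * (Y ω - ∫ ω', Y ω' ∂μ))) μ ∧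
      ∫ ω, Real.exp (s * (Y ω - ∫ ω', Y ω' ∂μ)) ∂μ
        ≤ Real.exp (8 / a ^ 2 * (M * Real.exp M) * s ^ 2) := by
  set m := ∫ ω', Y ω' ∂μ with hm
  have hYint : Integrable Y μ := by
    refine (hint.const_mul a⁻¹).mono' hY.aestronglyMeasurable (ae_of_all _ fun ω => ?_)
    have := Real.add_one_le_exp (a * |Y ω|)
    rw [Real.norm_eq_abs, inv_mul_eq_div, le_div_iff₀ ha]; nlinarith
  have hmM : a * |m| ≤ M := by
    have h1 : |m| ≤ ∫ ω, |Y ω| ∂μ := abs_integral_le_integral_abs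
    have h2 : ∫ ω, a * |Y ω| ∂μ ≤ ∫ ω, Real.exp (a * |Y ω|) ∂μ :=
      integral_mono (hYint.abs.const_mul a) hint fun ω => by
        have := Real.add_one_le_exp (a * |Y ω|); dsimp only; linarith
    rw [integral_const_mul] at h2
    nlinarith
  have hU : ∀ ω, Real.exp (a * |Y ω - m|) ≤ Real.exp M * Real.exp (a * |Y ω|) := by
    intro ω
    rw [← Real.exp_add]
    refine Real.exp_le_exp.2 ?_
    have := abs_sub (Y ω) m
    nlinarith
  have hUint : Integrable (fun ω => Real.exp (a * |Y ω - m|)) μ := by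
    refine (hint.const_mul (Real.exp M)).mono' (by fun_prop) (ae_of_all _ fun ω => ?_)
    rw [Real.norm_eq_abs, Real.abs_exp]; exact hU ω
  have hUle : ∫ ω, Real.exp (a * |Y ω - m|) ∂μ ≤ M * Real.exp M := by
    calc _ ≤ ∫ ω, Real.exp M * Real.exp (a * |Y ω|) ∂μ :=
          integral_mono hUint (hint.const_mul _) hU
      _ = Real.exp M * ∫ ω, Real.exp (a * |Y ω|) ∂μ := integral_const_mul _ _
      _ ≤ _ := by rw [mul_comm M]; gcongr
  have hpt : ∀ ω, Real.exp (s * (Y ω - m))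
      ≤ 1 + s * (Y ω - m) + s ^ 2 * (8 / a ^ 2) * Real.exp (a * |Y ω - m|) := by
    intro ω
    set u := Y ω - m
    refine (exp_le_one_add_add_sq_mul_exp_abs _).trans ?_
    have h1 : |s * u| ≤ a / 2 * |u| := by rw [abs_mul]; gcongr
    have h2 : u ^ 2 ≤ 8 / a ^ 2 * Real.exp (a / 2 * |u|) := by
      have := Real.quadratic_le_exp_of_nonneg (x := a / 2 * |u|) (by positivity)
      have h3 : (a / 2 * |u|) ^ 2 / 2 ≤ Real.exp (a / 2 * |u|) := by
        have : 0 ≤ a / 2 * |u| := by positivity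
        linarith
      rw [div_mul_eq_mul_div, le_div_iff₀ (by positivity)]
      rw [mul_pow, sq_abs] at h3
      nlinarith
    have h4 : (s * u) ^ 2 * Real.exp |s * u|
        ≤ s ^ 2 * (8 / a ^ 2) * Real.exp (a * |u|) := by
      calc (s * u) ^ 2 * Real.exp |s * u|
          = s ^ 2 * (u ^ 2 * Real.exp |s * u|) := by ring
        _ ≤ s ^ 2 * ((8 / a ^ 2 * Real.exp (a / 2 * |u|)) * Real.exp (a / 2 * |u|)) := by
            gcongr
        _ = s ^ 2 * (8 / a ^ 2) * Real.exp (a * |u|) := by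
            rw [mul_assoc (8 / a ^ 2), ← Real.exp_add]; ring_nf
    linarith
  have hi1 : Integrable (fun ω => Y ω - m) μ := hYint.sub (integrable_const m)
  have hi2 : Integrable (fun ω => 1 + s * (Y ω - m)
      + s ^ 2 * (8 / a ^ 2) * Real.exp (a * |Y ω - m|)) μ :=
    ((integrable_const (1 : ℝ)).add (hi1.const_mul s)).add (hUint.const_mul _)
  have hi3 : Integrable (fun ω => Real.exp (s * (Y ω - m))) μ := by
    refine hi2.mono' (by fun_prop) (ae_of_all _ fun ω => ?_)
    rw [Real.norm_eq_abs, Real.abs_exp]; exact hpt ω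
  refine ⟨hi3, (integral_mono hi3 hi2 hpt).trans ?_⟩
  have hi4 : Integrable (fun ω => 1 + s * (Y ω - m)) μ :=
    (integrable_const (1 : ℝ)).add (hi1.const_mul s)
  rw [integral_add hi4 (hUint.const_mul _),
    integral_add (integrable_const (1 : ℝ)) (hi1.const_mul s), integral_const_mul,
    integral_const_mul, integral_sub hYint (integrable_const m)]
  simp only [integral_const, probReal_univ, smul_eq_mul, mul_one, ← hm, sub_self,
    one_mul, mul_zero, add_zero]
  refine le_trans ?_ (Real.add_one_le_exp _)
  have : s ^ 2 * (8 / a ^ 2) * ∫ ω, Real.exp (a * |Y ω - m|) ∂μ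
      ≤ s ^ 2 * (8 / a ^ 2) * (M * Real.exp M) := by gcongr
  linarith

/-- Deviation inequality for empirical means of variables with an exponential moment, at the
scale `√(L / n)`. -/
lemma empirical_mean_deviation {Ω : Type*} [MeasurableSpace Ω] (μ : Measure Ω)
    [IsProbabilityMeasure μ] {a M : ℝ} (ha : 0 < a) (Y : Ω → ℝ) (hY : Measurable Y)
    (hint : Integrable (fun ω => Real.exp (a * |Y ω|)) μ)
    (hM : ∫ ω, Real.exp (a * |Y ω|) ∂μ ≤ M) {n : ℕ} {L B : ℝ} (hL : 0 < L)
    (hLn : L ≤ n) :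
    (Measure.pi (fun _ : Fin n => μ)).real
      {x | (4 / a * (M * Real.exp M) + 2 / a * B) * √(L / n)
        < |(n : ℝ)⁻¹ * ∑ i, Y (x i) - ∫ ω, Y ω ∂μ|} ≤ 2 * Real.exp (-(B * L)) := by
  have hn : (0 : ℝ) < n := hL.trans_le hLn
  set r := √(L / n) with hr
  have hr0 : 0 < r := Real.sqrt_pos.2 (by positivity)
  have hr2 : r ^ 2 = L / n := Real.sq_sqrt (by positivity)
  have hr1 : r ≤ 1 := by
    rw [hr, Real.sqrt_le_one]; rwa [div_le_one hn]
  set m := ∫ ω, Y ω ∂μ with hm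
  set κ := 8 / a ^ 2 * (M * Real.exp M) with hκ
  have key : ∀ s : ℝ, |s| = a / 2 * r →
      (Measure.pi (fun _ : Fin n => μ)).real
        {x | n * (κ * s ^ 2) + B * L ≤ ∑ i, s * (Y (x i) - m)} ≤ Real.exp (-(B * L)) := by
    intro s hs
    obtain ⟨h1, h2⟩ := integral_exp_centered_le μ ha Y hY hint hM (s := s)
      (by rw [hs]; nlinarith)
    exact chernoff_iid μ (fun ω => s * (Y ω - m)) _ h1 h2 n (B * L)
  have hsub : {x : Fin n → Ω | (4 / a * (M * Real.exp M) + 2 / a * B) * r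
        < |(n : ℝ)⁻¹ * ∑ i, Y (x i) - m|} ⊆
      {x | n * (κ * (a / 2 * r) ^ 2) + B * L ≤ ∑ i, (a / 2 * r) * (Y (x i) - m)} ∪
      {x | n * (κ * (-(a / 2 * r)) ^ 2) + B * L ≤ ∑ i, (-(a / 2 * r)) * (Y (x i) - m)} := by
    intro x hx
    simp only [Set.mem_ofPred_eq, Set.mem_union] at hx ⊢
    simp only [← Finset.mul_sum, Finset.sum_sub_distrib, Finset.sum_const, Finset.card_univ,
      Fintype.card_fin, nsmul_eq_mul]
    set Q := ∑ i, Y (x i)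
    have e1 : Q - n * m = n * ((n : ℝ)⁻¹ * Q - m) := by field_simp
    have e2 : n * (κ * (a / 2 * r) ^ 2) + B * L
        = n * (a / 2 * r) * ((4 / a * (M * Real.exp M) + 2 / a * B) * r) := by
      have : L = n * r ^ 2 := by rw [hr2]; field_simp
      rw [this, hκ]; field_simp; ring
    have hpos : 0 < n * (a / 2 * r) := by positivity
    rw [neg_sq, e1, e2]
    rcases lt_abs.1 hx with h | h
    · left; nlinarith
    · right; nlinarith
  calc _ ≤ _ := measureReal_mono hsub
    _ ≤ _ := measureReal_union_le _ _
    _ ≤ Real.exp (-(B * L)) + Real.exp (-(B * L)) := by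
        refine add_le_add (key _ ?_) (key _ ?_)
        · exact abs_of_pos (by positivity)
        · rw [abs_neg]; exact abs_of_pos (by positivity)
    _ = _ := by ring

/-! ### Gaussian tools -/

lemma integral_exp_sq_div_four_gaussian :
    Integrable (fun x : ℝ => Real.exp (x ^ 2 / 4)) (gaussianReal 0 1) ∧
      ∫ x, Real.exp (x ^ 2 / 4) ∂(gaussianReal 0 1) = √2 := by
  have hpt : ∀ x : ℝ, gaussianPDFReal 0 1 x * Real.exp (x ^ 2 / 4)
      = (√(2 * Real.pi))⁻¹ * Real.exp (-(1 / 4) * x ^ 2) := by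
    intro x
    simp only [gaussianPDFReal, NNReal.coe_one, mul_one, sub_zero]
    rw [mul_assoc, ← Real.exp_add]; ring_nf
  constructor
  · rw [gaussianReal_of_var_ne_zero _ one_ne_zero,
      integrable_withDensity_iff_integrable_smul' (measurable_gaussianPDF 0 1)
        (ae_of_all _ fun _ => gaussianPDF_lt_top)]
    simp only [toReal_gaussianPDF, smul_eq_mul, hpt]
    exact (integrable_exp_neg_mul_sq (by norm_num)).const_mul _
  · rw [integral_gaussianReal_eq_integral_smul one_ne_zero]
    simp only [smul_eq_mul, hpt]
    rw [integral_const_mul, integral_gaussian, ← Real.sqrt_inv, ← Real.sqrt_mul (by positivity)]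
    congr 1
    field_simp; norm_num

open scoped RealInnerProductSpace in
/-- The projection of a standard Gaussian vector on a subspace of dimension at most `d`. -/
lemma gaussian_projection_tail {n d : ℕ} (V : Submodule ℝ (EuclideanSpace ℝ (Fin n)))
    (hV : Module.finrank ℝ V ≤ d) (t : ℝ) :
    (Measure.pi (fun _ : Fin n => gaussianReal 0 1)).real
      {e | ∃ h ∈ V, 4 * (d * (Real.log 2 / 2) + t) * ‖h‖ ^ 2 < (∑ i, e i * h i) ^ 2}
      ≤ Real.exp (-t) := by
  classical
  set E := EuclideanSpace ℝ (Fin n)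
  set m := Module.finrank ℝ V with hm
  have hmn : m ≤ n := by
    have := Submodule.finrank_le V; rwa [finrank_euclideanSpace_fin] at this
  obtain ⟨b, hb⟩ : ∃ b : OrthonormalBasis (Fin n) ℝ E,
      ∀ i : Fin n, ∀ hi : (i : ℕ) < m, b i = (stdOrthonormalBasis ℝ V ⟨i, hi⟩ : E) := by
    let v : Fin n → E := fun i => if hi : (i : ℕ) < m then stdOrthonormalBasis ℝ V ⟨i, hi⟩ else 0
    have hv : Orthonormal ℝ (Set.domRestrict {i : Fin n | (i : ℕ) < m} v) := by
      have h0 : Orthonormal ℝ (fun i : Fin m => (stdOrthonormalBasis ℝ V i : E)) :=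
        (stdOrthonormalBasis ℝ V).orthonormal.comp_linearIsometry V.subtypeₗᵢ
      have h1 := h0.comp (fun i : {i : Fin n | (i : ℕ) < m} => (⟨i.1, i.2⟩ : Fin m))
        (fun i j hij => by
          apply Subtype.ext; apply Fin.ext; simpa using congrArg Fin.val hij)
      convert h1 using 1
      ext i : 1
      simp [Set.domRestrict, v, dif_pos (show ((i : Fin n) : ℕ) < m from i.2)]
    obtain ⟨b, hb⟩ := hv.exists_orthonormalBasis_extension_of_card_eq (by simp [E])
    refine ⟨b, fun i hi => ?_⟩
    rw [hb i hi]; simp [v, hi]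
  have hspan : ∀ h ∈ V, ∀ i : Fin n, ¬ ((i : ℕ) < m) → ⟪b i, h⟫ = 0 := by
    intro h hh i hi
    have h1 := (stdOrthonormalBasis ℝ V).sum_repr' ⟨h, hh⟩
    have h2 : h = ∑ k, ⟪stdOrthonormalBasis ℝ V k, ⟨h, hh⟩⟫ • (stdOrthonormalBasis ℝ V k : E) := by
      have := congrArg (V.subtype) h1
      rw [map_sum] at this
      exact this.symm
    rw [h2, inner_sum]
    refine Finset.sum_eq_zero fun k _ => ?_
    have hk : (stdOrthonormalBasis ℝ V k : E) = b ⟨k, k.2.trans_le hmn⟩ := by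
      rw [hb ⟨k, k.2.trans_le hmn⟩ k.2]
    rw [inner_smul_right, hk, b.inner_eq_ite, if_neg, mul_zero]
    rintro rfl
    exact hi k.2
  set γ := Measure.pi (fun _ : Fin n => gaussianReal 0 1) with hγ
  -- coordinates with respect to `b` have the same law
  set Φ : (Fin n → ℝ) → (Fin n → ℝ) := fun y => WithLp.ofLp (∑ i, y i • b i) with hΦ
  have hΦm : Measurable Φ := by
    have : Continuous Φ := by fun_prop
    exact this.measurable
  have hlaw : γ.map Φ = γ := by
    have h1 := map_pi_eq_stdGaussian (ι := Fin n)
    rw [stdGaussian_eq_map_pi_orthonormalBasis b] at h1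
    have h2 := congrArg (Measure.map (WithLp.ofLp : E → Fin n → ℝ)) h1
    have hof : Measurable (WithLp.ofLp : E → Fin n → ℝ) :=
      (by fun_prop : Continuous (WithLp.ofLp : E → Fin n → ℝ)).measurable
    have hto : Measurable (WithLp.toLp 2 : (Fin n → ℝ) → E) :=
      (by fun_prop : Continuous (WithLp.toLp 2 : (Fin n → ℝ) → E)).measurable
    rw [Measure.map_map hof hto, Measure.map_map hof
      (by fun_prop : Continuous (fun x : Fin n → ℝ => ∑ i, x i • b i)).measurable] at h2
    have h3 : (WithLp.ofLp : E → Fin n → ℝ) ∘ (WithLp.toLp 2) = id := rfl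
    rw [h3, Measure.map_id] at h2
    exact h2.symm
  set T : Set (Fin n → ℝ) :=
    {e | d * (Real.log 2 / 2) + t ≤ ∑ i with Fin.val i < m,
      (⟪b i, WithLp.toLp 2 e⟫) ^ 2 / 4} with hT
  have hTm : MeasurableSet T := by
    refine measurableSet_le measurable_const (Continuous.measurable ?_)
    fun_prop
  have hsub : {e : Fin n → ℝ | ∃ h ∈ V,
      4 * (d * (Real.log 2 / 2) + t) * ‖h‖ ^ 2 < (∑ i, e i * h i) ^ 2} ⊆ T := by
    rintro e ⟨h, hh, hlt⟩
    rw [hT, Set.mem_ofPred_eq]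
    by_contra hcon
    push Not at hcon
    have e1 : ∑ i, e i * h i = ∑ i with Fin.val i < m, ⟪b i, WithLp.toLp 2 e⟫ * ⟪b i, h⟫ := by
      have : ∑ i, e i * h i = ⟪WithLp.toLp 2 e, h⟫ := by
        simp [PiLp.inner_apply, mul_comm]
      rw [this, ← b.sum_inner_mul_inner, Finset.sum_filter]
      refine Finset.sum_congr rfl fun i _ => ?_
      split_ifs with hi
      · rw [real_inner_comm]
      · rw [hspan h hh i hi, mul_zero]
    have e2 : ∑ i with Fin.val i < m, ⟪b i, h⟫ ^ 2 ≤ ‖h‖ ^ 2 := by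
      rw [← b.sum_sq_inner_right h]
      exact Finset.sum_le_sum_of_subset_of_nonneg (Finset.filter_subset _ _)
        fun _ _ _ => sq_nonneg _
    have e3 := Finset.sum_mul_sq_le_sq_mul_sq
      (Finset.univ.filter (fun i : Fin n => (i : ℕ) < m))
      (fun i => ⟪b i, WithLp.toLp 2 e⟫) (fun i => ⟪b i, h⟫)
    rw [← e1] at e3
    rw [← Finset.sum_div] at hcon
    set Q := ∑ i with Fin.val i < m, ⟪b i, WithLp.toLp 2 e⟫ ^ 2 with hQ
    have hQ0 : 0 ≤ Q := Finset.sum_nonneg fun _ _ => sq_nonneg _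
    have : Q * ∑ i with Fin.val i < m, ⟪b i, h⟫ ^ 2 ≤ Q * ‖h‖ ^ 2 := by gcongr
    have h5 : Q ≤ 4 * (d * (Real.log 2 / 2) + t) := by linarith
    have : Q * ‖h‖ ^ 2 ≤ 4 * (d * (Real.log 2 / 2) + t) * ‖h‖ ^ 2 := by gcongr
    linarith
  refine (measureReal_mono hsub).trans ?_
  rw [← hlaw, measureReal_def, Measure.map_apply hΦm hTm, ← measureReal_def]
  have hpre : Φ ⁻¹' T = {y : Fin n → ℝ | d * (Real.log 2 / 2) + t
      ≤ ∑ i : Fin n, (if Fin.val i < m then y i ^ 2 / 4 else 0)} := by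
    ext y
    simp only [hT, hΦ, Set.mem_preimage, Set.mem_ofPred_eq, WithLp.toLp_ofLp, Finset.sum_filter]
    have : ∀ i, ⟪b i, ∑ k, y k • b k⟫ = y i := fun i => b.orthonormal.inner_right_fintype y i
    simp only [this]
  rw [hpre]
  set F : (Fin n) → ℝ → ℝ := fun i x => Real.exp (if (i : ℕ) < m then x ^ 2 / 4 else 0) with hF
  have he : ∀ y : Fin n → ℝ, Real.exp (1 * ∑ i, (if Fin.val i < m then y i ^ 2 / 4 else 0))
      = ∏ i, F i (y i) := by
    intro y; rw [one_mul, Real.exp_sum]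
  have hFint : ∀ i, Integrable (F i) (gaussianReal 0 1) := by
    intro i
    by_cases hi : (i : ℕ) < m
    · simp only [hF, hi, if_true]; exact integral_exp_sq_div_four_gaussian.1
    · simp only [hF, hi, if_false]; exact integrable_const _
  have h := measure_ge_le_exp_mul_mgf (μ := γ)
    (X := fun y => ∑ i, (if Fin.val i < m then y i ^ 2 / 4 else 0)) (t := 1)
    (d * (Real.log 2 / 2) + t) zero_le_one
    (by simp_rw [he]; exact Integrable.fintype_prod hFint)
  refine h.trans ?_
  rw [mgf]
  simp_rw [he]
  rw [hγ, integral_fintype_prod_eq_prod]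
  have hval : ∀ i : Fin n, ∫ x, F i x ∂(gaussianReal 0 1) = if (i : ℕ) < m then √2 else 1 := by
    intro i
    by_cases hi : (i : ℕ) < m
    · simp only [hF, hi, if_true]; exact integral_exp_sq_div_four_gaussian.2
    · simp [hF, hi]
  simp_rw [hval]
  rw [Finset.prod_ite, Finset.prod_const, Finset.prod_const_one, mul_one]
  have hcard : (Finset.univ.filter (fun i : Fin n => (i : ℕ) < m)).card ≤ d := by
    refine le_trans ?_ hV
    have := Finset.card_le_card_of_injOn (s := Finset.univ.filter (fun i : Fin n => (i : ℕ) < m))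
      (t := Finset.range m) (fun i => (i : ℕ)) (by intro i hi; simpa using hi)
      (fun i _ j _ hij => Fin.ext hij)
    simpa using this
  have hs2 : √2 = Real.exp (Real.log 2 / 2) := by
    rw [Real.sqrt_eq_rpow, Real.rpow_def_of_pos two_pos]; ring_nf
  calc Real.exp (-1 * (d * (Real.log 2 / 2) + t)) * √2 ^ _
      ≤ Real.exp (-1 * (d * (Real.log 2 / 2) + t)) * √2 ^ d := by
        gcongr
        exact Real.one_le_sqrt.2 (by norm_num)
    _ = Real.exp (-t) := by
        rw [hs2, ← Real.exp_nat_mul, ← Real.exp_add]; congr 1; ring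

/-- The projection bound for a Gaussian sample and a finite-dimensional space of functions of an
independent vector. -/
lemma sample_projection_tail {Ω ι : Type*} [MeasurableSpace Ω] [Fintype ι] (μ : Measure Ω)
    [IsProbabilityMeasure μ] (e : Ω → ℝ) (he : Measurable e) (hlaw : μ.map e = gaussianReal 0 1)
    (u : Ω → ι → ℝ) (hu : Measurable u) (hind : IndepFun e u μ) {n d : ℕ}
    (hd : Fintype.card ι ≤ d) (t : ℝ) :
    (Measure.pi (fun _ : Fin n => μ)).real
      {x | ∃ a : ι → ℝ, 4 * (d * (Real.log 2 / 2) + t) * ∑ i, (∑ l, a l * u (x i) l) ^ 2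
        < (∑ i, e (x i) * ∑ l, a l * u (x i) l) ^ 2} ≤ Real.exp (-t) := by
  classical
  set τ := 4 * (d * (Real.log 2 / 2) + t) with hτ
  set ν := μ.map u with hν
  have : IsProbabilityMeasure ν := Measure.isProbabilityMeasure_map hu.aemeasurable
  have hjoint : μ.map (fun ω => (e ω, u ω)) = (gaussianReal 0 1).prod ν := by
    rw [(indepFun_iff_map_prod_eq_prod_map_map he.aemeasurable hu.aemeasurable).1 hind, hlaw]
  let ψ : (Fin n → Ω) → (Fin n → ℝ) × (Fin n → ι → ℝ) :=
    fun x => (fun i => e (x i), fun i => u (x i))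
  have hψ : Measurable ψ := by fun_prop
  have hmap : (Measure.pi (fun _ : Fin n => μ)).map ψ
      = (Measure.pi (fun _ : Fin n => gaussianReal 0 1)).prod (Measure.pi (fun _ : Fin n => ν)) := by
    have h1 := (measurePreserving_arrowProdEquivProdArrow ℝ (ι → ℝ) (Fin n)
      (fun _ => gaussianReal 0 1) (fun _ => ν)).map_eq
    rw [← h1, ← hjoint]
    have hpm : ∀ i : Fin n, SigmaFinite (Measure.map (fun ω => (e ω, u ω)) μ) := by
      intro _; rw [hjoint]; infer_instance
    have h2 := Measure.pi_map_pi (μ := fun _ : Fin n => μ)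
      (f := fun _ ω => (e ω, u ω)) (fun _ => (he.prodMk hu).aemeasurable)
    rw [← h2, Measure.map_map (MeasurableEquiv.measurable _) (by fun_prop)]
    rfl
  let B : Set ((Fin n → ℝ) × (Fin n → ι → ℝ)) :=
    {z | ∃ a : ι → ℝ, τ * ∑ i, (∑ l, a l * z.2 i l) ^ 2 < (∑ i, z.1 i * ∑ l, a l * z.2 i l) ^ 2}
  have hBm : MeasurableSet B := by
    have : B = ⋃ a : ι → ℚ, {z | τ * ∑ i, (∑ l, (a l : ℝ) * z.2 i l) ^ 2
        < (∑ i, z.1 i * ∑ l, (a l : ℝ) * z.2 i l) ^ 2} := by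
      ext z
      simp only [B, Set.mem_ofPred_eq, Set.mem_iUnion]
      constructor
      · rintro ⟨a, ha⟩
        have hopen : IsOpen {a : ι → ℝ | τ * ∑ i, (∑ l, a l * z.2 i l) ^ 2
            < (∑ i, z.1 i * ∑ l, a l * z.2 i l) ^ 2} :=
          isOpen_lt (by fun_prop) (by fun_prop)
        have hdense : DenseRange (fun (q : ι → ℚ) (l : ι) => (q l : ℝ)) :=
          DenseRange.piMap (fun _ => Rat.denseRange_cast)
        obtain ⟨q, hq⟩ := hdense.exists_mem_open hopen ⟨a, ha⟩
        exact ⟨q, hq⟩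
      · rintro ⟨a, ha⟩
        exact ⟨fun l => a l, ha⟩
    rw [this]
    refine MeasurableSet.iUnion fun a => measurableSet_lt ?_ ?_
    · exact (by fun_prop : Continuous fun z : (Fin n → ℝ) × (Fin n → ι → ℝ) =>
        τ * ∑ i, (∑ l, (a l : ℝ) * z.2 i l) ^ 2).measurable
    · exact (by fun_prop : Continuous fun z : (Fin n → ℝ) × (Fin n → ι → ℝ) =>
        (∑ i, z.1 i * ∑ l, (a l : ℝ) * z.2 i l) ^ 2).measurable
  have hset : {x : Fin n → Ω | ∃ a : ι → ℝ, τ * ∑ i, (∑ l, a l * u (x i) l) ^ 2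
        < (∑ i, e (x i) * ∑ l, a l * u (x i) l) ^ 2} = ψ ⁻¹' B := rfl
  rw [hset, measureReal_def, ← Measure.map_apply hψ hBm, hmap]
  refine ENNReal.toReal_le_of_le_ofReal (Real.exp_pos _).le ?_
  rw [Measure.prod_apply_symm hBm]
  have hslice : ∀ w : Fin n → ι → ℝ,
      (Measure.pi (fun _ : Fin n => gaussianReal 0 1)) ((fun y => (y, w)) ⁻¹' B)
        ≤ ENNReal.ofReal (Real.exp (-t)) := by
    intro w
    set q : ι → EuclideanSpace ℝ (Fin n) := fun l => WithLp.toLp 2 (fun i => w i l) with hq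
    set V := Submodule.span ℝ (Set.range q)
    have hfin : Module.finrank ℝ V ≤ d := (finrank_range_le_card q).trans hd
    have h := gaussian_projection_tail V hfin t
    rw [← ENNReal.ofReal_toReal (measure_ne_top _ ((fun y => (y, w)) ⁻¹' B))]
    refine ENNReal.ofReal_le_ofReal (le_trans ?_ h)
    rw [← measureReal_def]
    refine measureReal_mono ?_
    rintro y ⟨a, ha⟩
    refine ⟨∑ l, a l • q l, Submodule.sum_mem _ fun l _ => Submodule.smul_mem _ _
      (Submodule.subset_span ⟨l, rfl⟩), ?_⟩
    have hco : ∀ i, (∑ l, a l • q l) i = ∑ l, a l * w i l := by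
      intro i
      simp [hq]
    rw [EuclideanSpace.real_norm_sq_eq]
    simp only [hco]
    exact ha
  calc _ ≤ ∫⁻ _, ENNReal.ofReal (Real.exp (-t)) ∂(Measure.pi (fun _ : Fin n => ν)) :=
        lintegral_mono hslice
    _ = _ := by simp

end CausalAdditive

namespace CausalAdditive

noncomputable section

/-! ### The noise variables -/

namespace AdditiveSEM

variable {p : ℕ} (M : AdditiveSEM p)

/-- The parents of `j`. -/
def parents (j : Fin p) : Finset (Fin p) := {k | (k, j) ∈ M.edges}

/-- The conditional mean `∑_{k ∈ pa(j)} f_{kj}(X_k)`. -/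
def signal (j : Fin p) (x : Fin p → ℝ) : ℝ := ∑ k ∈ M.parents j, M.f k j (x k)

/-- The error `ε_j`. -/
def noise (j : Fin p) (x : Fin p → ℝ) : ℝ := x j - M.signal j x

/-- The information in the variables `X_k`, `k ∈ B`. -/
abbrev coordSigma (B : Set (Fin p)) : MeasurableSpace (Fin p → ℝ) :=
  ⨆ k ∈ B, MeasurableSpace.comap (fun x : Fin p → ℝ => x k) inferInstance

lemma mem_parents {k j : Fin p} : k ∈ M.parents j ↔ (k, j) ∈ M.edges := by simp [parents]

lemma measurable_signal (j : Fin p) : Measurable (M.signal j) :=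
  Finset.measurable_fun_sum _ fun k _ => (M.measurable_f k j).comp (measurable_pi_apply k)

lemma measurable_noise (j : Fin p) : Measurable (M.noise j) :=
  (measurable_pi_apply j).sub (M.measurable_signal j)

lemma noise_law (j : Fin p) : M.P.map (M.noise j) = gaussianReal 0 (M.σ j ^ 2).toNNReal :=
  M.noise_gaussian j

lemma iIndepFun_noise : iIndepFun M.noise M.P := M.noise_indep

lemma standardized_noise_law (j : Fin p) :
    M.P.map (fun x => M.noise j x / M.σ j) = gaussianReal 0 1 := by
  have h : (fun x => M.noise j x / M.σ j) = (fun y => y / M.σ j) ∘ M.noise j := rfl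
  rw [h, ← Measure.map_map (by fun_prop) (M.measurable_noise j), noise_law,
    gaussianReal_map_div_const, zero_div]
  congr 1
  have := M.σ_pos j
  ext
  rw [NNReal.coe_div, Real.coe_toNNReal _ (sq_nonneg _)]
  simp [this.ne']

lemma integral_noise_sq (j : Fin p) :
    Integrable (fun x => M.noise j x ^ 2) M.P ∧ ∫ x, M.noise j x ^ 2 ∂M.P = M.σ j ^ 2 := by
  have hlaw := M.noise_law j
  have hm := (M.measurable_noise j).aemeasurable (μ := M.P)
  have hint : Integrable (fun y : ℝ => y ^ 2) (gaussianReal 0 (M.σ j ^ 2).toNNReal) :=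
    (memLp_id_gaussianReal' 2 (by simp)).integrable_sq
  constructor
  · have h2 := hint
    rw [← hlaw, integrable_map_measure (by fun_prop) hm] at h2
    exact h2
  · have h1 : ∫ x, M.noise j x ^ 2 ∂M.P = ∫ y, y ^ 2 ∂(M.P.map (M.noise j)) := by
      rw [integral_map hm (by fun_prop)]
    rw [h1, hlaw]
    have h2 := variance_fun_id_gaussianReal (μ := 0) (v := (M.σ j ^ 2).toNNReal)
    rw [variance_eq_integral (by fun_prop), integral_id_gaussianReal] at h2
    simpa [max_eq_left (sq_nonneg (M.σ j))] using h2

lemma integral_noise (j : Fin p) :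
    Integrable (M.noise j) M.P ∧ ∫ x, M.noise j x ∂M.P = 0 := by
  have hlaw := M.noise_law j
  have hm := (M.measurable_noise j).aemeasurable (μ := M.P)
  constructor
  · have h2 : Integrable (fun y : ℝ => y) (gaussianReal 0 (M.σ j ^ 2).toNNReal) :=
      (memLp_id_gaussianReal' 1 (by simp)).integrable le_rfl
    rw [← hlaw, integrable_map_measure (by fun_prop) hm] at h2
    exact h2
  · have h1 : ∫ x, M.noise j x ∂M.P = ∫ y, y ∂(M.P.map (M.noise j)) := by
      rw [integral_map hm (by fun_prop)]
    rw [h1, hlaw, integral_id_gaussianReal]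

lemma exp_noise_sq (j : Fin p) :
    Integrable (fun x => Real.exp ((M.noise j x / M.σ j) ^ 2 / 4)) M.P ∧
      ∫ x, Real.exp ((M.noise j x / M.σ j) ^ 2 / 4) ∂M.P = √2 := by
  have hlaw := M.standardized_noise_law j
  have hm : AEMeasurable (fun x => M.noise j x / M.σ j) M.P :=
    ((M.measurable_noise j).div_const _).aemeasurable
  obtain ⟨h1, h2⟩ := integral_exp_sq_div_four_gaussian
  constructor
  · rw [← hlaw, integrable_map_measure (by fun_prop) hm] at h1
    exact h1
  · rw [← h2, ← hlaw, integral_map hm (by fun_prop)]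

lemma coordSigma_le (B : Set (Fin p)) : coordSigma B ≤ MeasurableSpace.pi :=
  iSup₂_le fun k _ => (measurable_pi_apply k).comap_le

lemma measurable_coord {B : Set (Fin p)} {k : Fin p} (hk : k ∈ B) :
    Measurable[coordSigma B] (fun x : Fin p → ℝ => x k) := by
  rw [measurable_iff_comap_le]
  exact le_iSup₂_of_le k hk le_rfl

lemma measurable_signal_coordSigma {B : Set (Fin p)} {j : Fin p} (h : ∀ k ∈ M.parents j, k ∈ B) :
    Measurable[coordSigma B] (M.signal j) :=
  @Finset.measurable_fun_sum _ _ _ _ _ _ (coordSigma B) _ _ fun k hk =>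
    (M.measurable_f k j).comp (measurable_coord (h k hk))

lemma wellFounded_edges : WellFounded (Relation.TransGen fun k j => (k, j) ∈ M.edges) := by
  have : Std.Irrefl (Relation.TransGen fun k j => (k, j) ∈ M.edges) := ⟨M.acyclic⟩
  exact Finite.wellFounded_of_trans_of_irrefl _

/-- The error `ε_j` is independent of the variables in any set that is closed under taking parents
and does not contain `j`. -/
lemma indep_noise_coordSigma {B : Set (Fin p)} (hB : ∀ k ∈ B, ∀ l ∈ M.parents k, l ∈ B)
    {j : Fin p} (hj : j ∉ B) :
    Indep (MeasurableSpace.comap (M.noise j) inferInstance) (coordSigma B) M.P := by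
  set m : Fin p → MeasurableSpace (Fin p → ℝ) :=
    fun k => MeasurableSpace.comap (M.noise k) inferInstance with hm
  have h := indep_iSup_of_disjoint (m := m) (μ := M.P)
    (fun k => (M.measurable_noise k).comap_le) M.iIndepFun_noise.iIndep
    (S := {j}) (T := B) (Set.disjoint_singleton_left.2 hj)
  rw [iSup_singleton] at h
  have hle : coordSigma B ≤ ⨆ k ∈ B, m k := by
    have key : ∀ k, k ∈ B → Measurable[⨆ k ∈ B, m k] (fun x : Fin p → ℝ => x k) := by
      intro k
      induction k using M.wellFounded_edges.induction with
      | _ k ih =>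
        intro hk
        have h1 : Measurable[⨆ k ∈ B, m k] (M.noise k) := by
          rw [measurable_iff_comap_le]
          exact le_iSup₂_of_le k hk le_rfl
        have h2 : Measurable[⨆ k ∈ B, m k] (M.signal k) :=
          @Finset.measurable_fun_sum _ _ _ _ _ _ (⨆ k ∈ B, m k) _ _ fun l hl =>
            (M.measurable_f l k).comp
              (ih l (Relation.TransGen.single (M.mem_parents.1 hl)) (hB k hk l hl))
        have h3 : (fun x : Fin p → ℝ => x k) = fun x => M.noise k x + M.signal k x := by
          ext x; simp [noise]
        rw [h3]
        exact h1.add h2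
    exact iSup₂_le fun k hk => (key k hk).comap_le
  exact indep_of_indep_of_le_right h hle

lemma indepFun_noise {B : Set (Fin p)} (hB : ∀ k ∈ B, ∀ l ∈ M.parents k, l ∈ B)
    {j : Fin p} (hj : j ∉ B) {α : Type*} [MeasurableSpace α] {u : (Fin p → ℝ) → α}
    (hu : Measurable[coordSigma B] u) : IndepFun (M.noise j) u M.P :=
  indep_of_indep_of_le_right (M.indep_noise_coordSigma hB hj) hu.comap_le

/-- The ancestors of `j` are closed under taking parents and do not contain `j`. -/
lemma exists_closed_parents (j : Fin p) : ∃ B : Set (Fin p),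
    (∀ k ∈ B, ∀ l ∈ M.parents k, l ∈ B) ∧ j ∉ B ∧ ∀ k ∈ M.parents j, k ∈ B :=
  ⟨{k | Relation.TransGen (fun k j => (k, j) ∈ M.edges) k j},
    fun _ hk _ hl => Relation.TransGen.head (M.mem_parents.1 hl) hk, M.acyclic j,
    fun _ hk => Relation.TransGen.single (M.mem_parents.1 hk)⟩

end AdditiveSEM

/-! ### The function classes -/

lemma SobolevBall.summable_abs {C η : ℝ} {β : ℕ → ℝ} (h : SobolevBall C η β) (hη : 0 ≤ η) :
    Summable (fun r => |β r|) :=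
  h.1.of_nonneg_of_le (fun _ => abs_nonneg _) fun r =>
    le_mul_of_one_le_right (abs_nonneg _) (Real.one_le_rpow (by linarith [r.cast_nonneg (α := ℝ)]) hη)

lemma SobolevBall.tsum_abs_le {C η : ℝ} {β : ℕ → ℝ} (h : SobolevBall C η β) (hη : 0 ≤ η) :
    ∑' r, |β r| ≤ C :=
  ((h.summable_abs hη).tsum_le_tsum (fun r =>
    le_mul_of_one_le_right (abs_nonneg _)
      (Real.one_le_rpow (by linarith [r.cast_nonneg (α := ℝ)]) hη)) h.1).trans h.2

lemma SobolevBall.sum_mul_le {C η : ℝ} {β : ℕ → ℝ} (h : SobolevBall C η β) (hη : 1 ≤ η) (R : ℕ) :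
    ∑ r ∈ Finset.range R, |β r| * ((r : ℝ) + 1) ≤ C := by
  refine le_trans ?_ h.2
  refine le_trans ?_ (h.1.sum_le_tsum (Finset.range R) fun r _ => by positivity)
  refine Finset.sum_le_sum fun r _ => ?_
  gcongr
  exact Real.self_le_rpow_of_one_le (by linarith [r.cast_nonneg (α := ℝ)]) hη

lemma SobolevBall.of_abs_le {C η : ℝ} {β β' : ℕ → ℝ} (h : SobolevBall C η β)
    (hle : ∀ r, |β' r| ≤ |β r|) : SobolevBall C η β' := by
  have h1 : ∀ r : ℕ, |β' r| * ((r : ℝ) + 1) ^ η ≤ |β r| * ((r : ℝ) + 1) ^ η := fun r =>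
    mul_le_mul_of_nonneg_right (hle r) (by positivity)
  have hs := h.1.of_nonneg_of_le (fun r => by positivity) h1
  exact ⟨hs, (hs.tsum_le_tsum h1 h.1).trans h.2⟩

lemma SobolevBall.tail_le {C η : ℝ} {β : ℕ → ℝ} (h : SobolevBall C η β) (hη : 0 ≤ η) {R : ℕ}
    (hR : 1 ≤ R) :
    ∑' r, |if r < R then 0 else β r| ≤ C * (R : ℝ) ^ (-η) := by
  have hR0 : (0 : ℝ) < R := by exact_mod_cast hR
  have hpt : ∀ r : ℕ, |if r < R then 0 else β r| ≤ |β r| * ((r : ℝ) + 1) ^ η * (R : ℝ) ^ (-η) := by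
    intro r
    split_ifs with hr
    · rw [abs_zero]; positivity
    · have h1 : (R : ℝ) ^ η ≤ ((r : ℝ) + 1) ^ η := by
        refine Real.rpow_le_rpow hR0.le ?_ hη
        have : (R : ℝ) ≤ r := by exact_mod_cast not_lt.1 hr
        linarith
      have h2 : 1 ≤ ((r : ℝ) + 1) ^ η * (R : ℝ) ^ (-η) := by
        calc (1 : ℝ) = (R : ℝ) ^ η * (R : ℝ) ^ (-η) := by
              rw [← Real.rpow_add hR0]; simp
          _ ≤ _ := by gcongr
      rw [mul_assoc]
      exact le_mul_of_one_le_right (abs_nonneg _) h2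
  have hs : Summable (fun r : ℕ => |β r| * ((r : ℝ) + 1) ^ η * (R : ℝ) ^ (-η)) := h.1.mul_right _
  calc _ ≤ ∑' r : ℕ, |β r| * ((r : ℝ) + 1) ^ η * (R : ℝ) ^ (-η) :=
        (hs.of_nonneg_of_le (fun _ => abs_nonneg _) hpt).tsum_le_tsum hpt hs
    _ = (∑' r : ℕ, |β r| * ((r : ℝ) + 1) ^ η) * (R : ℝ) ^ (-η) := tsum_mul_right
    _ ≤ _ := by gcongr; exact h.2

namespace Setup

variable {p : ℕ} (S : Setup p)

/-- The standing assumptions on a single model. -/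
structure Regular (K : ℕ) (C η σbar c : ℝ) : Prop where
  C_pos : 0 < C
  one_lt_η : 1 < η
  c_pos : 0 < c
  wellSpecified : S.WellSpecified C η
  superSparse : S.SuperSparse K
  goodBasis : S.GoodBasis
  boundedVariances : S.BoundedVariances C η σbar c

/-- The centred basis functions. -/
def centeredBasis (k j : Fin p) (r : ℕ) (x : Fin p → ℝ) : ℝ :=
  S.b k j r (x k) - ∫ y, S.b k j r (y k) ∂S.sem.P

/-- The additive fit of node `j` given by the first `R` coefficients. -/
def fit (R : ℕ) (β : Fin p → Fin p → ℕ → ℝ) (j : Fin p) (x : Fin p → ℝ) : ℝ :=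
  ∑ k ∈ S.candidates j, ∑ r ∈ Finset.range R, β k j r * S.centeredBasis k j r x

lemma mem_candidates {k j : Fin p} : k ∈ S.candidates j ↔ (k, j) ∈ S.super := by
  simp [candidates]

variable {S}

section basis

lemma GoodBasis.measurable (h : S.GoodBasis) {k j : Fin p} (hkj : k ≠ j) (r : ℕ) :
    Measurable (S.b k j r) := by
  have h1 := (h.1 k j hkj r).1 0 (by norm_num)
  rw [iteratedDeriv_zero] at h1
  exact h1.continuous.measurable

lemma GoodBasis.abs_le (h : S.GoodBasis) {k j : Fin p} (hkj : k ≠ j) (r : ℕ) (t : ℝ) :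
    |S.b k j r t| ≤ 1 := (h.1 k j hkj r).2.2 t

lemma GoodBasis.integrable (h : S.GoodBasis) {k j : Fin p} (hkj : k ≠ j) (r : ℕ) :
    Integrable (fun x => S.b k j r (x k)) S.sem.P :=
  Integrable.of_bound ((h.measurable hkj r).comp (measurable_pi_apply k)).aestronglyMeasurable 1
    (ae_of_all _ fun x => by rw [Real.norm_eq_abs]; exact h.abs_le hkj r _)

lemma GoodBasis.measurable_centeredBasis (h : S.GoodBasis) {k j : Fin p} (hkj : k ≠ j) (r : ℕ) :
    Measurable (S.centeredBasis k j r) :=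
  ((h.measurable hkj r).comp (measurable_pi_apply k)).sub_const _

lemma abs_integral_le_of_abs_le {g : (Fin p → ℝ) → ℝ} {A : ℝ} (hg : ∀ x, |g x| ≤ A) :
    |∫ x, g x ∂S.sem.P| ≤ A := by
  have := norm_integral_le_of_norm_le_const (μ := S.sem.P) (f := g) (C := A)
    (ae_of_all _ fun x => by rw [Real.norm_eq_abs]; exact hg x)
  simpa using this

lemma GoodBasis.abs_centeredBasis_le (h : S.GoodBasis) {k j : Fin p} (hkj : k ≠ j) (r : ℕ)
    (x : Fin p → ℝ) : |S.centeredBasis k j r x| ≤ 2 := by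
  have h1 := abs_integral_le_of_abs_le (S := S) (fun y => h.abs_le hkj r (y k))
  have h2 := h.abs_le hkj r (x k)
  have h3 := abs_sub (S.b k j r (x k)) (∫ y, S.b k j r (y k) ∂S.sem.P)
  unfold centeredBasis
  linarith

lemma GoodBasis.summable (h : S.GoodBasis) {k j : Fin p} (hkj : k ≠ j) {β : ℕ → ℝ}
    (hβ : Summable fun r => |β r|) (t : ℝ) : Summable fun r => β r * S.b k j r t := by
  refine Summable.of_norm_bounded hβ fun r => ?_
  rw [Real.norm_eq_abs, abs_mul]
  exact mul_le_of_le_one_right (abs_nonneg _) (h.abs_le hkj r t)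

lemma GoodBasis.abs_tsum_le (h : S.GoodBasis) {k j : Fin p} (hkj : k ≠ j) {β : ℕ → ℝ}
    (hβ : Summable fun r => |β r|) (t : ℝ) : |∑' r, β r * S.b k j r t| ≤ ∑' r, |β r| := by
  have := tsum_of_norm_bounded hβ.hasSum (f := fun r => β r * S.b k j r t) fun r => by
    rw [Real.norm_eq_abs, abs_mul]
    exact mul_le_of_le_one_right (abs_nonneg _) (h.abs_le hkj r t)
  rwa [Real.norm_eq_abs] at this

lemma GoodBasis.abs_expansion_le (h : S.GoodBasis) {k j : Fin p} (hkj : k ≠ j) {β : ℕ → ℝ}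
    (hβ : Summable fun r => |β r|) (t : ℝ) :
    |S.expansion k j β t| ≤ 2 * ∑' r, |β r| := by
  have h1 := abs_integral_le_of_abs_le (S := S) (fun y => h.abs_tsum_le hkj hβ (y k))
  have h2 := h.abs_tsum_le hkj hβ t
  unfold expansion
  refine (abs_add_le _ _).trans ?_
  rw [abs_neg]
  linarith

lemma expansion_zero (k j : Fin p) : S.expansion k j (fun _ => 0) = fun _ => 0 := by
  ext t; simp [expansion]

lemma GoodBasis.expansion_of_truncated (h : S.GoodBasis) {k j : Fin p} (hkj : k ≠ j) {β : ℕ → ℝ}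
    {R : ℕ} (hβ : ∀ r, R ≤ r → β r = 0) (x : Fin p → ℝ) :
    S.expansion k j β (x k) = ∑ r ∈ Finset.range R, β r * S.centeredBasis k j r x := by
  have h1 : ∀ t, ∑' r, β r * S.b k j r t = ∑ r ∈ Finset.range R, β r * S.b k j r t := by
    intro t
    refine tsum_eq_sum fun r hr => ?_
    rw [hβ r (by simpa using hr), zero_mul]
  unfold expansion centeredBasis
  simp_rw [h1]
  rw [integral_finsetSum _ fun r _ => (h.integrable hkj r).const_mul _]
  simp_rw [integral_const_mul, mul_sub, Finset.sum_sub_distrib]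
  ring

lemma GoodBasis.abs_expansion_sub_truncation_le (h : S.GoodBasis) {k j : Fin p} (hkj : k ≠ j)
    {C η : ℝ} (hη : 0 ≤ η) {β : ℕ → ℝ} (hβ : SobolevBall C η β)
    (hmeas : Measurable (S.expansion k j β)) {R : ℕ} (hR : 1 ≤ R) (t : ℝ) :
    |S.expansion k j β t - S.expansion k j (fun r => if r < R then β r else 0) t|
      ≤ 2 * (C * (R : ℝ) ^ (-η)) := by
  have hs := hβ.summable_abs hη
  have hs1 : Summable fun r => |if r < R then β r else 0| :=
    hs.of_nonneg_of_le (fun _ => abs_nonneg _) fun r => by split_ifs <;> simp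
  have hs2 : Summable fun r => |if r < R then 0 else β r| :=
    hs.of_nonneg_of_le (fun _ => abs_nonneg _) fun r => by split_ifs <;> simp
  have hsum : ∀ t, ∑' r, β r * S.b k j r t
      = ∑' r, (if r < R then β r else 0) * S.b k j r t
        + ∑' r, (if r < R then 0 else β r) * S.b k j r t := by
    intro t
    rw [← (h.summable hkj hs1 t).tsum_add (h.summable hkj hs2 t)]
    refine tsum_congr fun r => ?_
    split_ifs <;> simp
  have hm0 : Measurable fun t => ∑' r, β r * S.b k j r t := by
    have : (fun t => ∑' r, β r * S.b k j r t)
        = fun t => S.expansion k j β t + ∫ x, ∑' r, β r * S.b k j r (x k) ∂S.sem.P := by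
      ext t; simp [expansion]
    rw [this]
    exact hmeas.add_const _
  have hi0 : Integrable (fun x : Fin p → ℝ => ∑' r, β r * S.b k j r (x k)) S.sem.P :=
    Integrable.of_bound (hm0.comp (measurable_pi_apply k)).aestronglyMeasurable (∑' r, |β r|)
      (ae_of_all _ fun x => by rw [Real.norm_eq_abs]; exact h.abs_tsum_le hkj hs _)
  have h1 : ∀ t, ∑' r, (if r < R then β r else 0) * S.b k j r t
      = ∑ r ∈ Finset.range R, β r * S.b k j r t := by
    intro t
    rw [tsum_eq_sum (s := Finset.range R) fun r hr => by
      rw [if_neg (by simpa using hr), zero_mul]]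
    exact Finset.sum_congr rfl fun r hr => by rw [if_pos (by simpa using hr)]
  have hi1 : Integrable (fun x : Fin p → ℝ => ∑' r, (if r < R then β r else 0) * S.b k j r (x k))
      S.sem.P := by
    simp_rw [h1]
    exact integrable_finsetSum _ fun r _ => (h.integrable hkj r).const_mul _
  have hdiff : S.expansion k j β t - S.expansion k j (fun r => if r < R then β r else 0) t
      = S.expansion k j (fun r => if r < R then 0 else β r) t := by
    have hint : ∫ x, ∑' r, (if r < R then 0 else β r) * S.b k j r (x k) ∂S.sem.P
        = ∫ x, ∑' r, β r * S.b k j r (x k) ∂S.sem.P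
          - ∫ x, ∑' r, (if r < R then β r else 0) * S.b k j r (x k) ∂S.sem.P := by
      rw [← integral_sub hi0 hi1]
      refine integral_congr_ae (ae_of_all _ fun x => ?_)
      dsimp only
      rw [hsum (x k)]; ring
    unfold expansion
    rw [hint, hsum t]; ring
  rw [hdiff]
  refine (h.abs_expansion_le hkj hs2 t).trans ?_
  have := hβ.tail_le hη hR
  linarith

end basis

end Setup

/-- The parents of `j` in the graph of a parameter. -/
def Param.parents {p : ℕ} (θ : Param p) (j : Fin p) : Finset (Fin p) := {k | (k, j) ∈ θ.edges}

lemma Param.mem_parents {p : ℕ} {θ : Param p} {k j : Fin p} :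
    k ∈ θ.parents j ↔ (k, j) ∈ θ.edges := by simp [Param.parents]

lemma Param.eq_zero_of_notMem_edges {p : ℕ} {θ : Param p} {k j : Fin p} (h : (k, j) ∉ θ.edges) :
    θ.β k j = fun _ => 0 := by
  ext r
  by_contra hr
  exact h (by simpa [Param.edges] using ⟨r, hr⟩)

/-- The number of edges, counted by their heads. -/
lemma sum_card_parents {p : ℕ} (E : Finset (Fin p × Fin p)) :
    ∑ j, (Finset.univ.filter fun k => (k, j) ∈ E).card = E.card := by
  classical
  rw [Finset.card_eq_sum_card_fiberwise (f := Prod.snd) (t := Finset.univ) (by simp)]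
  refine Finset.sum_congr rfl fun j _ => ?_
  refine Finset.card_bij (fun k _ => (k, j)) (by simp) (by simp) ?_
  rintro ⟨k, l⟩ hkl
  simp only [Finset.mem_filter] at hkl
  obtain ⟨h1, rfl⟩ := hkl
  exact ⟨k, by simpa using h1, rfl⟩

namespace Setup

variable {p : ℕ} {S : Setup p} {K : ℕ} {C η σbar c : ℝ}

namespace Regular

variable (h : S.Regular K C η σbar c)

include h

lemma η_nonneg : 0 ≤ η := by linarith [h.one_lt_η]

lemma ne_of_mem_candidates {k j : Fin p} (hk : k ∈ S.candidates j) : k ≠ j := by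
  rintro rfl
  exact h.wellSpecified.1 k (S.mem_candidates.1 hk)

lemma parents_subset (j : Fin p) : S.sem.parents j ⊆ S.candidates j := fun _ hk =>
  S.mem_candidates.2 (h.wellSpecified.2.1 (S.sem.mem_parents.1 hk))

lemma card_candidates_le (j : Fin p) : ((S.candidates j).card : ℝ) ≤ K := by
  exact_mod_cast h.superSparse j

lemma card_parents_le (j : Fin p) : ((S.sem.parents j).card : ℝ) ≤ K :=
  le_trans (by exact_mod_cast Finset.card_le_card (h.parents_subset j)) (h.card_candidates_le j)

lemma abs_f_le {k j : Fin p} (hkj : k ≠ j) (t : ℝ) : |S.sem.f k j t| ≤ 2 * C := by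
  obtain ⟨β, hβ, hf⟩ := h.wellSpecified.2.2 k j hkj
  rw [hf]
  have h1 := h.goodBasis.abs_expansion_le hkj (hβ.summable_abs h.η_nonneg) t
  have h2 := hβ.tsum_abs_le h.η_nonneg
  linarith

lemma abs_signal_le (j : Fin p) (x : Fin p → ℝ) : |S.sem.signal j x| ≤ 2 * C * K := by
  have hC := h.C_pos
  calc |S.sem.signal j x| ≤ ∑ k ∈ S.sem.parents j, |S.sem.f k j (x k)| :=
        Finset.abs_sum_le_sum_abs _ _
    _ ≤ ∑ k ∈ S.sem.parents j, 2 * C := Finset.sum_le_sum fun k hk =>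
        h.abs_f_le (h.ne_of_mem_candidates (h.parents_subset j hk)) _
    _ = (S.sem.parents j).card * (2 * C) := by rw [Finset.sum_const, nsmul_eq_mul]
    _ ≤ K * (2 * C) := mul_le_mul_of_nonneg_right (h.card_parents_le j) (by positivity)
    _ = _ := by ring

lemma abs_fit_le {R : ℕ} {β : Fin p → Fin p → ℕ → ℝ} (hβ : ∀ k j, SobolevBall C η (β k j))
    (j : Fin p) (x : Fin p → ℝ) : |S.fit R β j x| ≤ 2 * C * K := by
  have hC := h.C_pos
  have h1 : ∀ k ∈ S.candidates j,
      |∑ r ∈ Finset.range R, β k j r * S.centeredBasis k j r x| ≤ 2 * C := by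
    intro k hk
    calc _ ≤ ∑ r ∈ Finset.range R, |β k j r * S.centeredBasis k j r x| :=
          Finset.abs_sum_le_sum_abs _ _
      _ ≤ ∑ r ∈ Finset.range R, |β k j r| * 2 := Finset.sum_le_sum fun r _ => by
          rw [abs_mul]
          gcongr
          exact h.goodBasis.abs_centeredBasis_le (h.ne_of_mem_candidates hk) r x
      _ = 2 * ∑ r ∈ Finset.range R, |β k j r| := by rw [← Finset.sum_mul]; ring
      _ ≤ 2 * C := by
          have := ((hβ k j).summable_abs h.η_nonneg).sum_le_tsum (Finset.range R)
            fun _ _ => abs_nonneg _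
          have := (hβ k j).tsum_abs_le h.η_nonneg
          linarith
  calc _ ≤ _ := Finset.abs_sum_le_sum_abs _ _
    _ ≤ ∑ k ∈ S.candidates j, 2 * C := Finset.sum_le_sum h1
    _ = (S.candidates j).card * (2 * C) := by rw [Finset.sum_const, nsmul_eq_mul]
    _ ≤ K * (2 * C) := mul_le_mul_of_nonneg_right (h.card_candidates_le j) (by positivity)
    _ = _ := by ring

lemma measurable_fit (R : ℕ) (β : Fin p → Fin p → ℕ → ℝ) (j : Fin p) :
    Measurable (S.fit R β j) :=
  Finset.measurable_fun_sum _ fun _ hk => Finset.measurable_fun_sum _ fun r _ =>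
    (h.goodBasis.measurable_centeredBasis (h.ne_of_mem_candidates hk) r).const_mul _

lemma sum_expansion_eq_fit {R : ℕ} {s : ℝ} {θ : Param p} (hθ : S.Feasible C η R s θ) (j : Fin p)
    (x : Fin p → ℝ) :
    ∑ k with k ≠ j, S.expansion k j (θ.β k j) (x k) = S.fit R θ.β j x := by
  have hsub : S.candidates j ⊆ Finset.univ.filter fun k => k ≠ j := fun k hk => by
    simpa using h.ne_of_mem_candidates hk
  rw [fit, ← Finset.sum_subset hsub]
  · exact Finset.sum_congr rfl fun k hk =>
      h.goodBasis.expansion_of_truncated (h.ne_of_mem_candidates hk) (hθ.truncated k j) x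
  · intro k _ hk
    have : (k, j) ∉ θ.edges := fun hmem => hk (S.mem_candidates.2 (hθ.subset_super hmem))
    rw [Param.eq_zero_of_notMem_edges this, expansion_zero]

lemma empiricalResidual_eq {R : ℕ} {s : ℝ} {θ : Param p} (hθ : S.Feasible C η R s θ) {n : ℕ}
    (x : Fin n → Fin p → ℝ) (j : Fin p) :
    S.empiricalResidual x θ j = (n : ℝ)⁻¹ * ∑ i, (x i j - S.fit R θ.β j (x i)) ^ 2 := by
  unfold empiricalResidual
  simp_rw [h.sum_expansion_eq_fit hθ]

omit h in
lemma _root_.CausalAdditive.Setup.residualVar_le_of_mem {j : Fin p} {g : Finset (Fin p)}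
    {f : Fin p → ℝ → ℝ} (hf : ∀ k ∈ g, f k ∈ S.functionClass C η k j) :
    S.residualVar C η j g ≤ ∫ x, (x j - ∑ k ∈ g, f k (x k)) ^ 2 ∂S.sem.P := by
  refine csInf_le ⟨0, ?_⟩ ⟨f, hf, rfl⟩
  rintro _ ⟨f, _, rfl⟩
  exact integral_nonneg fun _ => sq_nonneg _

lemma zero_mem_functionClass (k j : Fin p) : (fun _ => 0) ∈ S.functionClass C η k j :=
  ⟨fun _ => 0, ⟨by simp [summable_zero], by simpa using h.C_pos.le⟩, (expansion_zero k j).symm⟩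

lemma residualVar_anti {j : Fin p} {g g' : Finset (Fin p)} (hg : g ⊆ g') :
    S.residualVar C η j g' ≤ S.residualVar C η j g := by
  classical
  refine le_csInf ⟨_, fun _ => fun _ => 0, fun k _ => h.zero_mem_functionClass k j, rfl⟩ ?_
  rintro _ ⟨f, hf, rfl⟩
  have h1 := S.residualVar_le_of_mem (C := C) (η := η) (j := j) (g := g')
    (f := fun k => if k ∈ g then f k else fun _ => 0) fun k _ => by
      split_ifs with hk
      · exact hf k hk
      · exact h.zero_mem_functionClass k j
  refine h1.trans (le_of_eq ?_)
  dsimp only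
  congr 1
  ext x
  rw [← Finset.sum_subset hg fun k _ hk => by rw [if_neg hk]]
  congr 2
  exact Finset.sum_congr rfl fun k hk => by rw [if_pos hk]

lemma residualVar_parents_le {R : ℕ} {s : ℝ} {θ : Param p} (hθ : S.Feasible C η R s θ)
    (j : Fin p) :
    S.residualVar C η j (θ.parents j) ≤ ∫ x, (x j - S.fit R θ.β j x) ^ 2 ∂S.sem.P := by
  have hsub : θ.parents j ⊆ S.candidates j := fun k hk =>
    S.mem_candidates.2 (hθ.subset_super (Param.mem_parents.1 hk))
  refine (S.residualVar_le_of_mem (f := fun k => S.expansion k j (θ.β k j))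
    fun k _ => ⟨θ.β k j, hθ.sobolev k j, rfl⟩).trans (le_of_eq ?_)
  congr 1
  ext x
  congr 2
  rw [fit, ← Finset.sum_subset hsub]
  · exact Finset.sum_congr rfl fun k hk =>
      h.goodBasis.expansion_of_truncated (h.ne_of_mem_candidates (hsub hk)) (hθ.truncated k j) x
  · intro k _ hk
    rw [Param.eq_zero_of_notMem_edges fun hm => hk (Param.mem_parents.2 hm)]
    simp

lemma le_sigma_sq (j : Fin p) : c ≤ S.sem.σ j ^ 2 := by
  refine (h.boundedVariances.2 j _ (h.parents_subset j)).trans ?_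
  refine (S.residualVar_le_of_mem (f := fun k => S.sem.f k j) fun k hk =>
    h.wellSpecified.2.2 k j (h.ne_of_mem_candidates (h.parents_subset j hk))).trans ?_
  exact (S.sem.integral_noise_sq j).2.le

lemma sigma_sq_le (j : Fin p) : S.sem.σ j ^ 2 ≤ σbar ^ 2 := h.boundedVariances.1 j

/-- The truncation of the true functions to the first `R` basis functions. -/
lemma exists_truncated_truth {R : ℕ} (hR : 1 ≤ R) : ∃ β : Fin p → Fin p → ℕ → ℝ,
    (∀ k j, SobolevBall C η (β k j)) ∧ (∀ k j r, R ≤ r → β k j r = 0) ∧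
    (∀ k j, (k, j) ∉ S.sem.edges → ∀ r, β k j r = 0) ∧
    ∀ j x, |S.sem.signal j x - S.fit R β j x|
      ≤ 2 * C * (S.sem.parents j).card * (R : ℝ) ^ (-η) := by
  classical
  have hex : ∀ k j, ∃ β, SobolevBall C η β ∧
      (k ≠ j → S.sem.f k j = S.expansion k j β) := by
    intro k j
    by_cases hkj : k = j
    · exact ⟨fun _ => 0, ⟨by simp [summable_zero], by simpa using h.C_pos.le⟩,
        fun hne => (hne hkj).elim⟩
    · obtain ⟨β, hβ, hf⟩ := h.wellSpecified.2.2 k j hkj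
      exact ⟨β, hβ, fun _ => hf⟩
  choose β hβ hf using hex
  refine ⟨fun k j r => if (k, j) ∈ S.sem.edges then (if r < R then β k j r else 0) else 0,
    fun k j => (hβ k j).of_abs_le fun r => ?_, fun k j r hr => ?_, fun k j hkj r => by simp [hkj],
    fun j x => ?_⟩
  · dsimp only; split_ifs <;> simp
  · simp [not_lt.2 hr]
  · have hfit : S.fit R (fun k j r => if (k, j) ∈ S.sem.edges then
        (if r < R then β k j r else 0) else 0) j x
        = ∑ k ∈ S.sem.parents j, S.expansion k j (fun r => if r < R then β k j r else 0) (x k) := by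
      rw [fit, ← Finset.sum_subset (h.parents_subset j)]
      · refine Finset.sum_congr rfl fun k hk => ?_
        rw [h.goodBasis.expansion_of_truncated (h.ne_of_mem_candidates (h.parents_subset j hk))
          (R := R) fun r hr => if_neg (not_lt.2 hr)]
        exact Finset.sum_congr rfl fun r _ => by rw [if_pos (S.sem.mem_parents.1 hk)]
      · intro k _ hk
        refine Finset.sum_eq_zero fun r _ => ?_
        rw [if_neg fun hm => hk (S.sem.mem_parents.2 hm), zero_mul]
    rw [hfit, AdditiveSEM.signal, ← Finset.sum_sub_distrib]
    calc _ ≤ _ := Finset.abs_sum_le_sum_abs _ _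
      _ ≤ ∑ k ∈ S.sem.parents j, 2 * (C * (R : ℝ) ^ (-η)) := Finset.sum_le_sum fun k hk => by
          have hkj := h.ne_of_mem_candidates (h.parents_subset j hk)
          rw [hf k j hkj]
          exact h.goodBasis.abs_expansion_sub_truncation_le hkj h.η_nonneg (hβ k j)
            (hf k j hkj ▸ S.sem.measurable_f k j) hR _
      _ = _ := by rw [Finset.sum_const, nsmul_eq_mul]; ring

omit h in
lemma _root_.CausalAdditive.Setup.memLp_of_bounded {g : (Fin p → ℝ) → ℝ} (hg : Measurable g) {A : ℝ} (hA : ∀ x, |g x| ≤ A)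
    (q : ENNReal) : MemLp g q S.sem.P :=
  MemLp.of_bound hg.aestronglyMeasurable A (ae_of_all _ fun x => by
    rw [Real.norm_eq_abs]; exact hA x)

omit h in
lemma _root_.CausalAdditive.Setup.memLp_noise (j : Fin p) : MemLp (S.sem.noise j) 2 S.sem.P :=
  (memLp_two_iff_integrable_sq (S.sem.measurable_noise j).aestronglyMeasurable).2
    (S.sem.integral_noise_sq j).1

/-- The population residual of the truncated true functions. -/
lemma integral_truncated_truth_le {R : ℕ} {β : Fin p → Fin p → ℕ → ℝ}
    (hzero : ∀ k j, (k, j) ∉ S.sem.edges → ∀ r, β k j r = 0) {j : Fin p} {δ : ℝ}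
    (hδ : ∀ x, |S.sem.signal j x - S.fit R β j x| ≤ δ) :
    ∫ x, (x j - S.fit R β j x) ^ 2 ∂S.sem.P ≤ S.sem.σ j ^ 2 + δ ^ 2 := by
  set u : (Fin p → ℝ) → ℝ := fun x => S.sem.signal j x - S.fit R β j x with hu
  have hum : Measurable u := (S.sem.measurable_signal j).sub (h.measurable_fit R β j)
  obtain ⟨B, hB, hj, hpa⟩ := S.sem.exists_closed_parents j
  have huB : Measurable[AdditiveSEM.coordSigma B] u := by
    refine Measurable.sub (S.sem.measurable_signal_coordSigma hpa) ?_
    have : S.fit R β j = fun x => ∑ k ∈ S.sem.parents j, ∑ r ∈ Finset.range R,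
        β k j r * S.centeredBasis k j r x := by
      ext x
      rw [fit, ← Finset.sum_subset (h.parents_subset j)]
      intro k _ hk
      refine Finset.sum_eq_zero fun r _ => ?_
      rw [hzero k j fun hm => hk (S.sem.mem_parents.2 hm), zero_mul]
    rw [this]
    refine @Finset.measurable_fun_sum _ _ _ _ _ _ (AdditiveSEM.coordSigma B) _ _ fun k hk =>
      @Finset.measurable_fun_sum _ _ _ _ _ _ (AdditiveSEM.coordSigma B) _ _ fun r _ =>
      Measurable.const_mul (Measurable.sub_const ?_ _) _
    exact (h.goodBasis.measurable (h.ne_of_mem_candidates (h.parents_subset j hk)) r).comp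
      (AdditiveSEM.measurable_coord (hpa k hk))
  have hind := S.sem.indepFun_noise hB hj huB
  have hcross : ∫ x, S.sem.noise j x * u x ∂S.sem.P = 0 := by
    have := hind.integral_mul_eq_mul_integral (S.sem.measurable_noise j).aestronglyMeasurable
      hum.aestronglyMeasurable
    rw [(S.sem.integral_noise j).2, zero_mul] at this
    exact this
  have hu2 : MemLp u 2 S.sem.P := S.memLp_of_bounded hum hδ 2
  have hi1 : Integrable (fun x => S.sem.noise j x * u x) S.sem.P :=
    (S.memLp_noise j).integrable_mul hu2
  have hi2 : Integrable (fun x => u x ^ 2) S.sem.P := hu2.integrable_sq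
  have hpt : ∀ x : Fin p → ℝ, (x j - S.fit R β j x) ^ 2
      = S.sem.noise j x ^ 2 + 2 * (S.sem.noise j x * u x) + u x ^ 2 := by
    intro x; simp only [hu, AdditiveSEM.noise]; ring
  simp_rw [hpt]
  have hi3 : Integrable (fun x => S.sem.noise j x ^ 2 + 2 * (S.sem.noise j x * u x)) S.sem.P :=
    (S.sem.integral_noise_sq j).1.add (hi1.const_mul 2)
  rw [integral_add hi3 hi2, integral_add (S.sem.integral_noise_sq j).1 (hi1.const_mul 2),
    integral_const_mul, hcross, (S.sem.integral_noise_sq j).2]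
  have : ∫ x, u x ^ 2 ∂S.sem.P ≤ δ ^ 2 := by
    have h1 := integral_mono (μ := S.sem.P) hi2 (integrable_const (δ ^ 2)) fun x =>
      sq_le_sq' (abs_le.1 (hδ x)).1 (abs_le.1 (hδ x)).2
    simpa using h1
  linarith

end Regular

/-! ### Uniform deviation of the empirical residuals -/

/-- The variable `X_j` and the centred basis functions of its candidate parents. -/
def feature (S : Setup p) (j : Fin p) : Option (Fin p × ℕ) → (Fin p → ℝ) → ℝ
  | none => fun x => x j
  | some (k, r) => S.centeredBasis k j r

/-- The weight `r` of the `r`-th basis function. -/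
def featureWeight : Option (Fin p × ℕ) → ℝ
  | none => 1
  | some (_, r) => (r : ℝ) + 1

/-- The features used for the first `R` basis functions. -/
def features (S : Setup p) (R : ℕ) (j : Fin p) : Finset (Option (Fin p × ℕ)) :=
  Finset.insertNone (S.candidates j ×ˢ Finset.range R)

/-- All empirical second moments of the features are close to the population ones. -/
def MomentsClose (S : Setup p) (R : ℕ) (t : ℝ) {n : ℕ} (x : Fin n → Fin p → ℝ) : Prop :=
  ∀ j, ∀ u ∈ S.features R j, ∀ v ∈ S.features R j,
    |(n : ℝ)⁻¹ * ∑ i, S.feature j u (x i) * S.feature j v (x i)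
      - ∫ y, S.feature j u y * S.feature j v y ∂S.sem.P| ≤ t * (featureWeight u * featureWeight v)

lemma one_le_featureWeight (u : Option (Fin p × ℕ)) : 1 ≤ featureWeight u := by
  cases u with
  | none => exact le_rfl
  | some a => simp [featureWeight]

lemma Regular.measurable_feature (h : S.Regular K C η σbar c) {R : ℕ} {j : Fin p}
    {u : Option (Fin p × ℕ)} (hu : u ∈ S.features R j) : Measurable (S.feature j u) := by
  cases u with
  | none => exact measurable_pi_apply j
  | some a =>
    have : a.1 ∈ S.candidates j := by
      simp [features] at hu; exact hu.1
    exact h.goodBasis.measurable_centeredBasis (h.ne_of_mem_candidates this) a.2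

lemma Regular.abs_feature_le (h : S.Regular K C η σbar c) {R : ℕ} {j : Fin p}
    {u : Option (Fin p × ℕ)} (hu : u ∈ S.features R j) (x : Fin p → ℝ) :
    |S.feature j u x| ≤ 2 + 2 * C * K + |S.sem.noise j x| := by
  have hC := h.C_pos
  cases u with
  | none =>
    have h1 : x j = S.sem.signal j x + S.sem.noise j x := by simp [AdditiveSEM.noise]
    have h2 := h.abs_signal_le j x
    have h3 := abs_add_le (S.sem.signal j x) (S.sem.noise j x)
    simp only [feature]
    rw [h1]
    linarith
  | some a =>
    have ha : a.1 ∈ S.candidates j := by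
      simp [features] at hu; exact hu.1
    have h1 := h.goodBasis.abs_centeredBasis_le (h.ne_of_mem_candidates ha) a.2 x
    have h2 : 0 ≤ 2 * C * K := by positivity
    have h3 := abs_nonneg (S.sem.noise j x)
    simp only [feature]
    linarith

lemma Regular.memLp_feature (h : S.Regular K C η σbar c) {R : ℕ} {j : Fin p}
    {u : Option (Fin p × ℕ)} (hu : u ∈ S.features R j) : MemLp (S.feature j u) 2 S.sem.P := by
  have h0 : MemLp (fun x => |S.sem.noise j x|) 2 S.sem.P := (S.memLp_noise j).norm
  have h1 : MemLp (fun x => 2 + 2 * C * K + |S.sem.noise j x|) 2 S.sem.P :=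
    (memLp_const (2 + 2 * C * K)).add h0
  refine h1.mono (h.measurable_feature hu).aestronglyMeasurable (ae_of_all _ fun x => ?_)
  rw [Real.norm_eq_abs, Real.norm_eq_abs]
  exact (h.abs_feature_le hu x).trans (le_abs_self _)

/-- If the second moments of the features are close, then so are the residual variances of all
parameters. -/
lemma Regular.abs_residual_sub_le (h : S.Regular K C η σbar c) {R : ℕ} {t : ℝ} (ht : 0 ≤ t) {n : ℕ}
    {x : Fin n → Fin p → ℝ} (hx : S.MomentsClose R t x) {β : Fin p → Fin p → ℕ → ℝ}
    (hβ : ∀ k j, SobolevBall C η (β k j)) (j : Fin p) :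
    |(n : ℝ)⁻¹ * ∑ i, (x i j - S.fit R β j (x i)) ^ 2
      - ∫ y, (y j - S.fit R β j y) ^ 2 ∂S.sem.P| ≤ t * (1 + C * K) ^ 2 := by
  set γ : Option (Fin p × ℕ) → ℝ := fun u => u.elim 1 fun a => -β a.1 j a.2 with hγ
  set F := S.features R j with hF
  have hlin : ∀ y : Fin p → ℝ, y j - S.fit R β j y = ∑ u ∈ F, γ u * S.feature j u y := by
    intro y
    rw [hF, features, Finset.sum_insertNone, Finset.sum_product]
    simp [hγ, feature, fit, sub_eq_add_neg]
  have hsq : ∀ y : Fin p → ℝ, (y j - S.fit R β j y) ^ 2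
      = ∑ u ∈ F, ∑ v ∈ F, γ u * γ v * (S.feature j u y * S.feature j v y) := by
    intro y
    rw [hlin, sq, Finset.sum_mul_sum]
    exact Finset.sum_congr rfl fun u _ => Finset.sum_congr rfl fun v _ => by ring
  have hint : ∀ u ∈ F, ∀ v ∈ F,
      Integrable (fun y => γ u * γ v * (S.feature j u y * S.feature j v y)) S.sem.P :=
    fun u hu v hv => ((h.memLp_feature hu).integrable_mul (h.memLp_feature hv)).const_mul _
  have hpop : ∫ y, (y j - S.fit R β j y) ^ 2 ∂S.sem.P
      = ∑ u ∈ F, ∑ v ∈ F, γ u * γ v * ∫ y, S.feature j u y * S.feature j v y ∂S.sem.P := by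
    simp_rw [hsq]
    rw [integral_finsetSum _ fun u hu => integrable_finsetSum _ fun v hv => hint u hu v hv]
    refine Finset.sum_congr rfl fun u hu => ?_
    rw [integral_finsetSum _ fun v hv => hint u hu v hv]
    exact Finset.sum_congr rfl fun v _ => integral_const_mul _ _
  have hemp : (n : ℝ)⁻¹ * ∑ i, (x i j - S.fit R β j (x i)) ^ 2
      = ∑ u ∈ F, ∑ v ∈ F,
        γ u * γ v * ((n : ℝ)⁻¹ * ∑ i, S.feature j u (x i) * S.feature j v (x i)) := by
    simp_rw [hsq]
    have hc : ∀ G : Option (Fin p × ℕ) → Option (Fin p × ℕ) → Fin n → ℝ,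
        ∑ i, ∑ u ∈ F, ∑ v ∈ F, G u v i = ∑ u ∈ F, ∑ v ∈ F, ∑ i, G u v i := by
      intro G
      rw [Finset.sum_comm]
      exact Finset.sum_congr rfl fun u _ => Finset.sum_comm
    rw [hc, Finset.mul_sum]
    refine Finset.sum_congr rfl fun u _ => ?_
    rw [Finset.mul_sum]
    refine Finset.sum_congr rfl fun v _ => ?_
    rw [← Finset.mul_sum]; ring
  have hw : ∑ u ∈ F, |γ u| * featureWeight u ≤ 1 + C * K := by
    have hC := h.C_pos
    rw [hF, features, Finset.sum_insertNone, Finset.sum_product]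
    simp only [hγ, Option.elim, abs_one, featureWeight, abs_neg, mul_one]
    have : ∑ k ∈ S.candidates j, ∑ r ∈ Finset.range R, |β k j r| * ((r : ℝ) + 1)
        ≤ ∑ k ∈ S.candidates j, C :=
      Finset.sum_le_sum fun k _ => (hβ k j).sum_mul_le h.one_lt_η.le R
    rw [Finset.sum_const, nsmul_eq_mul] at this
    have h2 := mul_le_mul_of_nonneg_right (h.card_candidates_le j) hC.le
    linarith
  have hw0 : 0 ≤ ∑ u ∈ F, |γ u| * featureWeight u := Finset.sum_nonneg fun u _ =>
    mul_nonneg (abs_nonneg _) (zero_le_one.trans (one_le_featureWeight u))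
  rw [hemp, hpop, ← Finset.sum_sub_distrib]
  simp_rw [← Finset.sum_sub_distrib, ← mul_sub]
  calc _ ≤ ∑ u ∈ F, ∑ v ∈ F, |γ u * γ v * ((n : ℝ)⁻¹ * ∑ i, S.feature j u (x i) * S.feature j v (x i)
          - ∫ y, S.feature j u y * S.feature j v y ∂S.sem.P)| :=
        (Finset.abs_sum_le_sum_abs _ _).trans
          (Finset.sum_le_sum fun u _ => Finset.abs_sum_le_sum_abs _ _)
    _ ≤ ∑ u ∈ F, ∑ v ∈ F, t * ((|γ u| * featureWeight u) * (|γ v| * featureWeight v)) := by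
        refine Finset.sum_le_sum fun u hu => Finset.sum_le_sum fun v hv => ?_
        rw [abs_mul, abs_mul]
        calc _ ≤ |γ u| * |γ v| * (t * (featureWeight u * featureWeight v)) := by
              gcongr; exact hx j u hu v hv
          _ = _ := by ring
    _ = t * (∑ u ∈ F, |γ u| * featureWeight u) ^ 2 := by
        rw [sq, Finset.sum_mul_sum, Finset.mul_sum]
        simp_rw [Finset.mul_sum]
    _ ≤ _ := by gcongr

end Setup

/-! ### Elementary inequalities for the logarithm -/

lemma sq_sub_one_le_of_log {t : ℝ} (ht : 0 < t) :
    (t - 1) ^ 2 ≤ 2 * (t + 1) * (t - 1 - Real.log t) := by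
  obtain ⟨y, hy, rfl⟩ : ∃ y : ℝ, 0 < y ∧ y ^ 2 = t := ⟨√t, Real.sqrt_pos.2 ht, Real.sq_sqrt ht.le⟩
  have h1 := Real.log_le_sub_one_of_pos hy
  have h2 : (y - 1) ^ 2 ≤ y ^ 2 - 1 - Real.log (y ^ 2) := by
    rw [Real.log_pow]; push_cast; nlinarith
  have h3 : (y + 1) ^ 2 ≤ 2 * (y ^ 2 + 1) := by nlinarith [sq_nonneg (y - 1)]
  calc (y ^ 2 - 1) ^ 2 = (y + 1) ^ 2 * (y - 1) ^ 2 := by ring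
    _ ≤ 2 * (y ^ 2 + 1) * (y ^ 2 - 1 - Real.log (y ^ 2)) :=
        mul_le_mul h3 h2 (sq_nonneg _) (by positivity)

lemma one_sub_div_le_log {a b : ℝ} (ha : 0 < a) (hb : 0 < b) :
    1 - a / b ≤ Real.log b - Real.log a := by
  have := Real.one_sub_inv_le_log_of_pos (div_pos hb ha)
  rwa [inv_div, Real.log_div hb.ne' ha.ne'] at this

lemma log_sub_le_div {a b : ℝ} (ha : 0 < a) (hb : 0 < b) :
    Real.log b - Real.log a ≤ (b - a) / a := by
  have := Real.log_le_sub_one_of_pos (div_pos hb ha)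
  rw [Real.log_div hb.ne' ha.ne'] at this
  rwa [sub_div, div_self (ne_of_gt ha)]

/-- Lower bound for the log residual of a fit with error `H`. -/
lemma log_residual_lower {a r H Z x c M : ℝ} (hc : 0 < c) (hcM : c ≤ M) (ha : c / 2 ≤ a)
    (haM : a ≤ M) (hr : c / 2 ≤ r) (hH : 0 ≤ H) (hHM : H ≤ M) (hZ : 0 ≤ Z) (hx : x ^ 2 ≤ Z * H)
    (hrx : r = a + 2 * x + H) :
    H / (4 * M) - 4 * Z / c ≤ Real.log r - Real.log a := by
  have hM : 0 < M := hc.trans_le hcM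
  have ha0 : 0 < a := by linarith
  have hr0 : 0 < r := by linarith
  set u := H / 2 - 2 * Z with hu
  have hru : a + u ≤ r := by
    have : |2 * x| ≤ H / 2 + 2 * Z := by
      refine abs_le_of_sq_le_sq ?_ (by positivity)
      nlinarith [sq_nonneg (H / 2 - 2 * Z)]
    have := (abs_le.1 this).1
    linarith
  have hZc : Z / M ≤ 4 * Z / c := by
    rw [div_le_div_iff₀ hM hc]; nlinarith [mul_nonneg hZ hM.le, mul_le_mul_of_nonneg_left hcM hZ]
  rcases le_total 0 u with h0 | h0
  · have h1 : Real.log (a + u) ≤ Real.log r := Real.log_le_log (by linarith) hru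
    have h2 := one_sub_div_le_log ha0 (show 0 < a + u by linarith)
    have h3 : u / (2 * M) ≤ 1 - a / (a + u) := by
      have : 1 - a / (a + u) = u / (a + u) := by
        have : a + u ≠ 0 := by linarith
        field_simp; ring
      rw [this]
      exact div_le_div_of_nonneg_left h0 (by linarith) (by linarith)
    have h4 : u / (2 * M) = H / (4 * M) - Z / M := by rw [hu]; field_simp; ring
    linarith
  · have h5 : u * (2 / c) ≤ Real.log r - Real.log a := by
      rcases le_total a r with har | har
      · have := Real.log_le_log ha0 har
        have : u * (2 / c) ≤ 0 := mul_nonpos_of_nonpos_of_nonneg h0 (by positivity)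
        linarith
      · have h2 := one_sub_div_le_log ha0 hr0
        have h3 : u * (2 / c) ≤ 1 - a / r := by
          have h4 : 1 - a / r = (r - a) * r⁻¹ := by field_simp
          have h6 : r⁻¹ ≤ 2 / c := by
            rw [← inv_div]; exact inv_anti₀ (by positivity) hr
          rw [h4]
          have h7 : (r - a) * (2 / c) ≤ (r - a) * r⁻¹ := mul_le_mul_of_nonpos_left h6 (by linarith)
          have h8 : u * (2 / c) ≤ (r - a) * (2 / c) :=
            mul_le_mul_of_nonneg_right (by linarith) (by positivity)
          linarith
        linarith
    have h9 : u * (2 / c) = H / c - 4 * Z / c := by rw [hu]; field_simp; ring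
    have h10 : H / (4 * M) ≤ H / c := div_le_div_of_nonneg_left hH hc (by linarith)
    linarith

/-- Upper bound for the log residual of a fit with error `H`. -/
lemma log_residual_upper {a r H Z x c : ℝ} (hc : 0 < c) (ha : c / 2 ≤ a) (hr : 0 < r)
    (hH : 0 ≤ H) (hZ : 0 ≤ Z) (hx : x ^ 2 ≤ Z * H) (hrx : r = a + 2 * x + H) :
    Real.log r - Real.log a ≤ 2 / c * (Z + 2 * H) := by
  have ha0 : 0 < a := by linarith
  have h1 : |2 * x| ≤ Z + H := by
    refine abs_le_of_sq_le_sq ?_ (by positivity)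
    nlinarith [sq_nonneg (H - Z)]
  have h2 := (abs_le.1 h1).2
  refine (log_sub_le_div ha0 hr).trans ?_
  rw [div_eq_mul_inv]
  have h3 : a⁻¹ ≤ 2 / c := by rw [← inv_div]; exact inv_anti₀ (by positivity) ha
  calc (r - a) * a⁻¹ ≤ (Z + 2 * H) * a⁻¹ :=
        mul_le_mul_of_nonneg_right (by linarith) (by positivity)
    _ ≤ (Z + 2 * H) * (2 / c) := by gcongr
    _ = _ := by ring

/-! ### Topological orderings -/

lemma exists_equiv_of_isLinearOrder {α : Type*} [Fintype α] (s : α → α → Prop)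
    (hs : IsLinearOrder α s) {p : ℕ} (hp : Fintype.card α = p) :
    ∃ e : Fin p ≃ α, ∀ k j, s (e k) (e j) → k ≤ j := by
  let lo : LinearOrder α :=
    { le := s
      le_refl := hs.refl
      le_trans := hs.trans
      le_antisymm := hs.antisymm
      le_total := hs.total
      toDecidableLE := Classical.decRel _ }
  let e := Fintype.orderIsoFinOfCardEq α hp
  exact ⟨e.toEquiv, fun k j hkj => e.le_iff_le.1 hkj⟩

lemma exists_consistent {p : ℕ} {E : Finset (Fin p × Fin p)} (hE : IsDAG E) :
    ∃ π : Equiv.Perm (Fin p), Consistent π E := by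
  classical
  set r : Fin p → Fin p → Prop := Relation.ReflTransGen fun k j => (k, j) ∈ E with hr
  have hpo : IsPartialOrder (Fin p) r :=
    { refl := fun _ => Relation.ReflTransGen.refl
      trans := fun _ _ _ => Relation.ReflTransGen.trans
      antisymm := by
        intro a b hab hba
        rcases Relation.reflTransGen_iff_eq_or_transGen.1 hab with h | h
        · exact h.symm
        · exact (hE a (h.trans_left hba)).elim }
  obtain ⟨s, hs, hrs⟩ := extend_partialOrder r
  obtain ⟨e, he⟩ := exists_equiv_of_isLinearOrder s hs (Fintype.card_fin p)
  refine ⟨e, fun k j hkj => ?_⟩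
  have h2 : k ≤ j := he k j (hrs _ _ (Relation.ReflTransGen.single hkj))
  refine lt_of_le_of_ne h2 ?_
  rintro rfl
  exact hE _ (Relation.TransGen.single hkj)

/-! ### Nearly optimal parameters -/

namespace Setup

variable {p : ℕ} {S : Setup p} {K R : ℕ} {C η σbar c s lam τ : ℝ} {n : ℕ}
  {x : Fin n → Fin p → ℝ} {θ : Param p}

lemma Feasible.with_sigma (hθ : S.Feasible C η R s θ) {σ : Fin p → ℝ} (hσ : ∀ j, 0 < σ j) :
    S.Feasible C η R s ⟨θ.β, σ⟩ :=
  ⟨hσ, hθ.sobolev, hθ.truncated, hθ.acyclic, hθ.subset_super, hθ.card_le⟩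

lemma empiricalResidual_nonneg (j : Fin p) : 0 ≤ S.empiricalResidual x θ j :=
  mul_nonneg (by positivity) (Finset.sum_nonneg fun _ _ => sq_nonneg _)

/-- The objective at the optimal variances. -/
lemma objective_profiled (hr : ∀ j, 0 < S.empiricalResidual x θ j) :
    S.objective lam x ⟨θ.β, fun j => √(S.empiricalResidual x θ j)⟩
      = ∑ j, Real.log (S.empiricalResidual x θ j) + p + lam ^ 2 * (θ.edges.card : ℝ) := by
  unfold objective
  have h1 : ∀ j, S.empiricalResidual x ⟨θ.β, fun j => √(S.empiricalResidual x θ j)⟩ j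
      = S.empiricalResidual x θ j := fun j => rfl
  have h2 : (⟨θ.β, fun j => √(S.empiricalResidual x θ j)⟩ : Param p).edges = θ.edges := rfl
  simp only [h1, h2]
  have h3 : ∀ j, √(S.empiricalResidual x θ j) ^ 2 = S.empiricalResidual x θ j :=
    fun j => Real.sq_sqrt (hr j).le
  simp only [h3]
  have h4 : ∀ j, S.empiricalResidual x θ j / S.empiricalResidual x θ j = 1 :=
    fun j => div_self (hr j).ne'
  simp [h4]

lemma IsNearOptimal.residual_pos (h : S.IsNearOptimal C η R s lam τ x θ) (hτ : 0 ≤ τ)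
    (j : Fin p) : 0 < S.empiricalResidual x θ j := by
  classical
  by_contra hcon
  have h0 : S.empiricalResidual x θ j = 0 :=
    le_antisymm (not_lt.1 hcon) (empiricalResidual_nonneg j)
  have hpos := h.1.σ_pos
  set σ : Fin p → ℝ := Function.update θ.σ j (θ.σ j * Real.exp (-(τ + 1))) with hσ
  have hσpos : ∀ k, 0 < σ k := by
    intro k
    by_cases hk : k = j
    · subst hk; simp only [hσ, Function.update_self]; exact mul_pos (hpos k) (Real.exp_pos _)
    · simp only [hσ, Function.update_of_ne hk]; exact hpos k
  have hle := h.2 _ (h.1.with_sigma hσpos)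
  have hval : S.objective lam x ⟨θ.β, σ⟩ = S.objective lam x θ - 2 * (τ + 1) := by
    unfold objective
    have h1 : ∀ k, S.empiricalResidual x ⟨θ.β, σ⟩ k = S.empiricalResidual x θ k := fun _ => rfl
    have h2 : (⟨θ.β, σ⟩ : Param p).edges = θ.edges := rfl
    simp only [h1, h2]
    have h3 : ∀ k, S.empiricalResidual x θ k / σ k ^ 2 = S.empiricalResidual x θ k / θ.σ k ^ 2 := by
      intro k
      by_cases hk : k = j
      · subst hk; simp [h0]
      · simp [hσ, Function.update_of_ne hk]
    have h4 : ∑ k, Real.log (σ k ^ 2) = ∑ k, Real.log (θ.σ k ^ 2) - 2 * (τ + 1) := by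
      rw [← Finset.add_sum_erase _ _ (Finset.mem_univ j),
        ← Finset.add_sum_erase _ (fun k => Real.log (θ.σ k ^ 2)) (Finset.mem_univ j)]
      have h5 : ∑ k ∈ Finset.univ.erase j, Real.log (σ k ^ 2)
          = ∑ k ∈ Finset.univ.erase j, Real.log (θ.σ k ^ 2) :=
        Finset.sum_congr rfl fun k hk => by
          simp [hσ, Function.update_of_ne (Finset.ne_of_mem_erase hk)]
      rw [h5]
      simp only [hσ, Function.update_self]
      rw [Real.log_pow, Real.log_pow, Real.log_mul (hpos j).ne' (Real.exp_pos _).ne', Real.log_exp]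
      push_cast
      ring
    simp only [h3, h4]
    ring
  rw [hval] at hle
  linarith

/-- The excess of the objective over its value at the optimal variances. -/
lemma IsNearOptimal.sum_excess_le (h : S.IsNearOptimal C η R s lam τ x θ) (hτ : 0 ≤ τ) :
    ∑ j, (S.empiricalResidual x θ j / θ.σ j ^ 2 - 1
      - Real.log (S.empiricalResidual x θ j / θ.σ j ^ 2)) ≤ τ := by
  have hr := h.residual_pos hτ
  have hle := h.2 _ (h.1.with_sigma fun j => Real.sqrt_pos.2 (hr j))
  rw [objective_profiled hr] at hle
  unfold objective at hle
  have h1 : ∀ j, Real.log (S.empiricalResidual x θ j / θ.σ j ^ 2)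
      = Real.log (S.empiricalResidual x θ j) - Real.log (θ.σ j ^ 2) := fun j =>
    Real.log_div (hr j).ne' (pow_pos (h.1.σ_pos j) 2).ne'
  simp only [h1, Finset.sum_sub_distrib, Finset.sum_const, Finset.card_univ, Fintype.card_fin,
    nsmul_eq_mul, mul_one]
  linarith

lemma IsNearOptimal.excess_le (h : S.IsNearOptimal C η R s lam τ x θ) (hτ : 0 ≤ τ) (j : Fin p) :
    S.empiricalResidual x θ j / θ.σ j ^ 2 - 1
      - Real.log (S.empiricalResidual x θ j / θ.σ j ^ 2) ≤ τ := by
  refine le_trans ?_ (h.sum_excess_le hτ)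
  refine Finset.single_le_sum (f := fun j => S.empiricalResidual x θ j / θ.σ j ^ 2 - 1
      - Real.log (S.empiricalResidual x θ j / θ.σ j ^ 2)) (fun k _ => ?_) (Finset.mem_univ j)
  have := Real.log_le_sub_one_of_pos
    (div_pos (h.residual_pos hτ k) (pow_pos (h.1.σ_pos k) 2))
  linarith

/-- The variance of a nearly optimal parameter is at most a constant times the residual. -/
lemma IsNearOptimal.sigma_sq_le (h : S.IsNearOptimal C η R s lam τ x θ) (hτ : 0 ≤ τ)
    {T : ℝ} (hT : τ ≤ T) (j : Fin p) :
    θ.σ j ^ 2 ≤ Real.exp (T + 1) * S.empiricalResidual x θ j := by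
  have hr := h.residual_pos hτ j
  have hσ := pow_pos (h.1.σ_pos j) 2
  have h1 := h.excess_le hτ j
  set t := S.empiricalResidual x θ j / θ.σ j ^ 2 with ht
  have ht0 : 0 < t := div_pos hr hσ
  have h2 : -(T + 1) ≤ Real.log t := by linarith
  have h3 : Real.exp (-(T + 1)) ≤ t := by
    rw [← Real.exp_log ht0]; exact Real.exp_le_exp.2 h2
  have h4 : Real.exp (-(T + 1)) * θ.σ j ^ 2 ≤ S.empiricalResidual x θ j := by
    rw [ht, le_div_iff₀ hσ] at h3; exact h3
  calc θ.σ j ^ 2 = Real.exp (T + 1) * (Real.exp (-(T + 1)) * θ.σ j ^ 2) := by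
        rw [← mul_assoc, ← Real.exp_add]; simp
    _ ≤ _ := by gcongr

/-- The distance of the variances of a nearly optimal parameter from the profiled ones. -/
lemma IsNearOptimal.sum_sq_sub_le (h : S.IsNearOptimal C η R s lam τ x θ) (hτ : 0 ≤ τ)
    {T M : ℝ} (hT : τ ≤ T) (hM : ∀ j, S.empiricalResidual x θ j ≤ M) :
    ∑ j, (S.empiricalResidual x θ j - θ.σ j ^ 2) ^ 2
      ≤ (Real.exp (T + 1) * M) ^ 2 * (2 * (2 * T + 3)) * τ := by
  have hpt : ∀ j, (S.empiricalResidual x θ j - θ.σ j ^ 2) ^ 2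
      ≤ (Real.exp (T + 1) * M) ^ 2 * (2 * (2 * T + 3)) *
        (S.empiricalResidual x θ j / θ.σ j ^ 2 - 1
          - Real.log (S.empiricalResidual x θ j / θ.σ j ^ 2)) := by
    intro j
    have hr := h.residual_pos hτ j
    have hσ := pow_pos (h.1.σ_pos j) 2
    have h1 := h.excess_le hτ j
    have hs := h.sigma_sq_le hτ hT j
    have hs2 : θ.σ j ^ 2 ≤ Real.exp (T + 1) * M := hs.trans (by gcongr; exact hM j)
    have heq : S.empiricalResidual x θ j
        = S.empiricalResidual x θ j / θ.σ j ^ 2 * θ.σ j ^ 2 := (div_mul_cancel₀ _ hσ.ne').symm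
    set t := S.empiricalResidual x θ j / θ.σ j ^ 2 with ht
    have ht0 : 0 < t := div_pos hr hσ
    have h2 := sq_sub_one_le_of_log ht0
    have hψ : 0 ≤ t - 1 - Real.log t := by linarith [Real.log_le_sub_one_of_pos ht0]
    have ht1 : t ≤ 2 * T + 2 := by
      have h3 : Real.log t ≤ t / 2 := by
        have h4 := Real.log_le_sub_one_of_pos (show 0 < t / 2 by positivity)
        rw [Real.log_div ht0.ne' two_ne_zero] at h4
        have := Real.log_two_lt_d9
        linarith
      linarith
    rw [heq]
    calc (t * θ.σ j ^ 2 - θ.σ j ^ 2) ^ 2 = (θ.σ j ^ 2) ^ 2 * (t - 1) ^ 2 := by ring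
      _ ≤ (Real.exp (T + 1) * M) ^ 2 * (2 * (2 * T + 3) * (t - 1 - Real.log t)) := by
          have h5 : 2 * (t + 1) * (t - 1 - Real.log t)
              ≤ 2 * (2 * T + 3) * (t - 1 - Real.log t) :=
            mul_le_mul_of_nonneg_right (by linarith) hψ
          exact mul_le_mul (by gcongr) (h2.trans h5) (sq_nonneg _) (sq_nonneg _)
      _ = _ := by ring
  refine (Finset.sum_le_sum fun j _ => hpt j).trans ?_
  rw [← Finset.mul_sum]
  have hT0 : 0 ≤ T := hτ.trans hT
  exact mul_le_mul_of_nonneg_left (h.sum_excess_le hτ) (by positivity)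

lemma IsEstimator.isNearOptimal (h : S.IsEstimator C η R s lam x θ) :
    S.IsNearOptimal C η R s lam 0 x θ :=
  ⟨h.1, fun θ₀ hfeas => by rw [add_zero]; exact h.2 θ₀ hfeas⟩

/-- Comparison of the log residuals of a nearly optimal parameter with a competitor. -/
lemma IsNearOptimal.sum_log_le (h : S.IsNearOptimal C η R s lam τ x θ) (hτ : 0 ≤ τ)
    {θ' : Param p} (hθ' : S.Feasible C η R s θ') (hr' : ∀ j, 0 < S.empiricalResidual x θ' j) :
    ∑ j, Real.log (S.empiricalResidual x θ j)
      ≤ ∑ j, Real.log (S.empiricalResidual x θ' j) + lam ^ 2 * s + τ := by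
  have hr := h.residual_pos hτ
  have h1 := h.2 _ (hθ'.with_sigma fun j => Real.sqrt_pos.2 (hr' j))
  rw [objective_profiled hr'] at h1
  have h2 : ∑ j, Real.log (S.empiricalResidual x θ j) + p + lam ^ 2 * (θ.edges.card : ℝ)
      ≤ S.objective lam x θ := by
    unfold objective
    have h3 : ∑ j, (Real.log (S.empiricalResidual x θ j) + 1)
        ≤ ∑ j, (Real.log (θ.σ j ^ 2) + S.empiricalResidual x θ j / θ.σ j ^ 2) := by
      refine Finset.sum_le_sum fun j _ => ?_
      have hσ := pow_pos (h.1.σ_pos j) 2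
      have := Real.log_le_sub_one_of_pos (div_pos (hr j) hσ)
      rw [Real.log_div (hr j).ne' hσ.ne'] at this
      linarith
    rw [Finset.sum_add_distrib, Finset.sum_add_distrib] at h3
    simp only [Finset.sum_const, Finset.card_univ, Fintype.card_fin, nsmul_eq_mul, mul_one] at h3
    linarith
  have h4 : lam ^ 2 * (θ'.edges.card : ℝ) ≤ lam ^ 2 * s := by
    gcongr; exact hθ'.card_le
  have h5 : 0 ≤ lam ^ 2 * (θ.edges.card : ℝ) := by positivity
  linarith

end Setup

namespace Setup

variable {p : ℕ} {S : Setup p} {K R : ℕ} {C η σbar c s lam τ : ℝ} {n : ℕ}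
  {x : Fin n → Fin p → ℝ} {θ : Param p}

/-! ### Identification of the order -/

lemma Regular.exists_comparator (h : S.Regular K C η σbar c) (hR : 1 ≤ R)
    (hs : (S.sem.edges.card : ℝ) ≤ s) : ∃ θ₀ : Param p, S.Feasible C η R s θ₀ ∧
      (∀ k j, (k, j) ∉ S.sem.edges → ∀ r, θ₀.β k j r = 0) ∧
      ∀ j y, |S.sem.signal j y - S.fit R θ₀.β j y|
        ≤ 2 * C * (S.sem.parents j).card * (R : ℝ) ^ (-η) := by
  obtain ⟨β, hβ, htr, hzero, hbias⟩ := h.exists_truncated_truth hR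
  have hsub : (⟨β, fun _ => 1⟩ : Param p).edges ⊆ S.sem.edges := by
    rintro ⟨k, j⟩ he
    by_contra hcon
    simp only [Param.edges, Finset.mem_filter, Finset.mem_univ, true_and] at he
    obtain ⟨r, hr⟩ := he
    exact hr (hzero k j hcon r)
  refine ⟨⟨β, fun _ => 1⟩, ⟨fun _ => one_pos, hβ, htr, fun v hv => ?_,
    hsub.trans h.wellSpecified.2.1, ?_⟩, hzero, hbias⟩
  · exact S.sem.acyclic v (Relation.TransGen.mono (fun _ _ he => hsub he) v v hv)
  · exact le_trans (by exact_mod_cast Finset.card_le_card hsub) hs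

lemma Regular.sum_bias_sq_le (h : S.Regular K C η σbar c) (hs : (S.sem.edges.card : ℝ) ≤ s) :
    ∑ j, (2 * C * (S.sem.parents j).card * (R : ℝ) ^ (-η)) ^ 2
      ≤ 4 * C ^ 2 * K * (s * (R : ℝ) ^ (-2 * η)) := by
  have hpow : ((R : ℝ) ^ (-η)) ^ 2 = (R : ℝ) ^ (-2 * η) := by
    rw [← Real.rpow_natCast, ← Real.rpow_mul (by positivity)]; congr 1; push_cast; ring
  have hsum : ∑ j, ((S.sem.parents j).card : ℝ) ≤ s := by
    refine le_trans (le_of_eq ?_) hs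
    rw [← sum_card_parents S.sem.edges]
    push_cast
    rfl
  calc _ ≤ ∑ j, 4 * C ^ 2 * K * (R : ℝ) ^ (-2 * η) * ((S.sem.parents j).card : ℝ) := by
        refine Finset.sum_le_sum fun j _ => ?_
        rw [mul_pow, hpow]
        have := h.card_parents_le j
        have h0 : (0 : ℝ) ≤ (S.sem.parents j).card := Nat.cast_nonneg _
        have h1 : (0 : ℝ) ≤ (R : ℝ) ^ (-2 * η) := by positivity
        have h2 : ((S.sem.parents j).card : ℝ) ^ 2 ≤ K * (S.sem.parents j).card := by nlinarith
        calc (2 * C * (S.sem.parents j).card) ^ 2 * (R : ℝ) ^ (-2 * η)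
            = 4 * C ^ 2 * (R : ℝ) ^ (-2 * η) * ((S.sem.parents j).card : ℝ) ^ 2 := by ring
          _ ≤ 4 * C ^ 2 * (R : ℝ) ^ (-2 * η) * (K * (S.sem.parents j).card) := by gcongr
          _ = _ := by ring
    _ = 4 * C ^ 2 * K * (R : ℝ) ^ (-2 * η) * ∑ j, ((S.sem.parents j).card : ℝ) := by
        rw [Finset.mul_sum]
    _ ≤ 4 * C ^ 2 * K * (R : ℝ) ^ (-2 * η) * s := by gcongr
    _ = _ := by ring

/-- The empirical residual of any feasible parameter is bounded below by the residual variance. -/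
lemma Regular.residualVar_sub_le (h : S.Regular K C η σbar c) {t : ℝ} (ht : 0 ≤ t)
    (hx : S.MomentsClose R t x) (hθ : S.Feasible C η R s θ) (j : Fin p) :
    S.residualVar C η j (θ.parents j) - t * (1 + C * K) ^ 2 ≤ S.empiricalResidual x θ j := by
  have h1 := (abs_le.1 (h.abs_residual_sub_le ht hx hθ.sobolev j)).1
  have h2 := h.residualVar_parents_le hθ j
  rw [h.empiricalResidual_eq hθ]
  linarith

lemma Regular.le_residualVar_parents (h : S.Regular K C η σbar c) (hθ : S.Feasible C η R s θ)
    (j : Fin p) : c ≤ S.residualVar C η j (θ.parents j) :=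
  h.boundedVariances.2 j _ fun _ hk =>
    S.mem_candidates.2 (hθ.subset_super (Param.mem_parents.1 hk))

lemma Regular.half_le_residual (h : S.Regular K C η σbar c) {t : ℝ} (ht : 0 ≤ t)
    (hx : S.MomentsClose R t x) (hsmall : t * (1 + C * K) ^ 2 ≤ c / 2)
    (hθ : S.Feasible C η R s θ) (j : Fin p) : c / 2 ≤ S.empiricalResidual x θ j := by
  have h1 := h.residualVar_sub_le ht hx hθ j
  have h2 := h.le_residualVar_parents hθ j
  linarith

/-- A topological order of a nearly optimal graph has small excess log residual variances. -/
lemma Regular.sum_log_residualVar_le (h : S.Regular K C η σbar c) (hR : 1 ≤ R)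
    (hs : (S.sem.edges.card : ℝ) ≤ s) {t : ℝ} (ht : 0 ≤ t) (hx : S.MomentsClose R t x)
    (hsmall : t * (1 + C * K) ^ 2 ≤ c / 2) (hopt : S.IsNearOptimal C η R s lam τ x θ)
    (hτ : 0 ≤ τ) {π : Equiv.Perm (Fin p)} (hπ : Consistent π θ.edges) :
    ∑ j, (Real.log (S.residualVar C η j (S.parentsUnder π j)) - Real.log (S.sem.σ j ^ 2))
      ≤ 3 / c * (1 + C * K) ^ 2 * (p * t) + 4 * C ^ 2 * K / c * (s * (R : ℝ) ^ (-2 * η))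
        + lam ^ 2 * s + τ := by
  have hc := h.c_pos
  obtain ⟨θ₀, hθ₀, hzero, hbias⟩ := h.exists_comparator hR hs
  set Δ := t * (1 + C * K) ^ 2 with hΔ
  have hΔ0 : 0 ≤ Δ := by positivity
  have hlog := hopt.sum_log_le hτ hθ₀ fun j =>
    lt_of_lt_of_le (by positivity) (h.half_le_residual ht hx hsmall hθ₀ j)
  have hlow : ∀ j, Real.log (S.residualVar C η j (S.parentsUnder π j)) - 2 / c * Δ
      ≤ Real.log (S.empiricalResidual x θ j) := by
    intro j
    have hsub : θ.parents j ⊆ S.parentsUnder π j := by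
      intro k hk
      have hk' := Param.mem_parents.1 hk
      simp only [parentsUnder, Finset.mem_filter, Finset.mem_univ, true_and]
      exact ⟨hπ _ _ (by simpa using hk'), hopt.1.subset_super hk'⟩
    have hcand : S.parentsUnder π j ⊆ S.candidates j := by
      intro k hk
      simp only [parentsUnder, Finset.mem_filter, Finset.mem_univ, true_and] at hk
      exact S.mem_candidates.2 hk.2
    have hν : c ≤ S.residualVar C η j (S.parentsUnder π j) := h.boundedVariances.2 j _ hcand
    have h1 := h.residualVar_sub_le ht hx hopt.1 j
    have h2 := h.residualVar_anti (j := j) hsub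
    set ν := S.residualVar C η j (S.parentsUnder π j)
    have h3 : Real.log (ν - Δ) ≤ Real.log (S.empiricalResidual x θ j) :=
      Real.log_le_log (by linarith) (by linarith)
    have h4 := log_sub_le_div (show 0 < ν - Δ by linarith) (show 0 < ν by linarith)
    have h5 : (ν - (ν - Δ)) / (ν - Δ) ≤ 2 / c * Δ := by
      rw [show ν - (ν - Δ) = Δ by ring, div_le_iff₀ (by linarith)]
      have : 1 ≤ 2 / c * (ν - Δ) := by
        rw [div_mul_eq_mul_div, le_div_iff₀ hc]; linarith
      nlinarith
    linarith
  have hup : ∀ j, Real.log (S.empiricalResidual x θ₀ j)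
      ≤ Real.log (S.sem.σ j ^ 2) + 1 / c * Δ
        + 1 / c * (2 * C * (S.sem.parents j).card * (R : ℝ) ^ (-η)) ^ 2 := by
    intro j
    have hσ := h.le_sigma_sq j
    have hpos : 0 < S.empiricalResidual x θ₀ j :=
      lt_of_lt_of_le (by positivity) (h.half_le_residual ht hx hsmall hθ₀ j)
    have h1 := (abs_le.1 (h.abs_residual_sub_le ht hx hθ₀.sobolev j)).2
    rw [← h.empiricalResidual_eq hθ₀] at h1
    have h2 := h.integral_truncated_truth_le hzero (hbias j)
    have h3 := log_sub_le_div (show 0 < S.sem.σ j ^ 2 by linarith) hpos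
    set b := (2 * C * (S.sem.parents j).card * (R : ℝ) ^ (-η)) ^ 2 with hb
    have hb0 : 0 ≤ b := sq_nonneg _
    have h4 : (S.empiricalResidual x θ₀ j - S.sem.σ j ^ 2) / S.sem.σ j ^ 2 ≤ (Δ + b) / c := by
      refine (div_le_div_of_nonneg_right (show _ ≤ Δ + b by linarith) (by linarith)).trans ?_
      exact div_le_div_of_nonneg_left (by positivity) hc hσ
    rw [add_div] at h4
    have h5 : Δ / c = 1 / c * Δ := by ring
    have h6 : b / c = 1 / c * b := by ring
    linarith
  have hsum1 := Finset.sum_le_sum fun j (_ : j ∈ Finset.univ) => hlow j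
  have hsum2 := Finset.sum_le_sum fun j (_ : j ∈ Finset.univ) => hup j
  have hb := mul_le_mul_of_nonneg_left (h.sum_bias_sq_le (R := R) hs)
    (show 0 ≤ 1 / c by positivity)
  rw [Finset.sum_sub_distrib] at hsum1 ⊢
  rw [Finset.sum_add_distrib, Finset.sum_add_distrib] at hsum2
  simp only [Finset.sum_const, Finset.card_univ, Fintype.card_fin, nsmul_eq_mul] at hsum1 hsum2
  rw [← Finset.mul_sum] at hsum2
  have e1 : 3 / c * (1 + C * K) ^ 2 * (p * t) = p * (2 / c * Δ) + p * (1 / c * Δ) := by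
    rw [hΔ]; ring
  have e2 : 4 * C ^ 2 * K / c * (s * (R : ℝ) ^ (-2 * η))
      = 1 / c * (4 * C ^ 2 * K * (s * (R : ℝ) ^ (-2 * η))) := by ring
  linarith

/-! ### The rate of convergence for a correct order -/

/-- The empirical variance of the errors of node `j`. -/
def noiseVar (S : Setup p) (x : Fin n → Fin p → ℝ) (j : Fin p) : ℝ :=
  (n : ℝ)⁻¹ * ∑ i, S.sem.noise j (x i) ^ 2

/-- The linear combinations of the signal of node `j` and of the first `R` basis functions of the
nodes in `g`. -/
def combination (S : Setup p) (R : ℕ) (j : Fin p) (g : Finset (Fin p)) (a₀ : ℝ)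
    (a : Fin p → ℕ → ℝ) (y : Fin p → ℝ) : ℝ :=
  a₀ * S.sem.signal j y + ∑ k ∈ g, ∑ r ∈ Finset.range R, a k r * S.centeredBasis k j r y

/-- The errors of node `j` are nearly orthogonal to all linear combinations of the basis functions
of variables that they are independent of. -/
def NearlyOrthogonal (S : Setup p) (R : ℕ) (L : ℝ) (x : Fin n → Fin p → ℝ) : Prop :=
  ∀ j, ∀ g ⊆ S.candidates j,
    (∃ B : Set (Fin p), (∀ k ∈ B, ∀ l ∈ S.sem.parents k, l ∈ B) ∧ j ∉ B ∧
      (∀ k ∈ S.sem.parents j, k ∈ B) ∧ ∀ k ∈ g, k ∈ B) →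
    ∀ (a₀ : ℝ) (a : Fin p → ℕ → ℝ),
      (∑ i, S.sem.noise j (x i) * S.combination R j g a₀ a (x i)) ^ 2
        ≤ S.sem.σ j ^ 2 * (4 * (((g.card * R + 1 : ℕ) : ℝ) * (Real.log 2 / 2) + L))
          * ∑ i, S.combination R j g a₀ a (x i) ^ 2

lemma fit_eq_sum (R : ℕ) {β : Fin p → Fin p → ℕ → ℝ} {j : Fin p} {g : Finset (Fin p)}
    (hg : g ⊆ S.candidates j) (hβ : ∀ k ∉ g, ∀ r, β k j r = 0) (y : Fin p → ℝ) :
    S.fit R β j y = ∑ k ∈ g, ∑ r ∈ Finset.range R, β k j r * S.centeredBasis k j r y := by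
  rw [fit, ← Finset.sum_subset hg]
  intro k _ hk
  exact Finset.sum_eq_zero fun r _ => by rw [hβ k hk, zero_mul]

/-- Decomposition of the empirical residual. -/
lemma Regular.residual_decomposition (h : S.Regular K C η σbar c) (hθ : S.Feasible C η R s θ)
    (j : Fin p) :
    S.empiricalResidual x θ j = S.noiseVar x j
      + 2 * ((n : ℝ)⁻¹ * ∑ i, S.sem.noise j (x i) * (S.sem.signal j (x i) - S.fit R θ.β j (x i)))
      + (n : ℝ)⁻¹ * ∑ i, (S.sem.signal j (x i) - S.fit R θ.β j (x i)) ^ 2 := by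
  have h1 : ∀ i, (x i j - S.fit R θ.β j (x i)) ^ 2 = S.sem.noise j (x i) ^ 2
      + 2 * (S.sem.noise j (x i) * (S.sem.signal j (x i) - S.fit R θ.β j (x i)))
      + (S.sem.signal j (x i) - S.fit R θ.β j (x i)) ^ 2 := fun i => by
    simp only [AdditiveSEM.noise]; ring
  rw [h.empiricalResidual_eq hθ, noiseVar, Finset.sum_congr rfl fun i _ => h1 i,
    Finset.sum_add_distrib, Finset.sum_add_distrib, ← Finset.mul_sum]
  ring

lemma NearlyOrthogonal.cross_sq_le {L : ℝ} (hx : S.NearlyOrthogonal R L x) (hn : 0 < n)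
    {j : Fin p} {g : Finset (Fin p)} (hg : g ⊆ S.candidates j)
    (hB : ∃ B : Set (Fin p), (∀ k ∈ B, ∀ l ∈ S.sem.parents k, l ∈ B) ∧ j ∉ B ∧
      (∀ k ∈ S.sem.parents j, k ∈ B) ∧ ∀ k ∈ g, k ∈ B)
    {β : Fin p → Fin p → ℕ → ℝ} (hβ : ∀ k ∉ g, ∀ r, β k j r = 0) (hσ : S.sem.σ j ^ 2 ≤ σbar ^ 2)
    (hL : 0 ≤ L) :
    ((n : ℝ)⁻¹ * ∑ i, S.sem.noise j (x i) * (S.sem.signal j (x i) - S.fit R β j (x i))) ^ 2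
      ≤ 4 * σbar ^ 2 * (g.card * R + 1 + L) / n
        * ((n : ℝ)⁻¹ * ∑ i, (S.sem.signal j (x i) - S.fit R β j (x i)) ^ 2) := by
  have hcomb : ∀ y, S.sem.signal j y - S.fit R β j y
      = S.combination R j g 1 (fun k r => -β k j r) y := by
    intro y
    rw [combination, fit_eq_sum R hg hβ]
    simp [sub_eq_add_neg]
  have hn' : (0 : ℝ) < n := by exact_mod_cast hn
  have h1 := hx j g hg hB 1 fun k r => -β k j r
  simp_rw [← hcomb] at h1
  set Q := ∑ i, (S.sem.signal j (x i) - S.fit R β j (x i)) ^ 2 with hQ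
  have hQ0 : 0 ≤ Q := Finset.sum_nonneg fun _ _ => sq_nonneg _
  rw [mul_pow]
  have hlog : Real.log 2 / 2 ≤ 1 := by linarith [Real.log_two_lt_d9]
  have hlog0 : 0 ≤ Real.log 2 / 2 := by positivity
  have h2 : S.sem.σ j ^ 2 * (4 * (((g.card * R + 1 : ℕ) : ℝ) * (Real.log 2 / 2) + L)) * Q
      ≤ σbar ^ 2 * (4 * (g.card * R + 1 + L)) * Q := by
    have h3 : ((g.card * R + 1 : ℕ) : ℝ) * (Real.log 2 / 2) ≤ g.card * R + 1 := by
      push_cast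
      exact mul_le_of_le_one_right (by positivity) hlog
    have h4 : 0 ≤ ((g.card * R + 1 : ℕ) : ℝ) * (Real.log 2 / 2) := by positivity
    gcongr
  calc ((n : ℝ)⁻¹) ^ 2 * _ ≤ ((n : ℝ)⁻¹) ^ 2 * (σbar ^ 2 * (4 * (g.card * R + 1 + L)) * Q) := by
        gcongr; exact h1.trans h2
    _ = _ := by field_simp

/-- From log residuals to residuals. -/
lemma sum_sq_residual_le_of_log {a r r₀ H X H₀ X₀ Z v : Fin p → ℝ} {M ZZ BB t' δ : ℝ}
    (hc : 0 < c) (hcM : c ≤ M) (ha : ∀ j, c / 2 ≤ a j) (haM : ∀ j, a j ≤ M)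
    (hr : ∀ j, c / 2 ≤ r j) (hr₀ : ∀ j, 0 < r₀ j) (hH : ∀ j, 0 ≤ H j) (hH₀ : ∀ j, 0 ≤ H₀ j)
    (hHM : ∀ j, H j ≤ M) (hZ : ∀ j, 0 ≤ Z j) (hX : ∀ j, X j ^ 2 ≤ Z j * H j)
    (hX₀ : ∀ j, X₀ j ^ 2 ≤ Z j * H₀ j) (hcs : ∀ j, X j ^ 2 ≤ a j * H j)
    (hdec : ∀ j, r j = a j + 2 * X j + H j) (hdec₀ : ∀ j, r₀ j = a j + 2 * X₀ j + H₀ j)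
    (hv : ∀ j, |a j - v j| ≤ t')
    (hlog : ∑ j, Real.log (r j) ≤ ∑ j, Real.log (r₀ j) + δ)
    (hsumZ : ∑ j, Z j ≤ ZZ) (hsumH₀ : ∑ j, H₀ j ≤ BB) :
    (∀ j, r j ≤ 4 * M) ∧ ∑ j, (v j - r j) ^ 2
      ≤ 2 * (p * t' ^ 2) + 80 * M ^ 2 * (6 / c * ZZ + 4 / c * BB + δ) := by
  have hM0 : 0 < M := hc.trans_le hcM
  have hlow : ∑ j, ((4 * M)⁻¹ * H j - 4 / c * Z j) ≤ ∑ j, (Real.log (r j) - Real.log (a j)) := by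
    refine Finset.sum_le_sum fun j _ => ?_
    have := log_residual_lower hc hcM (ha j) (haM j) (hr j) (hH j) (hHM j) (hZ j) (hX j) (hdec j)
    rwa [div_eq_inv_mul, mul_div_right_comm] at this
  have hup : ∑ j, (Real.log (r₀ j) - Real.log (a j)) ≤ ∑ j, (2 / c * Z j + 4 / c * H₀ j) := by
    refine Finset.sum_le_sum fun j _ => ?_
    have := log_residual_upper hc (ha j) (hr₀ j) (hH₀ j) (hZ j) (hX₀ j) (hdec₀ j)
    refine this.trans (le_of_eq (by ring))
  rw [Finset.sum_sub_distrib, Finset.sum_sub_distrib, ← Finset.mul_sum, ← Finset.mul_sum] at hlow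
  rw [Finset.sum_sub_distrib, Finset.sum_add_distrib, ← Finset.mul_sum, ← Finset.mul_sum] at hup
  have hsumH : ∑ j, H j ≤ 4 * M * (6 / c * ZZ + 4 / c * BB + δ) := by
    have e3 : 6 / c * (∑ j, Z j) = 4 / c * (∑ j, Z j) + 2 / c * ∑ j, Z j := by ring
    have h1 : (4 * M)⁻¹ * ∑ j, H j ≤ 6 / c * (∑ j, Z j) + 4 / c * ∑ j, H₀ j + δ := by
      linarith
    rw [inv_mul_le_iff₀ (by positivity)] at h1
    refine h1.trans ?_
    gcongr
  refine ⟨fun j => ?_, ?_⟩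
  · have h1 : |2 * X j| ≤ a j + H j := by
      refine abs_le_of_sq_le_sq ?_ (add_nonneg (by linarith [ha j]) (hH j))
      nlinarith [sq_nonneg (a j - H j), hcs j]
    rw [hdec]
    linarith [(abs_le.1 h1).2, haM j, hHM j]
  · have hpt : ∀ j, (v j - r j) ^ 2 ≤ 2 * t' ^ 2 + 20 * M * H j := by
      intro j
      have h1 : (v j - a j) ^ 2 ≤ t' ^ 2 := by
        have := hv j
        rw [abs_sub_comm] at this
        exact sq_le_sq' (abs_le.1 this).1 (abs_le.1 this).2
      have h2 : (2 * X j + H j) ^ 2 ≤ 10 * M * H j := by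
        have h3 : a j * H j ≤ M * H j := mul_le_mul_of_nonneg_right (haM j) (hH j)
        have h4 : H j * H j ≤ M * H j := mul_le_mul_of_nonneg_right (hHM j) (hH j)
        nlinarith [hcs j, sq_nonneg (2 * X j - H j)]
      rw [hdec]
      nlinarith [sq_nonneg ((v j - a j) + (2 * X j + H j))]
    refine (Finset.sum_le_sum fun j _ => hpt j).trans ?_
    rw [Finset.sum_add_distrib, ← Finset.mul_sum (s := Finset.univ) (f := H)]
    simp only [Finset.sum_const, Finset.card_univ, Fintype.card_fin, nsmul_eq_mul]
    have := mul_le_mul_of_nonneg_left hsumH (show 0 ≤ 20 * M by positivity)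
    linarith

/-- The bound on the residual variances when the order is correct. -/
lemma Regular.sum_sq_residual_le (h : S.Regular K C η σbar c) (hR : 1 ≤ R) (hn : 0 < n)
    (hs : (S.sem.edges.card : ℝ) ≤ s) {t t' L : ℝ} (ht : 0 ≤ t) (hL : 0 ≤ L)
    (hx : S.MomentsClose R t x)
    (hsmall : t * (1 + C * K) ^ 2 ≤ c / 2) (ht' : t' ≤ c / 2)
    (hnoise : ∀ j, |S.noiseVar x j - S.sem.σ j ^ 2| ≤ t') (horth : S.NearlyOrthogonal R L x)
    (hopt : S.IsNearOptimal C η R s lam τ x θ) (hτ : 0 ≤ τ)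
    {π : Equiv.Perm (Fin p)} (hπ : Consistent π θ.edges) (hπ' : Consistent π S.sem.edges) {M : ℝ}
    (hM : M = σbar ^ 2 + c + (4 * C * K) ^ 2) :
    (∀ j, S.empiricalResidual x θ j ≤ 4 * M) ∧
    ∑ j, (S.sem.σ j ^ 2 - S.empiricalResidual x θ j) ^ 2
      ≤ 2 * (p * t' ^ 2) + 80 * M ^ 2 * (6 / c * (4 * σbar ^ 2 * (2 * (s * R) + p + p * L) / n)
        + 4 / c * (4 * C ^ 2 * K * (s * (R : ℝ) ^ (-2 * η))) + (lam ^ 2 * s + τ)) := by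
  classical
  have hc := h.c_pos
  have hn' : (0 : ℝ) < n := by exact_mod_cast hn
  have hC := h.C_pos
  obtain ⟨θ₀, hθ₀, hzero, hbias⟩ := h.exists_comparator hR hs
  have hθ := hopt.1
  have hlog := hopt.sum_log_le hτ hθ₀ fun j =>
    lt_of_lt_of_le (by positivity) (h.half_le_residual ht hx hsmall hθ₀ j)
  set a := fun j => S.noiseVar x j with ha
  set H := fun j => (n : ℝ)⁻¹ * ∑ i, (S.sem.signal j (x i) - S.fit R θ.β j (x i)) ^ 2 with hH
  set X := fun j => (n : ℝ)⁻¹ * ∑ i, S.sem.noise j (x i) *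
    (S.sem.signal j (x i) - S.fit R θ.β j (x i)) with hX
  set H₀ := fun j => (n : ℝ)⁻¹ * ∑ i, (S.sem.signal j (x i) - S.fit R θ₀.β j (x i)) ^ 2 with hH₀
  set X₀ := fun j => (n : ℝ)⁻¹ * ∑ i, S.sem.noise j (x i) *
    (S.sem.signal j (x i) - S.fit R θ₀.β j (x i)) with hX₀
  set g := fun j => θ.parents j ∪ S.sem.parents j with hg
  set Z := fun j => 4 * σbar ^ 2 * ((g j).card * R + 1 + L) / n with hZ
  have hZ0 : ∀ j, 0 ≤ Z j := fun j => by simp only [hZ]; positivity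
  have hH0 : ∀ j, 0 ≤ H j := fun j =>
    mul_nonneg (by positivity) (Finset.sum_nonneg fun _ _ => sq_nonneg _)
  have hH₀0 : ∀ j, 0 ≤ H₀ j := fun j =>
    mul_nonneg (by positivity) (Finset.sum_nonneg fun _ _ => sq_nonneg _)
  have hgsub : ∀ j, g j ⊆ S.candidates j := fun j => Finset.union_subset
    (fun k hk => S.mem_candidates.2 (hθ.subset_super (Param.mem_parents.1 hk)))
    (h.parents_subset j)
  have hB : ∀ j, ∃ B : Set (Fin p), (∀ k ∈ B, ∀ l ∈ S.sem.parents k, l ∈ B) ∧ j ∉ B ∧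
      (∀ k ∈ S.sem.parents j, k ∈ B) ∧ ∀ k ∈ g j, k ∈ B := by
    intro j
    have hlt : ∀ k l, l ∈ S.sem.parents k → π⁻¹ l < π⁻¹ k := fun k l hl =>
      hπ' _ _ (by simpa using S.sem.mem_parents.1 hl)
    refine ⟨{k | π⁻¹ k < π⁻¹ j}, fun k hk l hl => (hlt k l hl).trans hk, by simp,
      fun k hk => hlt j k hk, fun k hk => ?_⟩
    rcases Finset.mem_union.1 hk with hk | hk
    · exact hπ _ _ (by simpa using Param.mem_parents.1 hk)
    · exact hlt j k hk
  have hcross : ∀ j, X j ^ 2 ≤ Z j * H j := fun j =>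
    horth.cross_sq_le hn (hgsub j) (hB j) (fun k hk r => by
      rw [Param.eq_zero_of_notMem_edges fun hm =>
        hk (Finset.mem_union_left _ (Param.mem_parents.2 hm))]) (h.sigma_sq_le j) hL
  have hcross₀ : ∀ j, X₀ j ^ 2 ≤ Z j * H₀ j := fun j =>
    horth.cross_sq_le hn (hgsub j) (hB j) (fun k hk r => hzero k j (fun hm =>
      hk (Finset.mem_union_right _ (S.sem.mem_parents.2 hm))) r) (h.sigma_sq_le j) hL
  have hdec : ∀ j, S.empiricalResidual x θ j = a j + 2 * X j + H j :=
    fun j => h.residual_decomposition hθ j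
  have hdec₀ : ∀ j, S.empiricalResidual x θ₀ j = a j + 2 * X₀ j + H₀ j :=
    fun j => h.residual_decomposition hθ₀ j
  have hcσ : ∀ j, c ≤ S.sem.σ j ^ 2 := h.le_sigma_sq
  have ha1 : ∀ j, c / 2 ≤ a j := fun j => by
    have := (abs_le.1 (hnoise j)).1
    have := hcσ j
    simp only [ha]; linarith
  have hM4 : 0 ≤ (4 * C * K) ^ 2 := sq_nonneg _
  have haM : ∀ j, a j ≤ M := fun j => by
    have := (abs_le.1 (hnoise j)).2
    have := h.sigma_sq_le j
    simp only [ha]; linarith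
  have hcM : c ≤ M := by nlinarith [sq_nonneg σbar]
  have hM0 : 0 < M := hc.trans_le hcM
  have hmean : ∀ (u : Fin n → ℝ) (A : ℝ), (∀ i, u i ≤ A) → (n : ℝ)⁻¹ * ∑ i, u i ≤ A := by
    intro u A hu
    have h1 := Finset.sum_le_sum fun i (_ : i ∈ Finset.univ) => hu i
    simp only [Finset.sum_const, Finset.card_univ, Fintype.card_fin, nsmul_eq_mul] at h1
    rw [inv_mul_le_iff₀ hn']
    linarith
  have hHM : ∀ j, H j ≤ M := fun j => by
    refine (hmean _ ((4 * C * K) ^ 2) fun i => ?_).trans (by nlinarith [sq_nonneg σbar])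
    refine sq_le_sq.2 ?_
    have h1 := abs_sub (S.sem.signal j (x i)) (S.fit R θ.β j (x i))
    have h2 := h.abs_signal_le j (x i)
    have h3 := h.abs_fit_le (R := R) hθ.sobolev j (x i)
    rw [abs_of_nonneg (by positivity : 0 ≤ 4 * C * K)]
    linarith
  have hH₀b : ∀ j, H₀ j ≤ (2 * C * (S.sem.parents j).card * (R : ℝ) ^ (-η)) ^ 2 := fun j =>
    hmean _ _ fun i => sq_le_sq' (abs_le.1 (hbias j (x i))).1 (abs_le.1 (hbias j (x i))).2
  have hcs : ∀ j, X j ^ 2 ≤ a j * H j := by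
    intro j
    have := Finset.sum_mul_sq_le_sq_mul_sq Finset.univ (fun i => S.sem.noise j (x i))
      (fun i => S.sem.signal j (x i) - S.fit R θ.β j (x i))
    simp only [hX, ha, hH, noiseVar]
    rw [mul_pow]
    calc _ ≤ ((n : ℝ)⁻¹) ^ 2 * _ := mul_le_mul_of_nonneg_left this (sq_nonneg _)
      _ = _ := by ring
  have hsumZ : ∑ j, Z j ≤ 4 * σbar ^ 2 * (2 * (s * R) + p + p * L) / n := by
    have hcard : ∑ j, ((g j).card : ℝ) ≤ 2 * s := by
      have h1 : ∑ j, ((g j).card : ℝ) ≤ ∑ j, (((θ.parents j).card : ℝ) + (S.sem.parents j).card) :=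
        Finset.sum_le_sum fun j _ => by exact_mod_cast Finset.card_union_le _ _
      rw [Finset.sum_add_distrib] at h1
      have h2 : ∑ j, ((θ.parents j).card : ℝ) = θ.edges.card := by
        rw [← sum_card_parents θ.edges]; push_cast; rfl
      have h3 : ∑ j, ((S.sem.parents j).card : ℝ) = S.sem.edges.card := by
        rw [← sum_card_parents S.sem.edges]; push_cast; rfl
      have := hθ.card_le
      linarith
    have e1 : ∑ j, Z j = 4 * σbar ^ 2 * ((∑ j, ((g j).card : ℝ)) * R + p + p * L) / n := by
      simp only [hZ]
      rw [← Finset.sum_div, ← Finset.mul_sum, Finset.sum_add_distrib, Finset.sum_add_distrib,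
        ← Finset.sum_mul]
      simp
    rw [e1]
    have : (∑ j, ((g j).card : ℝ)) * R ≤ 2 * (s * R) := by
      have := mul_le_mul_of_nonneg_right hcard (Nat.cast_nonneg R : (0 : ℝ) ≤ R)
      linarith
    gcongr
  have hsumH₀ : ∑ j, H₀ j ≤ 4 * C ^ 2 * K * (s * (R : ℝ) ^ (-2 * η)) :=
    (Finset.sum_le_sum fun j _ => hH₀b j).trans (h.sum_bias_sq_le hs)
  set ZZ := 4 * σbar ^ 2 * (2 * (s * R) + p + p * L) / n with hZZ
  set BB := 4 * C ^ 2 * K * (s * (R : ℝ) ^ (-2 * η)) with hBB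
  exact sum_sq_residual_le_of_log hc hcM ha1 haM (h.half_le_residual ht hx hsmall hθ)
    (fun j => lt_of_lt_of_le (by positivity) (h.half_le_residual ht hx hsmall hθ₀ j))
    hH0 hH₀0 hHM hZ0 hcross hcross₀ hcs hdec hdec₀ (fun j => hnoise j) (by linarith) hsumZ hsumH₀

end Setup

lemma sum_range_pow_succ_le {q : ℝ} (hq : 0 ≤ q) (hq2 : 2 * q ≤ 1) (R : ℕ) :
    ∑ r ∈ Finset.range R, q ^ (r + 1) ≤ 2 * q := by
  have key : ∑ r ∈ Finset.range R, q ^ (r + 1) + 2 * q ^ (R + 1) ≤ 2 * q := by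
    induction R with
    | zero => simp
    | succ R ih =>
      rw [Finset.sum_range_succ]
      have h1 : 2 * q ^ (R + 1 + 1) ≤ q ^ (R + 1) := by
        rw [pow_succ q (R + 1)]
        nlinarith [pow_nonneg hq (R + 1)]
      linarith
  have : 0 ≤ 2 * q ^ (R + 1) := by positivity
  linarith

lemma half_le_log {p : ℕ} (hp : 2 ≤ p) : 1 / 2 ≤ Real.log p := by
  have h1 : Real.log 2 ≤ Real.log p := Real.log_le_log two_pos (by exact_mod_cast hp)
  linarith [Real.log_two_gt_d9]

lemma measureReal_exists_le {Ω ι : Type*} [MeasurableSpace Ω] (μ : Measure Ω) [IsFiniteMeasure μ]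
    (I : Finset ι) (A : ι → Set Ω) :
    μ.real {ω | ∃ i ∈ I, ω ∈ A i} ≤ ∑ i ∈ I, μ.real (A i) := by
  have : {ω | ∃ i ∈ I, ω ∈ A i} = ⋃ i ∈ I, A i := by ext; simp
  rw [this]
  exact measureReal_biUnion_finset_le I A

namespace Setup

variable {p : ℕ} {S : Setup p} {K R : ℕ} {C η σbar c : ℝ} {n : ℕ}

instance (S : Setup p) (n : ℕ) : IsProbabilityMeasure (S.sem.sampleLaw n) := by
  unfold AdditiveSEM.sampleLaw; infer_instance

/-! ### Probabilities of the exceptional events -/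

/-- The rate in the exponential moment bound for products of features. -/
def momentRate (σbar : ℝ) : ℝ := 1 / (8 * σbar ^ 2)

/-- The exponential moment bound for products of features. -/
def momentBound (C σbar : ℝ) (K : ℕ) : ℝ :=
  Real.exp (momentRate σbar * (2 * (2 + 2 * C * K) ^ 2)) * √2

/-- The constant in the deviation bounds with exponent `B`. -/
def deviationConst (C σbar : ℝ) (K : ℕ) (B : ℝ) : ℝ :=
  4 / momentRate σbar * (momentBound C σbar K * Real.exp (momentBound C σbar K))
    + 2 / momentRate σbar * B

/-- The exponent for which the union bounds are summable. -/
def unionExponent (K : ℕ) : ℝ := 2 + 4 * (1 + 2 * (K : ℝ)) ^ 2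

lemma deviationConst_nonneg {B : ℝ} (hB : 0 ≤ B) : 0 ≤ deviationConst C σbar K B := by
  unfold deviationConst momentBound momentRate; positivity

lemma Regular.sigmabar_sq_pos (h : S.Regular K C η σbar c) (j : Fin p) : 0 < σbar ^ 2 :=
  h.c_pos.trans_le ((h.le_sigma_sq j).trans (h.sigma_sq_le j))

lemma Regular.exp_moment (h : S.Regular K C η σbar c) (j : Fin p) {Y : (Fin p → ℝ) → ℝ}
    (hY : Measurable Y)
    (hle : ∀ x, |Y x| ≤ 2 * (2 + 2 * C * K) ^ 2 + 2 * S.sem.noise j x ^ 2) :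
    Integrable (fun x => Real.exp (momentRate σbar * |Y x|)) S.sem.P ∧
      ∫ x, Real.exp (momentRate σbar * |Y x|) ∂S.sem.P ≤ momentBound C σbar K := by
  have hσ := h.sigmabar_sq_pos j
  have ha : 0 < momentRate σbar := by unfold momentRate; positivity
  obtain ⟨hi, hv⟩ := S.sem.exp_noise_sq j
  have hpt : ∀ x, Real.exp (momentRate σbar * |Y x|)
      ≤ Real.exp (momentRate σbar * (2 * (2 + 2 * C * K) ^ 2))
        * Real.exp ((S.sem.noise j x / S.sem.σ j) ^ 2 / 4) := by
    intro x
    rw [← Real.exp_add]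
    refine Real.exp_le_exp.2 ?_
    have h1 := mul_le_mul_of_nonneg_left (hle x) ha.le
    have h2 : momentRate σbar * (2 * S.sem.noise j x ^ 2)
        ≤ (S.sem.noise j x / S.sem.σ j) ^ 2 / 4 := by
      have e1 : momentRate σbar * (2 * S.sem.noise j x ^ 2)
          = S.sem.noise j x ^ 2 / σbar ^ 2 / 4 := by
        unfold momentRate; field_simp; ring
      rw [e1, div_pow]
      have := h.sigma_sq_le j
      have hp : 0 < S.sem.σ j ^ 2 := pow_pos (S.sem.σ_pos j) 2
      gcongr
    linarith
  have hint : Integrable (fun x => Real.exp (momentRate σbar * |Y x|)) S.sem.P := by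
    refine (hi.const_mul (Real.exp (momentRate σbar * (2 * (2 + 2 * C * K) ^ 2)))).mono'
      (by fun_prop) (ae_of_all _ fun x => ?_)
    rw [Real.norm_eq_abs, Real.abs_exp]
    exact hpt x
  refine ⟨hint, (integral_mono hint (hi.const_mul _) hpt).trans ?_⟩
  rw [integral_const_mul, hv]
  exact le_rfl

/-- Deviation bound for the empirical mean of a function dominated by the squared error. -/
lemma Regular.deviation (h : S.Regular K C η σbar c) (j : Fin p) {Y : (Fin p → ℝ) → ℝ}
    (hY : Measurable Y)
    (hle : ∀ x, |Y x| ≤ 2 * (2 + 2 * C * K) ^ 2 + 2 * S.sem.noise j x ^ 2) {L B w : ℝ}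
    (hL : 0 < L) (hLn : L ≤ n) (hw : 1 ≤ w) :
    (S.sem.sampleLaw n).real {x | deviationConst C σbar K B * √(L / n) * w
        < |(n : ℝ)⁻¹ * ∑ i, Y (x i) - ∫ y, Y y ∂S.sem.P|} ≤ 2 * Real.exp (-(B * w * L)) := by
  have hσ := h.sigmabar_sq_pos j
  have ha : 0 < momentRate σbar := by unfold momentRate; positivity
  obtain ⟨hi, hv⟩ := h.exp_moment j hY hle
  refine le_trans (measureReal_mono ?_)
    (empirical_mean_deviation S.sem.P ha Y hY hi hv (n := n) (B := B * w) hL hLn)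
  intro x hx
  simp only [Set.mem_ofPred_eq] at hx ⊢
  refine lt_of_le_of_lt ?_ hx
  have hM : 0 ≤ 4 / momentRate σbar *
      (momentBound C σbar K * Real.exp (momentBound C σbar K)) := by
    unfold momentBound; positivity
  have hs := Real.sqrt_nonneg (L / n)
  have h1 := mul_le_mul_of_nonneg_left hw hM
  calc _ ≤ (4 / momentRate σbar * (momentBound C σbar K * Real.exp (momentBound C σbar K)) * w
        + 2 / momentRate σbar * (B * w)) * √(L / n) :=
        mul_le_mul_of_nonneg_right (by linarith) hs
    _ = _ := by unfold deviationConst; ring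

lemma two_mul_exp_union_le {p : ℕ} (hp : 2 ≤ p) (K : ℕ) :
    p * (2 * (1 + 2 * (K : ℝ)) ^ 2 * Real.exp (-(unionExponent K * Real.log p))) ≤ 1 / p := by
  have hp0 : (0 : ℝ) < p := by positivity
  have hL := half_le_log hp
  have e1 : Real.exp (-(unionExponent K * Real.log p))
      = Real.exp (-(4 * (1 + 2 * (K : ℝ)) ^ 2 * Real.log p)) * (1 / p) * (1 / p) := by
    have : (1 : ℝ) / p = Real.exp (-Real.log p) := by rw [Real.exp_neg, Real.exp_log hp0, one_div]
    rw [this, ← Real.exp_add, ← Real.exp_add]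
    congr 1
    unfold unionExponent; ring
  have h2 : 2 * (1 + 2 * (K : ℝ)) ^ 2 * Real.exp (-(4 * (1 + 2 * (K : ℝ)) ^ 2 * Real.log p)) ≤ 1 := by
    rw [Real.exp_neg, ← div_eq_mul_inv, div_le_one (Real.exp_pos _)]
    have := Real.add_one_le_exp (4 * (1 + 2 * (K : ℝ)) ^ 2 * Real.log p)
    nlinarith [mul_le_mul_of_nonneg_left hL (show 0 ≤ 4 * (1 + 2 * (K : ℝ)) ^ 2 by positivity)]
  rw [e1]
  calc _ = (2 * (1 + 2 * (K : ℝ)) ^ 2 * Real.exp (-(4 * (1 + 2 * (K : ℝ)) ^ 2 * Real.log p)))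
        * (1 / p) := by field_simp
    _ ≤ 1 * (1 / p) := by gcongr
    _ = _ := one_mul _

lemma sum_exp_featureWeight_le (h : S.Regular K C η σbar c) {q : ℝ} (hq : 2 * Real.exp (-q) ≤ 1)
    (R : ℕ) (j : Fin p) :
    ∑ u ∈ S.features R j, Real.exp (-(q * featureWeight u)) ≤ (1 + 2 * K) * Real.exp (-q) := by
  rw [features, Finset.sum_insertNone, Finset.sum_product]
  simp only [featureWeight, mul_one]
  have h1 : ∀ r : ℕ, Real.exp (-(q * ((r : ℝ) + 1))) = Real.exp (-q) ^ (r + 1) := by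
    intro r
    rw [← Real.exp_nat_mul]; congr 1; push_cast; ring
  simp_rw [h1]
  have h2 : ∑ k ∈ S.candidates j, ∑ r ∈ Finset.range R, Real.exp (-q) ^ (r + 1)
      ≤ ∑ k ∈ S.candidates j, 2 * Real.exp (-q) :=
    Finset.sum_le_sum fun k _ => sum_range_pow_succ_le (Real.exp_pos _).le hq R
  rw [Finset.sum_const (2 * Real.exp (-q)), nsmul_eq_mul] at h2
  have h3 := mul_le_mul_of_nonneg_right (h.card_candidates_le j)
    (show 0 ≤ 2 * Real.exp (-q) by positivity)
  linarith

/-- The second moments of all features are close to the population ones. -/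
lemma Regular.measure_not_momentsClose_le (h : S.Regular K C η σbar c) (hp : 2 ≤ p)
    (hLn : Real.log p ≤ n) :
    (S.sem.sampleLaw n).real {x | ¬ S.MomentsClose R
      (deviationConst C σbar K (unionExponent K) * √(Real.log p / n)) x} ≤ 1 / p := by
  set L := Real.log p with hLdef
  have hL : 1 / 2 ≤ L := half_le_log hp
  set B := unionExponent K with hB
  have hB2 : 2 ≤ B := by rw [hB, unionExponent]; nlinarith [sq_nonneg (1 + 2 * (K : ℝ))]
  set t := deviationConst C σbar K B * √(L / n) with ht
  set μ := S.sem.sampleLaw n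
  let Bad : Fin p → Option (Fin p × ℕ) → Option (Fin p × ℕ) → Set (Fin n → Fin p → ℝ) :=
    fun j u v => {x | t * (featureWeight u * featureWeight v)
      < |(n : ℝ)⁻¹ * ∑ i, S.feature j u (x i) * S.feature j v (x i)
        - ∫ y, S.feature j u y * S.feature j v y ∂S.sem.P|}
  have hset : {x | ¬ S.MomentsClose R t x} ⊆ {x | ∃ j ∈ (Finset.univ : Finset (Fin p)),
      x ∈ {x | ∃ u ∈ S.features R j, x ∈ {x | ∃ v ∈ S.features R j, x ∈ Bad j u v}}} := by
    intro x hx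
    simp only [MomentsClose, Set.mem_ofPred_eq] at hx
    push Not at hx
    obtain ⟨j, u, hu, v, hv, hlt⟩ := hx
    exact ⟨j, Finset.mem_univ j, u, hu, v, hv, hlt⟩
  have hbad : ∀ j, ∀ u ∈ S.features R j, ∀ v ∈ S.features R j,
      μ.real (Bad j u v) ≤ 2 * (Real.exp (-(B * L / 2 * featureWeight u))
        * Real.exp (-(B * L / 2 * featureWeight v))) := by
    intro j u hu v hv
    have hu1 := one_le_featureWeight u
    have hv1 := one_le_featureWeight v
    have hd := h.deviation (n := n) j
      (Y := fun y => S.feature j u y * S.feature j v y)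
      ((h.measurable_feature hu).mul (h.measurable_feature hv)) (fun y => by
        rw [abs_mul]
        have h1 := h.abs_feature_le hu y
        have h2 := h.abs_feature_le hv y
        have h3 := mul_le_mul h1 h2 (abs_nonneg _) ((abs_nonneg _).trans h1)
        have h4 := sq_abs (S.sem.noise j y)
        nlinarith [sq_nonneg (2 + 2 * C * K - |S.sem.noise j y|)])
      (B := B) (w := featureWeight u * featureWeight v) (L := L) (by linarith) hLn (by nlinarith)
    refine hd.trans ?_
    rw [← Real.exp_add]
    gcongr
    have h5 : (featureWeight u + featureWeight v) / 2 ≤ featureWeight u * featureWeight v := by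
      nlinarith
    have h6 := mul_le_mul_of_nonneg_left h5 (show 0 ≤ B * L by positivity)
    linarith
  have hq : 2 * Real.exp (-(B * L / 2)) ≤ 1 := by
    have h1 : Real.exp (-(B * L / 2)) ≤ Real.exp (-Real.log 2) := by
      refine Real.exp_le_exp.2 ?_
      have h2 : Real.log 2 ≤ L := Real.log_le_log two_pos (by exact_mod_cast hp)
      nlinarith
    rw [Real.exp_neg (Real.log 2), Real.exp_log two_pos] at h1
    linarith
  calc μ.real {x | ¬ S.MomentsClose R t x}
      ≤ ∑ j, ∑ u ∈ S.features R j, ∑ v ∈ S.features R j, μ.real (Bad j u v) := by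
        refine (measureReal_mono hset).trans ((measureReal_exists_le _ _ _).trans ?_)
        refine Finset.sum_le_sum fun j _ => (measureReal_exists_le _ _ _).trans ?_
        exact Finset.sum_le_sum fun u _ => measureReal_exists_le _ _ _
    _ ≤ ∑ j : Fin p, ∑ u ∈ S.features R j, ∑ v ∈ S.features R j,
          2 * (Real.exp (-(B * L / 2 * featureWeight u))
            * Real.exp (-(B * L / 2 * featureWeight v))) :=
        Finset.sum_le_sum fun j _ => Finset.sum_le_sum fun u hu => Finset.sum_le_sum fun v hv =>
          hbad j u hu v hv
    _ = ∑ j : Fin p, 2 * (∑ u ∈ S.features R j, Real.exp (-(B * L / 2 * featureWeight u))) ^ 2 := by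
        refine Finset.sum_congr rfl fun j _ => ?_
        rw [sq, Finset.sum_mul_sum, Finset.mul_sum]
        simp_rw [Finset.mul_sum]
    _ ≤ ∑ _j : Fin p, 2 * (1 + 2 * (K : ℝ)) ^ 2 * Real.exp (-(B * L)) := by
        refine Finset.sum_le_sum fun j _ => ?_
        have h1 := sum_exp_featureWeight_le h hq R j
        have h2 : (∑ u ∈ S.features R j, Real.exp (-(B * L / 2 * featureWeight u))) ^ 2
            ≤ ((1 + 2 * K) * Real.exp (-(B * L / 2))) ^ 2 :=
          pow_le_pow_left₀ (Finset.sum_nonneg fun _ _ => (Real.exp_pos _).le) h1 2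
        rw [mul_pow, ← Real.exp_nat_mul] at h2
        have e1 : ((2 : ℕ) : ℝ) * -(B * L / 2) = -(B * L) := by push_cast; ring
        rw [e1] at h2
        linarith
    _ = p * (2 * (1 + 2 * (K : ℝ)) ^ 2 * Real.exp (-(B * L))) := by simp
    _ ≤ 1 / p := two_mul_exp_union_le hp K

/-- The empirical variances of the errors are close to the population ones. -/
lemma Regular.measure_not_noiseClose_le (h : S.Regular K C η σbar c) (hp : 2 ≤ p)
    (hLn : Real.log p ≤ n) :
    (S.sem.sampleLaw n).real {x | ¬ ∀ j, |S.noiseVar x j - S.sem.σ j ^ 2|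
      ≤ deviationConst C σbar K (unionExponent K) * √(Real.log p / n)} ≤ 1 / p := by
  have hL := half_le_log hp
  set t := deviationConst C σbar K (unionExponent K) * √(Real.log p / n) with ht
  have hset : {x : Fin n → Fin p → ℝ | ¬ ∀ j, |S.noiseVar x j - S.sem.σ j ^ 2| ≤ t}
      ⊆ {x | ∃ j ∈ (Finset.univ : Finset (Fin p)), x ∈ {x : Fin n → Fin p → ℝ | t * 1 <
        |(n : ℝ)⁻¹ * ∑ i, S.sem.noise j (x i) ^ 2 - ∫ y, S.sem.noise j y ^ 2 ∂S.sem.P|}} := by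
    intro x hx
    simp only [Set.mem_ofPred_eq] at hx
    push Not at hx
    obtain ⟨j, hj⟩ := hx
    refine ⟨j, Finset.mem_univ j, ?_⟩
    simp only [Set.mem_ofPred_eq]
    rw [(S.sem.integral_noise_sq j).2, mul_one]
    exact hj
  refine (measureReal_mono hset).trans ((measureReal_exists_le _ _ _).trans ?_)
  refine (Finset.sum_le_sum fun j _ => h.deviation (n := n) j
    (Y := fun y => S.sem.noise j y ^ 2) ((S.sem.measurable_noise j).pow_const 2) (fun y => by
      rw [abs_of_nonneg (sq_nonneg _)]
      nlinarith [sq_nonneg (2 + 2 * C * K), sq_nonneg (S.sem.noise j y)])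
    (B := unionExponent K) (L := Real.log p) (by linarith) hLn le_rfl).trans ?_
  simp only [Finset.sum_const, Finset.card_univ, Fintype.card_fin, nsmul_eq_mul, mul_one]
  refine le_trans ?_ (two_mul_exp_union_le hp K)
  gcongr
  have : 1 ≤ (1 + 2 * (K : ℝ)) ^ 2 := by nlinarith [(Nat.cast_nonneg K : (0 : ℝ) ≤ K)]
  linarith

/-- The errors are nearly orthogonal to the basis functions of the variables that they are
independent of. -/
lemma Regular.measure_not_nearlyOrthogonal_le (h : S.Regular K C η σbar c) (hp : 2 ≤ p) :
    (S.sem.sampleLaw n).real {x | ¬ S.NearlyOrthogonal R ((K + 2) * Real.log p) x} ≤ 1 / p := by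
  classical
  set L := (K + 2) * Real.log p with hL
  have hp0 : (0 : ℝ) < p := by positivity
  set Adm : Fin p → Finset (Fin p) → Prop := fun j g =>
    ∃ B : Set (Fin p), (∀ k ∈ B, ∀ l ∈ S.sem.parents k, l ∈ B) ∧ j ∉ B ∧
      (∀ k ∈ S.sem.parents j, k ∈ B) ∧ ∀ k ∈ g, k ∈ B with hAdm
  let Bad : Fin p → Finset (Fin p) → Set (Fin n → Fin p → ℝ) := fun j g =>
    {x | Adm j g ∧ ∃ (a₀ : ℝ) (a : Fin p → ℕ → ℝ),
      S.sem.σ j ^ 2 * (4 * (((g.card * R + 1 : ℕ) : ℝ) * (Real.log 2 / 2) + L))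
          * ∑ i, S.combination R j g a₀ a (x i) ^ 2
        < (∑ i, S.sem.noise j (x i) * S.combination R j g a₀ a (x i)) ^ 2}
  have hset : {x : Fin n → Fin p → ℝ | ¬ S.NearlyOrthogonal R L x}
      ⊆ {x | ∃ j ∈ (Finset.univ : Finset (Fin p)),
        x ∈ {x | ∃ g ∈ (S.candidates j).powerset, x ∈ Bad j g}} := by
    intro x hx
    simp only [NearlyOrthogonal, Set.mem_ofPred_eq] at hx
    push Not at hx
    obtain ⟨j, g, hg, hB, a₀, a, hlt⟩ := hx
    exact ⟨j, Finset.mem_univ j, g, Finset.mem_powerset.2 hg, hB, a₀, a, hlt⟩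
  have hbad : ∀ j, ∀ g ∈ (S.candidates j).powerset,
      (S.sem.sampleLaw n).real (Bad j g) ≤ Real.exp (-L) := by
    intro j g hg
    have hg := Finset.mem_powerset.1 hg
    by_cases hadm : Adm j g
    · obtain ⟨B, hB, hjB, hpaB, hgB⟩ := hadm
      have hσ := S.sem.σ_pos j
      let u : (Fin p → ℝ) → Option {a // a ∈ g ×ˢ Finset.range R} → ℝ := fun y o =>
        o.elim (S.sem.signal j y) fun a => S.centeredBasis a.1.1 j a.1.2 y
      have hmem : ∀ a : {a // a ∈ g ×ˢ Finset.range R}, a.1.1 ∈ g := fun a =>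
        (Finset.mem_product.1 a.2).1
      have huB : Measurable[AdditiveSEM.coordSigma B] u := by
        refine @measurable_pi_lambda _ _ _ (AdditiveSEM.coordSigma B) _ _ fun o => ?_
        cases o with
        | none => exact S.sem.measurable_signal_coordSigma hpaB
        | some a =>
          refine Measurable.sub_const ?_ _
          exact (h.goodBasis.measurable (h.ne_of_mem_candidates (hg (hmem a))) a.1.2).comp
            (AdditiveSEM.measurable_coord (hgB _ (hmem a)))
      have hu : Measurable u := huB.mono (AdditiveSEM.coordSigma_le B) le_rfl
      have hind : IndepFun (fun y => S.sem.noise j y / S.sem.σ j) u S.sem.P :=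
        (S.sem.indepFun_noise hB hjB huB).comp (φ := fun y => y / S.sem.σ j) (ψ := id)
          (by fun_prop) measurable_id
      have htail := sample_projection_tail (n := n) (d := g.card * R + 1) S.sem.P
        (fun y => S.sem.noise j y / S.sem.σ j) ((S.sem.measurable_noise j).div_const _)
        (S.sem.standardized_noise_law j) u hu hind (by simp) L
      refine le_trans (measureReal_mono ?_) htail
      rintro x ⟨_, a₀, a, hlt⟩
      refine ⟨fun o => o.elim a₀ fun b => a b.1.1 b.1.2, ?_⟩
      have hcomb : ∀ y, ∑ l, (Option.elim l a₀ fun b => a b.1.1 b.1.2) * u y l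
          = S.combination R j g a₀ a y := by
        intro y
        rw [Fintype.sum_option, combination, ← Finset.sum_product',
          ← Finset.sum_coe_sort (g ×ˢ Finset.range R)]
        rfl
      simp_rw [hcomb]
      have e1 : ∑ i, S.sem.noise j (x i) / S.sem.σ j * S.combination R j g a₀ a (x i)
          = (S.sem.σ j)⁻¹ * ∑ i, S.sem.noise j (x i) * S.combination R j g a₀ a (x i) := by
        rw [Finset.mul_sum]
        exact Finset.sum_congr rfl fun i _ => by ring
      rw [e1, mul_pow, inv_pow, lt_inv_mul_iff₀ (by positivity)]
      linarith
    · have : Bad j g = ∅ := by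
        ext x; simp [Bad, hadm]
      rw [this, measureReal_empty]
      exact (Real.exp_pos _).le
  refine (measureReal_mono hset).trans ((measureReal_exists_le _ _ _).trans ?_)
  have hstep : ∀ j, (S.sem.sampleLaw n).real {x | ∃ g ∈ (S.candidates j).powerset, x ∈ Bad j g}
      ≤ 2 ^ K * Real.exp (-L) := by
    intro j
    refine (measureReal_exists_le _ _ _).trans ((Finset.sum_le_sum (hbad j)).trans ?_)
    rw [Finset.sum_const, nsmul_eq_mul, Finset.card_powerset]
    push_cast
    gcongr
    · norm_num
    · exact h.superSparse j
  refine (Finset.sum_le_sum fun j _ => hstep j).trans ?_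
  simp only [Finset.sum_const, Finset.card_univ, Fintype.card_fin, nsmul_eq_mul]
  have e2 : Real.exp (-L) = ((p : ℝ) ^ (K + 2))⁻¹ := by
    rw [Real.exp_neg, hL, ← Real.exp_log (pow_pos hp0 (K + 2)), Real.log_pow]
    push_cast
    rfl
  rw [e2]
  have h2 : (2 : ℝ) ^ K ≤ (p : ℝ) ^ K := pow_le_pow_left₀ two_pos.le (by exact_mod_cast hp) K
  rw [pow_add, mul_inv]
  calc (p : ℝ) * (2 ^ K * (((p : ℝ) ^ K)⁻¹ * ((p : ℝ) ^ 2)⁻¹))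
      ≤ p * ((p : ℝ) ^ K * (((p : ℝ) ^ K)⁻¹ * ((p : ℝ) ^ 2)⁻¹)) := by gcongr
    _ = 1 / p := by field_simp

lemma exp_half_log_two : √2 = Real.exp (Real.log 2 / 2) := by
  rw [Real.sqrt_eq_rpow, Real.rpow_def_of_pos two_pos]; ring_nf

lemma noise_sq_le (h : S.Regular K C η σbar c) (j : Fin p) (y : Fin p → ℝ) :
    S.sem.noise j y ^ 2 ≤ 4 * σbar ^ 2 * ((S.sem.noise j y / S.sem.σ j) ^ 2 / 4) := by
  have hσ : 0 < S.sem.σ j ^ 2 := pow_pos (S.sem.σ_pos j) 2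
  have e : S.sem.noise j y ^ 2 = S.sem.σ j ^ 2 * (S.sem.noise j y / S.sem.σ j) ^ 2 := by
    rw [div_pow, mul_div_cancel₀ _ hσ.ne']
  have := mul_le_mul_of_nonneg_right (h.sigma_sq_le j) (sq_nonneg (S.sem.noise j y / S.sem.σ j))
  linarith

/-- Without any restriction on `log p / n`, the empirical variances of the errors are at most of
the order `1 + log p / n`. -/
lemma Regular.measure_not_noiseVar_le (h : S.Regular K C η σbar c) (hp : 2 ≤ p) (hn : 0 < n) :
    (S.sem.sampleLaw n).real {x | ¬ ∀ j, S.noiseVar x j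
      ≤ 4 * σbar ^ 2 * (1 + 2 * (Real.log p / n))} ≤ 1 / p := by
  have hp0 : (0 : ℝ) < p := by positivity
  have hn0 : (0 : ℝ) < n := by exact_mod_cast hn
  have hset : {x : Fin n → Fin p → ℝ | ¬ ∀ j, S.noiseVar x j
      ≤ 4 * σbar ^ 2 * (1 + 2 * (Real.log p / n))}
      ⊆ {x | ∃ j ∈ (Finset.univ : Finset (Fin p)), x ∈ {x : Fin n → Fin p → ℝ |
        n * (Real.log 2 / 2) + 2 * Real.log p
          ≤ ∑ i, (S.sem.noise j (x i) / S.sem.σ j) ^ 2 / 4}} := by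
    intro x hx
    simp only [Set.mem_ofPred_eq] at hx
    push Not at hx
    obtain ⟨j, hj⟩ := hx
    refine ⟨j, Finset.mem_univ j, ?_⟩
    simp only [Set.mem_ofPred_eq]
    have hσ := h.sigmabar_sq_pos j
    have h1 : ∑ i, S.sem.noise j (x i) ^ 2
        ≤ 4 * σbar ^ 2 * ∑ i, (S.sem.noise j (x i) / S.sem.σ j) ^ 2 / 4 := by
      rw [Finset.mul_sum]; exact Finset.sum_le_sum fun i _ => noise_sq_le h j _
    unfold noiseVar at hj
    rw [lt_inv_mul_iff₀ hn0] at hj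
    have h2 : 4 * σbar ^ 2 * (n + 2 * Real.log p)
        < 4 * σbar ^ 2 * ∑ i, (S.sem.noise j (x i) / S.sem.σ j) ^ 2 / 4 := by
      refine lt_of_eq_of_lt ?_ (hj.trans_le h1)
      field_simp
    have h3 := lt_of_mul_lt_mul_left h2 (by positivity)
    have := Real.log_two_lt_d9
    nlinarith
  refine (measureReal_mono hset).trans ((measureReal_exists_le _ _ _).trans ?_)
  have hb : ∀ j : Fin p, (S.sem.sampleLaw n).real {x : Fin n → Fin p → ℝ |
        n * (Real.log 2 / 2) + 2 * Real.log p
          ≤ ∑ i, (S.sem.noise j (x i) / S.sem.σ j) ^ 2 / 4} ≤ Real.exp (-(2 * Real.log p)) := by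
    intro j
    obtain ⟨h1, h2⟩ := S.sem.exp_noise_sq j
    exact chernoff_iid S.sem.P (fun y => (S.sem.noise j y / S.sem.σ j) ^ 2 / 4) _ h1
      (h2.trans exp_half_log_two).le n _
  refine (Finset.sum_le_sum fun j _ => hb j).trans ?_
  simp only [Finset.sum_const, Finset.card_univ, Fintype.card_fin, nsmul_eq_mul]
  have : Real.exp (-(2 * Real.log p)) = 1 / p * (1 / p) := by
    have : (1 : ℝ) / p = Real.exp (-Real.log p) := by rw [Real.exp_neg, Real.exp_log hp0, one_div]
    rw [this, ← Real.exp_add]; congr 1; ring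
  rw [this]
  refine le_of_eq ?_
  field_simp

/-- The sum of the empirical variances of the errors is at most of the order `p + log p / n`. -/
lemma Regular.measure_not_sum_noiseVar_le (h : S.Regular K C η σbar c) (hp : 2 ≤ p) (hn : 0 < n) :
    (S.sem.sampleLaw n).real {x | ¬ ∑ j, S.noiseVar x j
      ≤ 4 * σbar ^ 2 * (p + Real.log p / n)} ≤ 1 / p := by
  have hp0 : (0 : ℝ) < p := by positivity
  have hn0 : (0 : ℝ) < n := by exact_mod_cast hn
  have hσ := h.sigmabar_sq_pos ⟨0, by omega⟩
  set Y : Fin p → (Fin p → ℝ) → ℝ := fun j y => (S.sem.noise j y / S.sem.σ j) ^ 2 / 4 with hY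
  have hset : {x : Fin n → Fin p → ℝ | ¬ ∑ j, S.noiseVar x j
      ≤ 4 * σbar ^ 2 * (p + Real.log p / n)}
      ⊆ {x | n * (p * (Real.log 2 / 2)) + Real.log p ≤ ∑ i, (∑ j, Y j) (x i)} := by
    intro x hx
    simp only [Set.mem_ofPred_eq, not_le] at hx ⊢
    have h1 : ∑ j, S.noiseVar x j ≤ (n : ℝ)⁻¹ * (4 * σbar ^ 2 * ∑ i, (∑ j, Y j) (x i)) := by
      simp only [noiseVar]
      rw [← Finset.mul_sum, Finset.sum_comm]
      refine mul_le_mul_of_nonneg_left ?_ (by positivity)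
      rw [Finset.mul_sum]
      refine Finset.sum_le_sum fun i _ => ?_
      rw [Finset.sum_apply, Finset.mul_sum]
      exact Finset.sum_le_sum fun j _ => noise_sq_le h j _
    have h2 := hx.trans_le h1
    rw [lt_inv_mul_iff₀ hn0] at h2
    have h3 : 4 * σbar ^ 2 * (n * p + Real.log p) < 4 * σbar ^ 2 * ∑ i, (∑ j, Y j) (x i) := by
      refine lt_of_eq_of_lt ?_ h2
      field_simp
    have h4 := lt_of_mul_lt_mul_left h3 (by positivity)
    have h5 : (n : ℝ) * (p * (Real.log 2 / 2)) ≤ n * p := by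
      have := Real.log_two_lt_d9
      have : (p : ℝ) * (Real.log 2 / 2) ≤ p := mul_le_of_le_one_right hp0.le (by linarith)
      gcongr
    linarith
  have hind : iIndepFun Y S.sem.P :=
    S.sem.iIndepFun_noise.comp (fun j y => (y / S.sem.σ j) ^ 2 / 4) fun j => by fun_prop
  have hYm : ∀ j, Measurable (Y j) := fun j =>
    (((S.sem.measurable_noise j).div_const _).pow_const 2).div_const 4
  have hint : Integrable (fun y => Real.exp (1 * (∑ j, Y j) y)) S.sem.P :=
    hind.integrable_exp_mul_sum hYm fun j _ => by
      simpa only [one_mul] using (S.sem.exp_noise_sq j).1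
  have hval : ∫ y, Real.exp (1 * (∑ j, Y j) y) ∂S.sem.P = Real.exp (p * (Real.log 2 / 2)) := by
    have h1 := hind.mgf_sum (t := 1) hYm Finset.univ
    have h2 : ∀ j, mgf (Y j) S.sem.P 1 = Real.exp (Real.log 2 / 2) := fun j => by
      rw [mgf, ← exp_half_log_two, ← (S.sem.exp_noise_sq j).2]
      simp only [one_mul, hY]
    rw [mgf] at h1
    rw [h1]
    simp only [h2, Finset.prod_const, Finset.card_univ, Fintype.card_fin]
    rw [← Real.exp_nat_mul]
  simp only [one_mul] at hint hval
  refine (measureReal_mono hset).trans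
    ((chernoff_iid S.sem.P _ _ hint hval.le n (Real.log p)).trans (le_of_eq ?_))
  rw [Real.exp_neg, Real.exp_log hp0, one_div]

end Setup

namespace Setup

variable {p : ℕ} {S : Setup p} {K R : ℕ} {C η σbar c s lam τ : ℝ} {n : ℕ}
  {x : Fin n → Fin p → ℝ} {θ : Param p}

/-! ### Good samples -/

/-- The constant in the uniform deviation bounds. -/
def uniformConst (C σbar : ℝ) (K : ℕ) : ℝ := deviationConst C σbar K (unionExponent K)

/-- Below this value of `log p / n` the empirical residuals are bounded away from zero. -/
def ratioThreshold (C σbar c : ℝ) (K : ℕ) : ℝ :=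
  min 1 ((c / (2 * ((uniformConst C σbar K + 1) * (1 + C * K) ^ 2))) ^ 2)

/-- The sample satisfies all concentration bounds. -/
structure GoodSample (S : Setup p) (K R : ℕ) (C σbar c : ℝ) (x : Fin n → Fin p → ℝ) : Prop where
  moments : Real.log p / n ≤ ratioThreshold C σbar c K →
    S.MomentsClose R (uniformConst C σbar K * √(Real.log p / n)) x
  noise : Real.log p / n ≤ ratioThreshold C σbar c K →
    ∀ j, |S.noiseVar x j - S.sem.σ j ^ 2| ≤ uniformConst C σbar K * √(Real.log p / n)
  orthogonal : S.NearlyOrthogonal R ((K + 2) * Real.log p) x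
  noiseVar_le : ∀ j, S.noiseVar x j ≤ 4 * σbar ^ 2 * (1 + 2 * (Real.log p / n))
  sum_noiseVar_le : ∑ j, S.noiseVar x j ≤ 4 * σbar ^ 2 * (p + Real.log p / n)

lemma uniformConst_nonneg : 0 ≤ uniformConst C σbar K :=
  deviationConst_nonneg (by unfold unionExponent; positivity)

lemma ratioThreshold_pos (hC : 0 < C) (hc : 0 < c) : 0 < ratioThreshold C σbar c K := by
  have := uniformConst_nonneg (C := C) (σbar := σbar) (K := K)
  refine lt_min one_pos (pow_pos (div_pos hc ?_) 2)
  positivity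

lemma uniformConst_mul_sqrt_le (hC : 0 < C) (hc : 0 < c) {ℓ : ℝ}
    (hℓ : ℓ ≤ ratioThreshold C σbar c K) :
    uniformConst C σbar K * √ℓ * (1 + C * K) ^ 2 ≤ c / 2 := by
  have hA := uniformConst_nonneg (C := C) (σbar := σbar) (K := K)
  set A := uniformConst C σbar K
  have hq : 0 < (1 + C * K) ^ 2 := by positivity
  have h1 : √ℓ ≤ c / (2 * ((A + 1) * (1 + C * K) ^ 2)) := by
    rw [Real.sqrt_le_left (by positivity)]
    exact hℓ.trans (min_le_right _ _)
  have h2 : A * √ℓ * (1 + C * K) ^ 2 ≤ (A + 1) * √ℓ * (1 + C * K) ^ 2 := by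
    have := Real.sqrt_nonneg ℓ
    gcongr
    linarith
  refine h2.trans ?_
  calc (A + 1) * √ℓ * (1 + C * K) ^ 2
      ≤ (A + 1) * (c / (2 * ((A + 1) * (1 + C * K) ^ 2))) * (1 + C * K) ^ 2 := by gcongr
    _ = c / 2 := by field_simp

lemma Regular.exists_measurableSet_goodSample (h : S.Regular K C η σbar c) (hp : 2 ≤ p)
    (hn : 0 < n) (R : ℕ) : ∃ A : Set (Fin n → Fin p → ℝ), MeasurableSet A ∧
      1 - 5 / (p : ℝ) ≤ (S.sem.sampleLaw n).real A ∧
      ∀ x ∈ A, S.GoodSample K R C σbar c x := by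
  set μ := S.sem.sampleLaw n
  have hn0 : (0 : ℝ) < n := by exact_mod_cast hn
  set B1 := {x : Fin n → Fin p → ℝ | ¬ (Real.log p / n ≤ ratioThreshold C σbar c K →
    S.MomentsClose R (uniformConst C σbar K * √(Real.log p / n)) x)} with hB1
  set B2 := {x : Fin n → Fin p → ℝ | ¬ (Real.log p / n ≤ ratioThreshold C σbar c K →
    ∀ j, |S.noiseVar x j - S.sem.σ j ^ 2| ≤ uniformConst C σbar K * √(Real.log p / n))} with hB2
  set B3 := {x : Fin n → Fin p → ℝ | ¬ S.NearlyOrthogonal R ((K + 2) * Real.log p) x} with hB3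
  set B4 := {x : Fin n → Fin p → ℝ | ¬ ∀ j, S.noiseVar x j
    ≤ 4 * σbar ^ 2 * (1 + 2 * (Real.log p / n))} with hB4
  set B5 := {x : Fin n → Fin p → ℝ | ¬ ∑ j, S.noiseVar x j
    ≤ 4 * σbar ^ 2 * (p + Real.log p / n)} with hB5
  have hLn : Real.log p / n ≤ ratioThreshold C σbar c K → Real.log p ≤ n := fun hle => by
    have := hle.trans (min_le_left _ _)
    rwa [div_le_one hn0] at this
  have h1 : μ.real B1 ≤ 1 / p := by
    by_cases hle : Real.log p / n ≤ ratioThreshold C σbar c K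
    · refine (measureReal_mono ?_).trans (h.measure_not_momentsClose_le (R := R) hp (hLn hle))
      exact fun x hx hcon => hx fun _ => hcon
    · have : B1 = ∅ := by ext x; simp [hB1, hle]
      rw [this, measureReal_empty]; positivity
  have h2 : μ.real B2 ≤ 1 / p := by
    by_cases hle : Real.log p / n ≤ ratioThreshold C σbar c K
    · refine (measureReal_mono ?_).trans (h.measure_not_noiseClose_le hp (hLn hle))
      exact fun x hx hcon => hx fun _ => hcon
    · have : B2 = ∅ := by ext x; simp [hB2, hle]
      rw [this, measureReal_empty]; positivity
  have h3 : μ.real B3 ≤ 1 / p := h.measure_not_nearlyOrthogonal_le hp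
  have h4 : μ.real B4 ≤ 1 / p := h.measure_not_noiseVar_le hp hn
  have h5 : μ.real B5 ≤ 1 / p := h.measure_not_sum_noiseVar_le hp hn
  set B := B1 ∪ B2 ∪ B3 ∪ B4 ∪ B5 with hB
  have hBle : μ.real B ≤ 5 / p := by
    have e : (5 : ℝ) / p = 1 / p + 1 / p + 1 / p + 1 / p + 1 / p := by ring
    rw [e]
    refine (measureReal_union_le _ _).trans (add_le_add ?_ h5)
    refine (measureReal_union_le _ _).trans (add_le_add ?_ h4)
    refine (measureReal_union_le _ _).trans (add_le_add ?_ h3)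
    exact (measureReal_union_le _ _).trans (add_le_add h1 h2)
  refine ⟨(toMeasurable μ B)ᶜ, (measurableSet_toMeasurable μ B).compl, ?_, fun x hx => ?_⟩
  · rw [probReal_compl_eq_one_sub (measurableSet_toMeasurable μ B), measureReal_def,
      measure_toMeasurable, ← measureReal_def]
    linarith
  · have hxB : x ∉ B := fun hmem => hx (subset_toMeasurable μ B hmem)
    simp only [hB, Set.mem_union, not_or] at hxB
    obtain ⟨⟨⟨⟨g1, g2⟩, g3⟩, g4⟩, g5⟩ := hxB
    exact ⟨not_not.1 g1, not_not.1 g2, not_not.1 g3, not_not.1 g4, not_not.1 g5⟩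

/-! ### Large dimension -/

lemma Regular.residual_le_noiseVar (h : S.Regular K C η σbar c) (hn : 0 < n)
    (hθ : S.Feasible C η R s θ) (j : Fin p) :
    S.empiricalResidual x θ j ≤ 2 * S.noiseVar x j + 2 * (4 * C * K) ^ 2 := by
  have hn0 : (0 : ℝ) < n := by exact_mod_cast hn
  have hC := h.C_pos
  rw [h.empiricalResidual_eq hθ, noiseVar, inv_mul_le_iff₀ hn0]
  have hpt : ∀ i, (x i j - S.fit R θ.β j (x i)) ^ 2
      ≤ 2 * S.sem.noise j (x i) ^ 2 + 2 * (4 * C * K) ^ 2 := by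
    intro i
    have h1 := h.abs_signal_le j (x i)
    have h2 := h.abs_fit_le (R := R) hθ.sobolev j (x i)
    have h3 : (S.sem.signal j (x i) - S.fit R θ.β j (x i)) ^ 2 ≤ (4 * C * K) ^ 2 := by
      refine sq_le_sq.2 ?_
      rw [abs_of_nonneg (by positivity : 0 ≤ 4 * C * K)]
      linarith [abs_sub (S.sem.signal j (x i)) (S.fit R θ.β j (x i))]
    have e : x i j - S.fit R θ.β j (x i)
        = S.sem.noise j (x i) + (S.sem.signal j (x i) - S.fit R θ.β j (x i)) := by
      simp only [AdditiveSEM.noise]; ring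
    rw [e]
    nlinarith [sq_nonneg (S.sem.noise j (x i) - (S.sem.signal j (x i) - S.fit R θ.β j (x i)))]
  refine (Finset.sum_le_sum fun i _ => hpt i).trans (le_of_eq ?_)
  rw [Finset.sum_add_distrib, ← Finset.mul_sum, Finset.sum_const, Finset.card_univ,
    Fintype.card_fin, nsmul_eq_mul]
  field_simp

/-- If `log p / n` is bounded below, all variances dominated by the residuals satisfy the bound. -/
lemma Regular.sum_sq_le_of_large (h : S.Regular K C η σbar c) (hp : 2 ≤ p) (hn : 0 < n)
    {δ E : ℝ} (hδ : 0 < δ) (hlarge : δ < Real.log p / n) (hE : 0 ≤ E)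
    (hx : S.GoodSample K R C σbar c x)
    (hθ : S.Feasible C η R s θ) {v : Fin p → ℝ} (hv : ∀ j, 0 ≤ v j)
    (hvE : ∀ j, v j ≤ E * S.empiricalResidual x θ j) :
    ∑ j, (S.sem.σ j ^ 2 - v j) ^ 2
      ≤ (((σbar ^ 2) ^ 2 + 8 * E ^ 2 * ((4 * C * K) ^ 2) ^ 2 + 256 * E ^ 2 * (σbar ^ 2) ^ 2) / δ
        + 512 * E ^ 2 * (σbar ^ 2) ^ 2) * (p * Real.log p / n) := by
  have hp0 : (0 : ℝ) < p := by positivity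
  have hn1 : (1 : ℝ) ≤ n := by exact_mod_cast hn
  set ℓ := Real.log p / n with hℓ
  have hℓp : ℓ ≤ p := by
    have h1 : Real.log p ≤ p := (Real.log_le_sub_one_of_pos hp0).trans (by linarith)
    rw [hℓ, div_le_iff₀ (by linarith)]
    nlinarith
  have hℓ0 : 0 < ℓ := hδ.trans hlarge
  have ha0 : ∀ j, 0 ≤ S.noiseVar x j := fun j =>
    mul_nonneg (by positivity) (Finset.sum_nonneg fun _ _ => sq_nonneg _)
  set a := fun j => S.noiseVar x j with ha
  set b := σbar ^ 2 with hb
  have hb0 : 0 ≤ b := sq_nonneg _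
  have hsq : ∑ j, a j ^ 2 ≤ 32 * b ^ 2 * (1 + 2 * ℓ) * p := by
    calc ∑ j, a j ^ 2 ≤ ∑ j, (4 * b * (1 + 2 * ℓ)) * a j := Finset.sum_le_sum fun j _ => by
          rw [sq]; exact mul_le_mul_of_nonneg_right (hx.noiseVar_le j) (ha0 j)
      _ = (4 * b * (1 + 2 * ℓ)) * ∑ j, a j := by rw [Finset.mul_sum]
      _ ≤ (4 * b * (1 + 2 * ℓ)) * (4 * b * (p + ℓ)) := by
          gcongr; exact hx.sum_noiseVar_le
      _ ≤ (4 * b * (1 + 2 * ℓ)) * (4 * b * (p + p)) := by gcongr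
      _ = _ := by ring
  have hpt : ∀ j, (S.sem.σ j ^ 2 - v j) ^ 2
      ≤ (b ^ 2 + 8 * E ^ 2 * ((4 * C * K) ^ 2) ^ 2) + 8 * E ^ 2 * a j ^ 2 := by
    intro j
    have h1 := h.sigma_sq_le j
    have h0 : 0 ≤ S.sem.σ j ^ 2 := sq_nonneg _
    have h2 : v j ≤ E * (2 * a j + 2 * (4 * C * K) ^ 2) :=
      (hvE j).trans (mul_le_mul_of_nonneg_left (h.residual_le_noiseVar hn hθ j) hE)
    have h3 : v j ^ 2 ≤ (E * (2 * a j + 2 * (4 * C * K) ^ 2)) ^ 2 := pow_le_pow_left₀ (hv j) h2 2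
    have h4 : (S.sem.σ j ^ 2) ^ 2 ≤ b ^ 2 := pow_le_pow_left₀ h0 h1 2
    have h5 : (2 * a j + 2 * (4 * C * K) ^ 2) ^ 2 ≤ 8 * a j ^ 2 + 8 * ((4 * C * K) ^ 2) ^ 2 := by
      nlinarith [sq_nonneg (a j - (4 * C * K) ^ 2)]
    have h6 := mul_le_mul_of_nonneg_left h5 (sq_nonneg E)
    rw [mul_pow] at h3
    nlinarith [mul_nonneg h0 (hv j)]
  refine (Finset.sum_le_sum fun j _ => hpt j).trans ?_
  rw [Finset.sum_add_distrib, Finset.sum_const, Finset.card_univ, Fintype.card_fin, nsmul_eq_mul,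
    ← Finset.mul_sum]
  set Q := b ^ 2 + 8 * E ^ 2 * ((4 * C * K) ^ 2) ^ 2 with hQ
  have hQ0 : 0 ≤ Q := by positivity
  have h7 := mul_le_mul_of_nonneg_left hsq (show 0 ≤ 8 * E ^ 2 by positivity)
  have h8 : (p : ℝ) * Real.log p / n = p * ℓ := by rw [hℓ]; ring
  rw [h8]
  have h9 : p * (Q + 256 * E ^ 2 * b ^ 2) ≤ (Q + 256 * E ^ 2 * b ^ 2) / δ * (p * ℓ) := by
    have : p * (Q + 256 * E ^ 2 * b ^ 2) * δ ≤ p * (Q + 256 * E ^ 2 * b ^ 2) * ℓ := by gcongr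
    rw [div_mul_eq_mul_div, le_div_iff₀ hδ]
    linarith
  rw [add_mul]
  linarith

/-! ### The order of a nearly optimal graph -/

/-- The rate `(p + s R) log p / n + s R^{-2η} + λ² s`. -/
def rate (p n R : ℕ) (s lam η : ℝ) : ℝ :=
  (p + s * R) * Real.log p / n + s * (R : ℝ) ^ (-2 * η) + lam ^ 2 * s

/-- The constant in the comparison of the separation with the rate. -/
def orderConst (C σbar c : ℝ) (K : ℕ) : ℝ :=
  3 / c * (1 + C * K) ^ 2 * uniformConst C σbar K + 4 * C ^ 2 * K / c + 1

lemma orderConst_pos (hC : 0 < C) (hc : 0 < c) : 0 < orderConst C σbar c K := by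
  have := uniformConst_nonneg (C := C) (σbar := σbar) (K := K)
  unfold orderConst; positivity

lemma Regular.consistent_of_separation (h : S.Regular K C η σbar c) (hp : 2 ≤ p) (hn : 0 < n)
    (hR : 1 ≤ R) (hs : (S.sem.edges.card : ℝ) ≤ s) (hx : S.GoodSample K R C σbar c x)
    (hsmall : Real.log p / n ≤ ratioThreshold C σbar c K)
    (hopt : S.IsNearOptimal C η R s lam τ x θ) (hτ : 0 ≤ τ) {ε : ℝ} (hε : 0 < ε)
    (hεD : 4 * orderConst C σbar c K * ε ≤ 1)
    (hsep : ((|lam ^ 2 * s + p * √(Real.log p / n) + s * (R : ℝ) ^ (-2 * η)| : ℝ) : EReal)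
      ≤ (ε : EReal) * ((p : EReal) * S.separation C η))
    (hsepτ : ((|τ| : ℝ) : EReal) ≤ (ε : EReal) * ((p : EReal) * S.separation C η))
    {π : Equiv.Perm (Fin p)} (hπ : Consistent π θ.edges) : Consistent π S.sem.edges := by
  by_contra hcon
  have hp0 : (0 : ℝ) < p := by positivity
  have hn0 : (0 : ℝ) < n := by exact_mod_cast hn
  have hc := h.c_pos
  have hC := h.C_pos
  have hs0 : 0 ≤ s := (Nat.cast_nonneg _).trans hs
  have hA := uniformConst_nonneg (C := C) (σbar := σbar) (K := K)
  set Ξ := ∑ j, (Real.log (S.residualVar C η j (S.parentsUnder π j))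
    - Real.log (S.sem.σ j ^ 2)) with hΞ
  have hle : (ε : EReal) * ((p : EReal) * S.separation C η) ≤ ((ε * Ξ : ℝ) : EReal) := by
    have h1 : S.separation C η ≤ (((p : ℝ)⁻¹ * Ξ : ℝ) : EReal) :=
      iInf_le (fun π : {π : Equiv.Perm (Fin p) // ¬ Consistent π S.sem.edges} =>
        (((p : ℝ)⁻¹ * ∑ j, (Real.log (S.residualVar C η j (S.parentsUnder π.1 j))
          - Real.log (S.sem.σ j ^ 2)) : ℝ) : EReal)) ⟨π, hcon⟩
    have h2 : (p : EReal) * S.separation C η ≤ (p : EReal) * (((p : ℝ)⁻¹ * Ξ : ℝ) : EReal) :=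
      mul_le_mul_of_nonneg_left h1 (by positivity)
    have h3 : (p : EReal) * (((p : ℝ)⁻¹ * Ξ : ℝ) : EReal) = ((Ξ : ℝ) : EReal) := by
      rw [← EReal.coe_natCast, ← EReal.coe_mul, mul_inv_cancel_left₀ hp0.ne']
    rw [h3] at h2
    rw [EReal.coe_mul]
    exact mul_le_mul_of_nonneg_left h2 (by exact_mod_cast hε.le)
  set a := lam ^ 2 * s + p * √(Real.log p / n) + s * (R : ℝ) ^ (-2 * η) with ha
  have hlog : 0 < Real.log p := by linarith [half_le_log hp]
  have ha0 : 0 < a := by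
    have : 0 < √(Real.log p / n) := Real.sqrt_pos.2 (by positivity)
    positivity
  have ha1 : a ≤ ε * Ξ := by
    have := EReal.coe_le_coe_iff.1 (hsep.trans hle)
    rwa [abs_of_pos ha0] at this
  have hτ1 : τ ≤ ε * Ξ := by
    have := EReal.coe_le_coe_iff.1 (hsepτ.trans hle)
    rwa [abs_of_nonneg hτ] at this
  have hmain := h.sum_log_residualVar_le hR hs (by positivity) (hx.moments hsmall)
    (uniformConst_mul_sqrt_le hC hc hsmall) hopt hτ hπ
  rw [← hΞ] at hmain
  set D := orderConst C σbar c K with hD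
  have hD1 : Ξ ≤ D * a + τ := by
    set q := √(Real.log p / n)
    have hq : 0 ≤ q := Real.sqrt_nonneg _
    set w := s * (R : ℝ) ^ (-2 * η)
    have hw : 0 ≤ w := by positivity
    have hl : 0 ≤ lam ^ 2 * s := by positivity
    set k1 := 3 / c * (1 + C * K) ^ 2 * uniformConst C σbar K with hk1
    set k2 := 4 * C ^ 2 * K / c with hk2
    have hk10 : 0 ≤ k1 := by positivity
    have hk20 : 0 ≤ k2 := by positivity
    have e1 : 3 / c * (1 + C * K) ^ 2 * (p * (uniformConst C σbar K * q)) = k1 * (p * q) := by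
      rw [hk1]; ring
    rw [e1] at hmain
    have hDk : D = k1 + k2 + 1 := rfl
    have hpq : 0 ≤ p * q := by positivity
    have e2 : D * a + τ - (k1 * (p * q) + k2 * w + lam ^ 2 * s + τ)
        = (k1 + k2) * (lam ^ 2 * s) + (k2 + 1) * (p * q) + (k1 + 1) * w := by
      rw [hDk, ha]; ring
    have : 0 ≤ (k1 + k2) * (lam ^ 2 * s) + (k2 + 1) * (p * q) + (k1 + 1) * w := by positivity
    linarith
  have hDone : 1 ≤ D := by
    rw [hD, orderConst]
    have : 0 ≤ 3 / c * (1 + C * K) ^ 2 * uniformConst C σbar K + 4 * C ^ 2 * K / c := by positivity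
    linarith
  have hΞ0 : 0 < Ξ := by
    by_contra hneg
    have := mul_nonpos_of_nonneg_of_nonpos hε.le (not_lt.1 hneg)
    linarith
  have h1 : D * a ≤ D * (ε * Ξ) := by gcongr
  have h2 : ε * Ξ ≤ D * (ε * Ξ) := le_mul_of_one_le_left (by positivity) hDone
  have h3 : 4 * D * ε * Ξ ≤ 1 * Ξ := by gcongr
  linarith

/-! ### Bounds for a single model -/

lemma rate_nonneg (hs0 : 0 ≤ s) : 0 ≤ rate p n R s lam η := by
  unfold rate; positivity

/-- The bound for the residuals when `log p / n` is small. -/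
lemma Regular.residual_rate_of_small (h : S.Regular K C η σbar c) (hp : 2 ≤ p) (hn : 0 < n)
    (hR : 1 ≤ R) (hs : (S.sem.edges.card : ℝ) ≤ s) (hx : S.GoodSample K R C σbar c x)
    (hsmall : Real.log p / n ≤ ratioThreshold C σbar c K)
    (hopt : S.IsNearOptimal C η R s lam τ x θ) (hτ : 0 ≤ τ)
    (horder : ∀ π : Equiv.Perm (Fin p), Consistent π θ.edges → Consistent π S.sem.edges) {M : ℝ}
    (hM : M = σbar ^ 2 + c + (4 * C * K) ^ 2) :
    (∀ j, S.empiricalResidual x θ j ≤ 4 * M) ∧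
    ∑ j, (S.sem.σ j ^ 2 - S.empiricalResidual x θ j) ^ 2
      ≤ (2 * uniformConst C σbar K ^ 2 + 80 * M ^ 2 *
          (6 / c * (4 * σbar ^ 2 * (K + 4)) + 4 / c * (4 * C ^ 2 * K) + 1))
        * (rate p n R s lam η + τ) := by
  have hc := h.c_pos
  have hC := h.C_pos
  have hs0 : 0 ≤ s := (Nat.cast_nonneg _).trans hs
  have hn0 : (0 : ℝ) < n := by exact_mod_cast hn
  have hA := uniformConst_nonneg (C := C) (σbar := σbar) (K := K)
  have hL := half_le_log hp
  set L := Real.log p with hLdef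
  obtain ⟨π, hπ⟩ := exists_consistent hopt.1.acyclic
  have hsm := uniformConst_mul_sqrt_le (σbar := σbar) hC hc hsmall
  have hone : 1 ≤ (1 + C * K) ^ 2 := by
    have : 0 ≤ C * K := by positivity
    nlinarith
  obtain ⟨hb, hsum⟩ := h.sum_sq_residual_le hR hn hs (t' := uniformConst C σbar K * √(L / n))
    (L := (K + 2) * L) (by positivity) (by positivity)
    (hx.moments hsmall) hsm
    (le_trans (le_mul_of_one_le_right (by positivity) hone) hsm) (hx.noise hsmall) hx.orthogonal
    hopt hτ hπ (horder π hπ) hM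
  refine ⟨hb, hsum.trans ?_⟩
  rw [mul_pow, Real.sq_sqrt (by positivity)]
  set A := uniformConst C σbar K
  set w := s * (R : ℝ) ^ (-2 * η) with hw
  have hw0 : 0 ≤ w := by positivity
  set ρ := (p + s * R) * L / n with hρ
  have hρ0 : 0 ≤ ρ := by positivity
  have hl0 : 0 ≤ lam ^ 2 * s := by positivity
  have hrate : rate p n R s lam η = ρ + w + lam ^ 2 * s := rfl
  have h1 : (p : ℝ) * (A ^ 2 * (L / n)) ≤ A ^ 2 * ρ := by
    have e : (p : ℝ) * (A ^ 2 * (L / n)) = A ^ 2 * (p * L / n) := by ring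
    rw [e, hρ]
    gcongr
    have : 0 ≤ s * R := by positivity
    linarith
  have h2 : 4 * σbar ^ 2 * (2 * (s * R) + p + p * ((K + 2) * L)) / n
      ≤ 4 * σbar ^ 2 * (K + 4) * ρ := by
    have h3 : 2 * (s * R) + p + p * ((K + 2) * L) ≤ (K + 4) * ((p + s * R) * L) := by
      have h4 : 0 ≤ s * R := by positivity
      have h5 : s * R ≤ 2 * (s * R * L) := by nlinarith
      have h6 : (p : ℝ) ≤ 2 * (p * L) := by nlinarith [(Nat.cast_nonneg p : (0 : ℝ) ≤ p)]
      have h7 : 0 ≤ K * (s * R * L) := by positivity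
      linarith
    calc _ ≤ 4 * σbar ^ 2 * ((K + 4) * ((p + s * R) * L)) / n := by gcongr
      _ = _ := by rw [hρ]; ring
  have h3 := mul_le_mul_of_nonneg_left h2 (show 0 ≤ 6 / c by positivity)
  rw [hrate]
  have hM0 : 0 ≤ 80 * M ^ 2 := by positivity
  set k1 := 6 / c * (4 * σbar ^ 2 * (K + 4)) with hk1
  set k2 := 4 / c * (4 * C ^ 2 * K) with hk2
  have hk10 : 0 ≤ k1 := by positivity
  have hk20 : 0 ≤ k2 := by positivity
  have h4 : 6 / c * (4 * σbar ^ 2 * (2 * (s * R) + p + p * ((K + 2) * L)) / n)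
      + 4 / c * (4 * C ^ 2 * K * w) + (lam ^ 2 * s + τ)
      ≤ (k1 + k2 + 1) * (ρ + w + lam ^ 2 * s + τ) := by
    have e1 : 4 / c * (4 * C ^ 2 * K * w) = k2 * w := by rw [hk2]; ring
    have e2 : 6 / c * (4 * σbar ^ 2 * (K + 4) * ρ) = k1 * ρ := by rw [hk1]; ring
    have e3 : (k1 + k2 + 1) * (ρ + w + lam ^ 2 * s + τ)
        - (k1 * ρ + k2 * w + (lam ^ 2 * s + τ))
        = (k2 + 1) * ρ + (k1 + 1) * w + (k1 + k2) * (lam ^ 2 * s + τ) := by ring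
    have : 0 ≤ (k2 + 1) * ρ + (k1 + 1) * w + (k1 + k2) * (lam ^ 2 * s + τ) := by positivity
    linarith
  have h5 := mul_le_mul_of_nonneg_left h4 hM0
  have h6 : A ^ 2 * ρ ≤ A ^ 2 * (ρ + w + lam ^ 2 * s + τ) := by
    gcongr; linarith
  calc _ ≤ 2 * (A ^ 2 * (ρ + w + lam ^ 2 * s + τ))
        + 80 * M ^ 2 * ((k1 + k2 + 1) * (ρ + w + lam ^ 2 * s + τ)) := by linarith
    _ = _ := by ring

lemma varianceError_le_two_mul (S : Setup p) (θ : Param p) (r : Fin p → ℝ) :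
    S.varianceError θ ≤ 2 * ∑ j, (S.sem.σ j ^ 2 - r j) ^ 2 + 2 * ∑ j, (r j - θ.σ j ^ 2) ^ 2 := by
  have key : ∀ a b r : ℝ, (a - b) ^ 2 ≤ 2 * (a - r) ^ 2 + 2 * (r - b) ^ 2 := fun a b r => by
    nlinarith [sq_nonneg ((a - r) - (r - b))]
  unfold varianceError
  rw [Finset.mul_sum, Finset.mul_sum, ← Finset.sum_add_distrib]
  exact Finset.sum_le_sum fun j _ => key _ _ _

/-- The bounds for nearly optimal parameters, with constants that do not depend on the model. -/
theorem exists_rate_const (K : ℕ) {C σbar c : ℝ} (η : ℝ) (hC : 0 < C) (hc : 0 < c) (T : ℝ)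
    (hT : 0 ≤ T) :
    ∃ D : ℝ, 0 < D ∧ ∀ {p : ℕ} {S : Setup p} {R : ℕ} {s lam τ : ℝ} {n : ℕ}
      {x : Fin n → Fin p → ℝ} {θ : Param p}, S.Regular K C η σbar c → 2 ≤ p → 0 < n → 1 ≤ R →
      (S.sem.edges.card : ℝ) ≤ s → S.GoodSample K R C σbar c x →
      S.IsNearOptimal C η R s lam τ x θ → 0 ≤ τ → (S.IsProfiled x θ ∨ τ ≤ T) →
      (Real.log p / n ≤ ratioThreshold C σbar c K →
        ∀ π : Equiv.Perm (Fin p), Consistent π θ.edges → Consistent π S.sem.edges) →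
      S.varianceError θ ≤ D * (rate p n R s lam η + τ) := by
  set δ := ratioThreshold C σbar c K with hδ
  have hδ0 : 0 < δ := ratioThreshold_pos hC hc
  set M := σbar ^ 2 + c + (4 * C * K) ^ 2 with hM
  have hM0 : 0 < M := by positivity
  set E := Real.exp (T + 1) with hE
  have hE1 : 1 ≤ E := Real.one_le_exp (by linarith)
  set D1 := 2 * uniformConst C σbar K ^ 2 + 80 * M ^ 2 *
    (6 / c * (4 * σbar ^ 2 * (K + 4)) + 4 / c * (4 * C ^ 2 * K) + 1) with hD1
  have hD10 : 0 < D1 := by positivity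
  set D2 := ((σbar ^ 2) ^ 2 + 8 * E ^ 2 * ((4 * C * K) ^ 2) ^ 2
    + 256 * E ^ 2 * (σbar ^ 2) ^ 2) / δ + 512 * E ^ 2 * (σbar ^ 2) ^ 2 with hD2
  have hD20 : 0 ≤ D2 := by positivity
  set D3 := (E * (4 * M)) ^ 2 * (2 * (2 * T + 3)) with hD3
  have hD30 : 0 ≤ D3 := by positivity
  refine ⟨2 * D1 + D2 + 2 * D3, by positivity, ?_⟩
  intro p S R s lam τ n x θ h hp hn hR hs hx hopt hτ hprof horder
  have hs0 : 0 ≤ s := (Nat.cast_nonneg _).trans hs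
  have hrate := rate_nonneg (p := p) (n := n) (R := R) (lam := lam) (η := η) hs0
  have hn0 : (0 : ℝ) < n := by exact_mod_cast hn
  set r := rate p n R s lam η + τ with hr
  have hr0 : 0 ≤ r := by positivity
  have hτr : τ ≤ r := by linarith
  rcases le_or_gt (Real.log p / n) δ with hsmall | hlarge
  · obtain ⟨hb, hsum⟩ := h.residual_rate_of_small hp hn hR hs hx hsmall hopt hτ (horder hsmall) hM
    rcases hprof with hprof | hτT
    · have e : S.varianceError θ
          = ∑ j, (S.sem.σ j ^ 2 - S.empiricalResidual x θ j) ^ 2 := by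
        unfold varianceError
        exact Finset.sum_congr rfl fun j _ => by rw [hprof j]
      rw [e]
      refine hsum.trans (mul_le_mul_of_nonneg_right ?_ hr0)
      linarith
    · have h2 := hopt.sum_sq_sub_le hτ hτT hb
      have h3 := S.varianceError_le_two_mul θ (S.empiricalResidual x θ)
      rw [← hD1, ← hr] at hsum
      rw [← hE, ← hD3] at h2
      clear_value D1 D2 D3 E M δ r
      have h4 : D3 * τ ≤ D3 * r := by gcongr
      have h5 : 0 ≤ D2 * r := by positivity
      calc S.varianceError θ ≤ 2 * (D1 * r) + 2 * (D3 * r) := by linarith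
        _ ≤ _ := by linarith
  · have hvE : ∀ j, θ.σ j ^ 2 ≤ E * S.empiricalResidual x θ j := by
      intro j
      rcases hprof with hprof | hτT
      · rw [hprof j]
        exact le_mul_of_one_le_left (empiricalResidual_nonneg j) hE1
      · exact hopt.sigma_sq_le hτ hτT j
    have h1 := h.sum_sq_le_of_large hp hn hδ0 hlarge (by linarith) hx hopt.1
      (fun j => sq_nonneg (θ.σ j)) hvE
    have h2 : (p : ℝ) * Real.log p / n ≤ r := by
      have h3 : (p : ℝ) * Real.log p / n ≤ (p + s * R) * Real.log p / n := by
        have : 0 ≤ s * R := by positivity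
        have := half_le_log hp
        gcongr
        linarith
      have h4 : 0 ≤ s * (R : ℝ) ^ (-2 * η) := by positivity
      have h5 : 0 ≤ lam ^ 2 * s := by positivity
      rw [hr, rate]
      linarith
    calc S.varianceError θ ≤ D2 * (p * Real.log p / n) := h1
      _ ≤ D2 * r := by gcongr
      _ ≤ _ := mul_le_mul_of_nonneg_right (by linarith) hr0

end Setup

end

end CausalAdditive

namespace CausalAdditive

namespace Setup

variable {K : ℕ} {C η σbar c : ℝ} {p R : ℕ → ℕ} {s lam : ℕ → ℝ} {S : ∀ n, Setup (p n)}

/-! ### Sequences of models -/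

lemma exists_goodSets (hreg : ∀ n, (S n).Regular K C η σbar c) (hp : ∀ n, 1 ≤ p n)
    (R : ℕ → ℕ) : ∃ A : ∀ n, Set (Fin n → Fin (p n) → ℝ),
      (∀ n, MeasurableSet (A n) ∧
        1 - 5 / (p n : ℝ) ≤ ((S n).sem.sampleLaw n).real (A n)) ∧
      ∀ n, 0 < n → ∀ x ∈ A n, 2 ≤ p n ∧ (S n).GoodSample K (R n) C σbar c x := by
  have key : ∀ n, ∃ A : Set (Fin n → Fin (p n) → ℝ), (MeasurableSet A ∧
      1 - 5 / (p n : ℝ) ≤ ((S n).sem.sampleLaw n).real A) ∧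
      (0 < n → ∀ x ∈ A, 2 ≤ p n ∧ (S n).GoodSample K (R n) C σbar c x) := by
    intro n
    rcases Nat.eq_zero_or_pos n with hn | hn
    · refine ⟨Set.univ, ⟨MeasurableSet.univ, ?_⟩, fun h => absurd h (by omega)⟩
      rw [probReal_univ]
      have : 0 ≤ 5 / (p n : ℝ) := by positivity
      linarith
    · rcases Nat.lt_or_ge (p n) 2 with hlt | hge
      · have : p n = 1 := by have := hp n; omega
        refine ⟨∅, ⟨MeasurableSet.empty, ?_⟩, fun _ x hx => absurd hx (Set.notMem_empty x)⟩
        rw [measureReal_empty, this]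
        norm_num
      · obtain ⟨A, h1, h2, h3⟩ := (hreg n).exists_measurableSet_goodSample hge hn (R n)
        exact ⟨A, ⟨h1, h2⟩, fun _ x hx => ⟨hge, h3 x hx⟩⟩
  choose A h1 h2 using key
  exact ⟨A, h1, h2⟩

lemma exists_eventual_rate (hC : 0 < C) (hc : 0 < c) (hreg : ∀ n, (S n).Regular K C η σbar c)
    (hR : ∀ n, 1 ≤ R n) (hs : ∀ n, ((S n).sem.edges.card : ℝ) ≤ s n)
    (hsep : NegligibleTo
      (fun n => lam n ^ 2 * s n + p n * √(Real.log (p n) / n) + s n * (R n : ℝ) ^ (-2 * η))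
      (fun n => (p n : EReal) * (S n).separation C η))
    {A : ∀ n, Set (Fin n → Fin (p n) → ℝ)}
    (hA : ∀ n, 0 < n → ∀ x ∈ A n, 2 ≤ p n ∧ (S n).GoodSample K (R n) C σbar c x)
    {T : ℝ} (hT : 0 ≤ T) {τ : ℕ → ℝ} (hτ : ∀ n, 0 ≤ τ n)
    (hsepτ : NegligibleTo τ (fun n => (p n : EReal) * (S n).separation C η)) :
    ∃ D : ℝ, 0 < D ∧ ∀ᶠ n in atTop, ∀ x ∈ A n, ∀ θ,
      (S n).IsNearOptimal C η (R n) (s n) (lam n) (τ n) x θ →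
      ((S n).IsProfiled x θ ∨ τ n ≤ T) →
      (S n).varianceError θ ≤ D * (rate (p n) n (R n) (s n) (lam n) η + τ n) := by
  obtain ⟨D, hD, hbound⟩ := exists_rate_const K (σbar := σbar) η hC hc T hT
  have hO := orderConst_pos (σbar := σbar) (K := K) hC hc
  set ε := 1 / (4 * orderConst C σbar c K) with hε
  have hε0 : 0 < ε := by positivity
  have hεD : 4 * orderConst C σbar c K * ε ≤ 1 := by
    rw [hε, mul_one_div_cancel (by positivity)]
  refine ⟨D, hD, ?_⟩
  filter_upwards [hsep ε hε0, hsepτ ε hε0, eventually_gt_atTop 0] with n h1 h2 hn x hx θ hopt hprof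
  obtain ⟨hp2, hgood⟩ := hA n hn x hx
  exact hbound (hreg n) hp2 hn (hR n) (hs n) hgood hopt (hτ n) hprof fun hsmall π hπ =>
    (hreg n).consistent_of_separation hp2 hn (hR n) (hs n) hgood hsmall hopt (hτ n) hε0 hεD h1 h2 hπ

lemma negligibleTo_zero {a : ℕ → ℝ} {b : ℕ → EReal} (h : NegligibleTo a b) :
    NegligibleTo (fun _ => 0) b := fun ε hε => by
  filter_upwards [h ε hε] with n hn
  refine le_trans ?_ hn
  rw [abs_zero]
  exact_mod_cast abs_nonneg (a n)

/-- Under the additional scaling the penalty dominates the rate. -/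
lemma exists_rate_le (hs : ∀ n, 0 < s n)
    (h1 : (fun n : ℕ => s n * (R n : ℝ) ^ (-2 * η) + s n * R n * Real.log (p n) / n)
      =O[atTop] (fun n : ℕ => (p n : ℝ) * Real.log (p n) / n))
    (h2 : (fun n : ℕ => (p n : ℝ) * Real.log (p n) / (n * s n)) =O[atTop]
      (fun n : ℕ => lam n ^ 2)) :
    ∃ B : ℝ, 0 < B ∧ ∀ᶠ n in atTop,
      rate (p n) n (R n) (s n) (lam n) η ≤ B * (lam n ^ 2 * s n) := by
  obtain ⟨C1, hC1, h1⟩ := h1.exists_pos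
  obtain ⟨C2, hC2, h2⟩ := h2.exists_pos
  refine ⟨(1 + C1) * C2 + 1, by positivity, ?_⟩
  filter_upwards [h1.bound, h2.bound, eventually_gt_atTop 0] with n g1 g2 hn
  have hs0 := hs n
  have hn0 : (0 : ℝ) < n := by exact_mod_cast hn
  have hlog : 0 ≤ Real.log (p n) := Real.log_natCast_nonneg _
  rw [Real.norm_of_nonneg (by positivity), Real.norm_of_nonneg (by positivity)] at g1 g2
  have g3 : (p n : ℝ) * Real.log (p n) / n ≤ C2 * (lam n ^ 2 * s n) := by
    have := mul_le_mul_of_nonneg_right g2 hs0.le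
    have e : (p n : ℝ) * Real.log (p n) / (n * s n) * s n = p n * Real.log (p n) / n := by
      field_simp
    rw [e] at this
    linarith
  have e : rate (p n) n (R n) (s n) (lam n) η = p n * Real.log (p n) / n
      + (s n * (R n : ℝ) ^ (-2 * η) + s n * R n * Real.log (p n) / n) + lam n ^ 2 * s n := by
    rw [rate]; ring
  have g4 := mul_le_mul_of_nonneg_left g3 (show 0 ≤ 1 + C1 by positivity)
  rw [e]
  linarith

end Setup

end CausalAdditive

theorem theorem2
    -- constants that do not depend on the sample size
    (K : ℕ) (C η σbar c : ℝ) (hC : 0 < C) (hη : 1 < η) (hc : 0 < c)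
    -- quantities that may vary with the sample size `n`
    (p R : ℕ → ℕ) (s lam : ℕ → ℝ)
    (hp : ∀ n, 1 ≤ p n) (hR : ∀ n, 1 ≤ R n) (hlam : ∀ n, 0 ≤ lam n)
    (S : ∀ n, Setup (p n))
    -- standing assumptions on the model
    (hident : ∀ n, (S n).sem.NonlinearSmooth)
    (hspec : ∀ n, (S n).WellSpecified C η)
    (hsuper : ∀ n, (S n).SuperSparse K)
    (hsparse : ∀ n, ((S n).sem.edges.card : ℝ) ≤ s n)
    (hbasis : ∀ n, (S n).GoodBasis)
    (hvar : ∀ n, (S n).BoundedVariances C η σbar c)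
    (hcompat : ∀ n, (S n).Compatible C η)
    -- non-negligible separation
    (hsep : NegligibleTo
      (fun n => lam n ^ 2 * s n + p n * √(Real.log (p n) / n) + s n * (R n : ℝ) ^ (-2 * η))
      (fun n => (p n : EReal) * (S n).separation C η)) :
    ∃ A : ∀ n, Set (Fin n → Fin (p n) → ℝ),
      (∀ n, MeasurableSet (A n) ∧
        1 - 5 / (p n : ℝ) ≤ ((S n).sem.sampleLaw n).real (A n)) ∧
      -- the general bound
      (∃ D : ℝ, 0 < D ∧ ∃ N : ℕ, ∀ n ≥ N, ∀ x ∈ A n, ∀ θ,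
        (S n).IsEstimator C η (R n) (s n) (lam n) x θ →
        (S n).varianceError θ ≤
          D * ((p n + s n * R n) * Real.log (p n) / n + s n * (R n : ℝ) ^ (-2 * η)
            + lam n ^ 2 * s n)) ∧
      -- the bounds under the additional scaling
      ((∀ n, 0 < s n) →
        (fun n : ℕ => s n * (R n : ℝ) ^ (-2 * η) + s n * R n * Real.log (p n) / n)
          =O[atTop] (fun n : ℕ => (p n : ℝ) * Real.log (p n) / n) →
        (fun n : ℕ => lam n ^ 2)
          =Θ[atTop] (fun n : ℕ => (p n : ℝ) * Real.log (p n) / (n * s n)) →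
        (∃ D : ℝ, 0 < D ∧ ∃ N : ℕ, ∀ n ≥ N, ∀ x ∈ A n, ∀ θ,
          (S n).IsEstimator C η (R n) (s n) (lam n) x θ →
          (S n).varianceError θ ≤ D * (lam n ^ 2 * s n)) ∧
        -- early stopping
        (∀ τ : ℕ → ℝ, (∀ n, 0 ≤ τ n) →
          τ =O[atTop] (fun n : ℕ => lam n ^ 2 * s n
            + (p n + s n * R n) * Real.log (p n) / n + s n * (R n : ℝ) ^ (-2 * η)) →
          NegligibleTo τ (fun n => (p n : EReal) * (S n).separation C η) →
          (∃ D : ℝ, 0 < D ∧ ∃ N : ℕ, ∀ n ≥ N, ∀ x ∈ A n, ∀ θ,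
            (S n).IsNearOptimal C η (R n) (s n) (lam n) (τ n) x θ →
            (S n).IsProfiled x θ →
            (S n).varianceError θ ≤ D * (lam n ^ 2 * s n)) ∧
          (τ =O[atTop] (fun _ => (1 : ℝ)) →
            ∃ D : ℝ, 0 < D ∧ ∃ N : ℕ, ∀ n ≥ N, ∀ x ∈ A n, ∀ θ,
              (S n).IsNearOptimal C η (R n) (s n) (lam n) (τ n) x θ →
              (S n).varianceError θ ≤ D * (lam n ^ 2 * s n)))) := by
  have hreg : ∀ n, (S n).Regular K C η σbar c := fun n =>
    ⟨hC, hη, hc, hspec n, hsuper n, hbasis n, hvar n⟩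
  obtain ⟨A, hA, hgood⟩ := Setup.exists_goodSets hreg hp R
  have hest : ∃ D : ℝ, 0 < D ∧ ∀ᶠ n in atTop, ∀ x ∈ A n, ∀ θ,
      (S n).IsEstimator C η (R n) (s n) (lam n) x θ →
      (S n).varianceError θ ≤ D * Setup.rate (p n) n (R n) (s n) (lam n) η := by
    obtain ⟨D, hD, hev⟩ := Setup.exists_eventual_rate hC hc hreg hR hsparse hsep hgood le_rfl
      (fun _ => le_rfl) (Setup.negligibleTo_zero hsep)
    refine ⟨D, hD, hev.mono fun n h x hx θ hθ => ?_⟩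
    simpa only [add_zero] using h x hx θ hθ.isNearOptimal (Or.inr le_rfl)
  refine ⟨A, hA, ?_, fun hs hsmall hlarge => ?_⟩
  · obtain ⟨D, hD, hev⟩ := hest
    obtain ⟨N, hN⟩ := eventually_atTop.1 hev
    exact ⟨D, hD, N, hN⟩
  obtain ⟨B, hB, hrate⟩ := Setup.exists_rate_le hs hsmall hlarge.2
  refine ⟨?_, fun τ hτ hτrate hsepτ => ?_⟩
  · obtain ⟨D, hD, hev⟩ := hest
    obtain ⟨N, hN⟩ := eventually_atTop.1 (hev.and hrate)
    refine ⟨D * B, by positivity, N, fun n hn x hx θ hθ => ((hN n hn).1 x hx θ hθ).trans ?_⟩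
    rw [mul_assoc]
    exact mul_le_mul_of_nonneg_left (hN n hn).2 hD.le
  obtain ⟨C3, hC3, hτ3⟩ := hτrate.exists_pos
  have hτle : ∀ᶠ n in atTop, Setup.rate (p n) n (R n) (s n) (lam n) η + τ n
      ≤ (1 + C3) * B * (lam n ^ 2 * s n) := by
    filter_upwards [hτ3.bound, hrate] with n h1 h2
    have hr0 := Setup.rate_nonneg (p := p n) (n := n) (R := R n) (lam := lam n) (η := η) (hs n).le
    have e : lam n ^ 2 * s n + (p n + s n * R n) * Real.log (p n) / n
        + s n * (R n : ℝ) ^ (-2 * η) = Setup.rate (p n) n (R n) (s n) (lam n) η := by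
      rw [Setup.rate]; ring
    rw [e, Real.norm_of_nonneg (hτ n), Real.norm_of_nonneg hr0] at h1
    have h3 := mul_le_mul_of_nonneg_left h2 (show 0 ≤ 1 + C3 by positivity)
    linarith
  have hmain : ∀ T : ℝ, 0 ≤ T → ∃ D : ℝ, 0 < D ∧ ∀ᶠ n in atTop, ∀ x ∈ A n, ∀ θ,
      (S n).IsNearOptimal C η (R n) (s n) (lam n) (τ n) x θ →
      ((S n).IsProfiled x θ ∨ τ n ≤ T) →
      (S n).varianceError θ ≤ D * (lam n ^ 2 * s n) := by
    intro T hT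
    obtain ⟨D, hD, hev⟩ := Setup.exists_eventual_rate hC hc hreg hR hsparse hsep hgood hT hτ hsepτ
    refine ⟨D * ((1 + C3) * B), by positivity, ?_⟩
    filter_upwards [hev, hτle] with n h1 h2 x hx θ hθ hprof
    refine (h1 x hx θ hθ hprof).trans ?_
    rw [mul_assoc]
    exact mul_le_mul_of_nonneg_left h2 hD.le
  refine ⟨?_, fun hτ1 => ?_⟩
  · obtain ⟨D, hD, hev⟩ := hmain 0 le_rfl
    obtain ⟨N, hN⟩ := eventually_atTop.1 hev
    exact ⟨D, hD, N, fun n hn x hx θ hθ hprof => hN n hn x hx θ hθ (Or.inl hprof)⟩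
  · obtain ⟨T, hT, hτT⟩ := hτ1.exists_pos
    obtain ⟨D, hD, hev⟩ := hmain T hT.le
    obtain ⟨N, hN⟩ := eventually_atTop.1 (hev.and hτT.bound)
    refine ⟨D, hD, N, fun n hn x hx θ hθ => (hN n hn).1 x hx θ hθ (Or.inr ?_)⟩
    have := (hN n hn).2
    rwa [Real.norm_of_nonneg (hτ n), norm_one, mul_one] at this
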